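/- A \emph{plane graph} is a finite connected directed graph $G$ (parallel edges allowed) embedded in $\mathbb{C}$, its edges drawn as polygonal arcs; its faces are the connected components of $\mathbb{C}\setminus G$, the unbounded one being exterior and the others interior. Paths are directed. A \emph{pasting scheme} $\mathcal P$ is a plane graph such that: (1) the edges with the exterior face on their left form a non-empty simple path $\mathrm{dom}_{\mathcal P}$, and the edges with the exterior face on their right form a non-empty simple path $\mathrm{cod}_{\mathcal P}$, both from a vertex $s$ to a vertex $t$; (2) for each interior face $F$, the edges with $F$ on their right form a non-empty simple path $\mathrm{dom}_F$, and those with $F$ on their left form a non-empty simple path $\mathrm{cod}_F$, with the same source and the same target, having no common edges and no other common vertices; (3) $s$ is the only vertex without incoming edges and $t$ is the only vertex without outgoing edges. Let $\mathfrak F\mathcal P$ be the free (strict) 2-category on the 2-computad whose objects are the vertices of $\mathcal P$, whose atomic 1-cells are its edges, and whose atomic 2-cells are the interior faces $F\colon \mathrm{dom}_F\Rightarrow\mathrm{cod}_F$. Let $N_*\mathfrak F\mathcal P$ be the simplicially enriched category obtained by applying the nerve to each hom-category. Thus its $n$-arrows $x\to y$ are the chains of $n$ vertically composable 2-cells $p_0\Rightarrow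 p_1\Rightarrow\cdots\Rightarrow p_n$ between paths $p_i$ from $x$ to $y$. At each vertex $v$, order the outgoing edges counterclockwise, starting from the incoming edges (if $v=s$: starting from the first edge of $\mathrm{cod}_{\mathcal P}$), and the incoming edges clockwise, starting from the outgoing edges (if $v=t$: starting from the last edge of $\mathrm{cod}_{\mathcal P}$). For paths $p,q$ from $x$ to $y$, say that $p$ \emph{lies above} $q$, written $p\ge q$, if at each common vertex $v$ of $p$ and $q$ the edge of $p$ entering $v$ is $\geq$ the edge of $q$ entering $v$, and the edge of $p$ leaving $v$ is $\geq$ the edge of $q$ leaving $v$ (where an absent edge is comparable only with an absent edge). A simplicially enriched category $\mathcal A$ is a \emph{simplicial computad} if for each $n\ge 0$ the category $\mathcal A_n$ of objects and $n$-arrows is free on a set of $n$-arrows, called atomic (that is, each $n$-arrow is the composite of a unique path of atomic $n$-arrows), and for each epimorphism $\sigma\colon[m]\to[n]$ of $\mathbf\Delta$ the functor $\sigma^*\colon\mathcal A_n\to\mathcal A_m$ preserves atomic arrows. \textbf{Proposition.} For each pasting scheme $\mathcal P$, $N_*\mathfrak F\mathcal P$ is a simplicial computad whose objects are the vertices of $\mathcal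 P$, whose atomic $0$-arrows $x\to y$ are the edges of $\mathcal P$ from $x$ to $y$, and whose atomic $n$-arrows $x\to y$, for every $n\ge 0$, correspond bijectively, by taking a chain of 2-cells $p_0\Rightarrow\cdots\Rightarrow p_n$ to the paths $(p_0,\dots,p_n)$, to the sequences of paths $p_0\ge p_1\ge\cdots\ge p_n$ from $x$ to $y$ with $x\ne y$, each $p_i$ lying above $p_{i+1}$, such that the only vertices that $p_0$ and $p_n$ have in common are $x$ and $y$. -/

import Mathlib

open CategoryTheory

universe u v w

/-- A 2-computad with underlying directed graph `V`: atomic 2-cells, each with a source path and a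
target path, which are parallel. -/
structure TwoComputad (V : Type u) [Quiver.{v} V] where
  Cell : V → V → Type w
  dom {x y : V} : Cell x y → Quiver.Path x y
  cod {x y : V} : Cell x y → Quiver.Path x y

namespace TwoComputad

variable {V : Type u} [Quiver.{v} V] (K : TwoComputad.{u, v, w} V)

/-- Formal horizontal and vertical composites of the atomic 2-cells and of identities of paths. -/
inductive Term : {x y : V} → Quiver.Path x y → Quiver.Path x y → Type (max u v w) where
  | atom {x y : V} (α : K.Cell x y) : Term (K.dom α) (K.cod α)
  | id {x y : V} (p : Quiver.Path x y) : Term p p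
  | vcomp {x y : V} {p q r : Quiver.Path x y} (a : Term p q) (b : Term q r) : Term p r
  | hcomp {x y z : V} {p q : Quiver.Path x y} {p' q' : Quiver.Path y z}
      (a : Term p q) (b : Term p' q') : Term (p.comp p') (q.comp q')

variable {K}

/-- The congruence generated by the axioms of a strict 2-category. Since composition of paths is
associative and unital only propositionally, it relates terms whose boundaries are equal but need
not be syntactically so (see `Rel.boundary`). -/
inductive Rel : {x y : V} → {p q p' q' : Quiver.Path x y} → K.Term p q → K.Term p' q' → Prop where
  | refl {x y : V} {p q : Quiver.Path x y} (a : K.Term p q) : Rel a a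
  | symm {x y : V} {p q p' q' : Quiver.Path x y} {a : K.Term p q} {b : K.Term p' q'} :
      Rel a b → Rel b a
  | trans {x y : V} {p q p' q' p'' q'' : Quiver.Path x y} {a : K.Term p q} {b : K.Term p' q'}
      {c : K.Term p'' q''} : Rel a b → Rel b c → Rel a c
  | vcomp_congr {x y : V} {p q r p' q' r' : Quiver.Path x y} {a : K.Term p q} {b : K.Term q r}
      {a' : K.Term p' q'} {b' : K.Term q' r'} :
      Rel a a' → Rel b b' → Rel (a.vcomp b) (a'.vcomp b')
  | hcomp_congr {x y z : V} {p q p' q' : Quiver.Path x y} {r s r' s' : Quiver.Path y z}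
      {a : K.Term p q} {a' : K.Term p' q'} {b : K.Term r s} {b' : K.Term r' s'} :
      Rel a a' → Rel b b' → Rel (a.hcomp b) (a'.hcomp b')
  | id_vcomp {x y : V} {p q : Quiver.Path x y} (a : K.Term p q) : Rel ((Term.id p).vcomp a) a
  | vcomp_id {x y : V} {p q : Quiver.Path x y} (a : K.Term p q) : Rel (a.vcomp (Term.id q)) a
  | vcomp_assoc {x y : V} {p q r s : Quiver.Path x y}
      (a : K.Term p q) (b : K.Term q r) (c : K.Term r s) :
      Rel ((a.vcomp b).vcomp c) (a.vcomp (b.vcomp c))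
  | id_hcomp_id {x y z : V} (p : Quiver.Path x y) (q : Quiver.Path y z) :
      Rel ((Term.id p).hcomp (Term.id q)) (Term.id (p.comp q))
  | interchange {x y z : V} {p q r : Quiver.Path x y} {p' q' r' : Quiver.Path y z}
      (a : K.Term p q) (b : K.Term q r) (a' : K.Term p' q') (b' : K.Term q' r') :
      Rel ((a.hcomp a').vcomp (b.hcomp b')) ((a.vcomp b).hcomp (a'.vcomp b'))
  | nil_hcomp {x y : V} {p q : Quiver.Path x y} (a : K.Term p q) :
      Rel ((Term.id Quiver.Path.nil).hcomp a) a
  | hcomp_nil {x y : V} {p q : Quiver.Path x y} (a : K.Term p q) :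
      Rel (a.hcomp (Term.id Quiver.Path.nil)) a
  | hcomp_assoc {x y z t : V} {p p' : Quiver.Path x y} {q q' : Quiver.Path y z}
      {r r' : Quiver.Path z t} (a : K.Term p p') (b : K.Term q q') (c : K.Term r r') :
      Rel ((a.hcomp b).hcomp c) (a.hcomp (b.hcomp c))

theorem Rel.boundary {x y : V} {p q p' q' : Quiver.Path x y} {a : K.Term p q}
    {b : K.Term p' q'} (h : Rel a b) : p = p' ∧ q = q' := by
  induction h <;> simp_all

variable (K) in
def termSetoid {x y : V} (p q : Quiver.Path x y) : Setoid (K.Term p q) where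
  r := Rel
  iseqv := ⟨Rel.refl, Rel.symm, Rel.trans⟩

/-- The 1-cells of the free 2-category: directed paths. -/
def OneCell (_K : TwoComputad.{u, v, w} V) (x y : V) : Type (max u v) := Quiver.Path x y

variable (K) in
/-- The 2-cells of the free 2-category. -/
def TwoCell {x y : V} (p q : Quiver.Path x y) : Type (max u v w) := Quotient (K.termSetoid p q)

def TwoCell.mk {x y : V} {p q : Quiver.Path x y} (a : K.Term p q) : K.TwoCell p q :=
  Quotient.mk (K.termSetoid p q) a

theorem TwoCell.mk_heq {x y : V} {p q p' q' : Quiver.Path x y} {a : K.Term p q}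
    {b : K.Term p' q'} (h : Rel a b) : HEq (mk a) (mk b) := by
  obtain ⟨rfl, rfl⟩ := h.boundary
  exact heq_of_eq (Quotient.sound (s := K.termSetoid p q) h)

theorem TwoCell.mk_eq {x y : V} {p q : Quiver.Path x y} {a b : K.Term p q} (h : Rel a b) :
    mk a = mk b := Quotient.sound (s := K.termSetoid p q) h

theorem TwoCell.exists_rep {x y : V} {p q : Quiver.Path x y} (a : K.TwoCell p q) :
    ∃ t : K.Term p q, mk t = a := Quotient.exists_rep (s := K.termSetoid p q) a

def TwoCell.vcomp {x y : V} {p q r : Quiver.Path x y} (a : K.TwoCell p q) (b : K.TwoCell q r) :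
    K.TwoCell p r :=
  Quotient.map₂ (sa := K.termSetoid p q) (sb := K.termSetoid q r) (sc := K.termSetoid p r)
    Term.vcomp (fun _ _ h _ _ h' => Rel.vcomp_congr h h') a b

def TwoCell.hcomp {x y z : V} {p q : Quiver.Path x y} {p' q' : Quiver.Path y z}
    (a : K.TwoCell p q) (b : K.TwoCell p' q') : K.TwoCell (p.comp p') (q.comp q') :=
  Quotient.map₂ (sa := K.termSetoid p q) (sb := K.termSetoid p' q')
    (sc := K.termSetoid (p.comp p') (q.comp q'))
    Term.hcomp (fun _ _ h _ _ h' => Rel.hcomp_congr h h') a b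

instance (x y : V) : Category.{max u v w} (K.OneCell x y) where
  Hom p q := K.TwoCell p q
  id p := TwoCell.mk (Term.id p)
  comp a b := TwoCell.vcomp a b
  id_comp a := by
    obtain ⟨a, rfl⟩ := TwoCell.exists_rep a; exact TwoCell.mk_eq (Rel.id_vcomp _)
  comp_id a := by
    obtain ⟨a, rfl⟩ := TwoCell.exists_rep a; exact TwoCell.mk_eq (Rel.vcomp_id _)
  assoc a b c := by
    obtain ⟨a, rfl⟩ := TwoCell.exists_rep a
    obtain ⟨b, rfl⟩ := TwoCell.exists_rep b
    obtain ⟨c, rfl⟩ := TwoCell.exists_rep c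
    exact TwoCell.mk_eq (Rel.vcomp_assoc _ _ _)

/-- The free 2-category on a 2-computad. -/
structure Free (K : TwoComputad.{u, v, w} V) : Type u where
  as : V

namespace Free

instance : CategoryStruct K.Free where
  Hom x y := K.OneCell x.as y.as
  id x := (Quiver.Path.nil : Quiver.Path x.as x.as)
  comp p q := Quiver.Path.comp p q

instance (x y : K.Free) : Category.{max u v w} (x ⟶ y) :=
  inferInstanceAs (Category.{max u v w} (K.OneCell x.as y.as))

instance : Category K.Free where
  id_comp p := Quiver.Path.nil_comp p
  comp_id p := Quiver.Path.comp_nil p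
  assoc p q r := Quiver.Path.comp_assoc p q r

def hComp {a b c : K.Free} {f f' : a ⟶ b} {g g' : b ⟶ c} (η : f ⟶ f') (θ : g ⟶ g') :
    f ≫ g ⟶ f' ≫ g' := TwoCell.hcomp (V := V) (K := K) η θ

theorem id_hComp_id {a b c : K.Free} (f : a ⟶ b) (g : b ⟶ c) :
    hComp (𝟙 f) (𝟙 g) = 𝟙 (f ≫ g) := TwoCell.mk_eq (Rel.id_hcomp_id _ _)

theorem hComp_comp {a b c : K.Free} {f₁ f₂ f₃ : a ⟶ b} {g₁ g₂ g₃ : b ⟶ c}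
    (η : f₁ ⟶ f₂) (η' : f₂ ⟶ f₃) (θ : g₁ ⟶ g₂) (θ' : g₂ ⟶ g₃) :
    hComp η θ ≫ hComp η' θ' = hComp (η ≫ η') (θ ≫ θ') := by
  obtain ⟨η, rfl⟩ := TwoCell.exists_rep η
  obtain ⟨η', rfl⟩ := TwoCell.exists_rep η'
  obtain ⟨θ, rfl⟩ := TwoCell.exists_rep θ
  obtain ⟨θ', rfl⟩ := TwoCell.exists_rep θ'
  exact TwoCell.mk_eq (Rel.interchange _ _ _ _)

theorem id_hComp {a b : K.Free} {f f' : a ⟶ b} (η : f ⟶ f') :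
    hComp (𝟙 (𝟙 a)) η = eqToHom (Category.id_comp f) ≫ η ≫ eqToHom (Category.id_comp f').symm := by
  have : HEq (hComp (𝟙 (𝟙 a)) η) η := by
    obtain ⟨η, rfl⟩ := TwoCell.exists_rep η
    exact TwoCell.mk_heq (Rel.nil_hcomp _)
  simp [← heq_eq_eq, this]

theorem hComp_id {a b : K.Free} {f f' : a ⟶ b} (η : f ⟶ f') :
    hComp η (𝟙 (𝟙 b)) = eqToHom (Category.comp_id f) ≫ η ≫ eqToHom (Category.comp_id f').symm := by
  have : HEq (hComp η (𝟙 (𝟙 b))) η := by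
    obtain ⟨η, rfl⟩ := TwoCell.exists_rep η
    exact TwoCell.mk_heq (Rel.hcomp_nil _)
  simp [← heq_eq_eq, this]

theorem hComp_assoc {a b c d : K.Free} {f f' : a ⟶ b} {g g' : b ⟶ c} {h h' : c ⟶ d}
    (η : f ⟶ f') (θ : g ⟶ g') (κ : h ⟶ h') :
    hComp (hComp η θ) κ = eqToHom (Category.assoc f g h) ≫ hComp η (hComp θ κ) ≫
      eqToHom (Category.assoc f' g' h').symm := by
  have : HEq (hComp (hComp η θ) κ) (hComp η (hComp θ κ)) := by
    obtain ⟨η, rfl⟩ := TwoCell.exists_rep η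
    obtain ⟨θ, rfl⟩ := TwoCell.exists_rep θ
    obtain ⟨κ, rfl⟩ := TwoCell.exists_rep κ
    exact TwoCell.mk_heq (Rel.hcomp_assoc _ _ _)
  simp [← heq_eq_eq, this]

theorem eqToHom_hComp_eqToHom {a b c : K.Free} {f f' : a ⟶ b} (α : f = f') {g g' : b ⟶ c}
    (β : g = g') : hComp (eqToHom α) (eqToHom β) = eqToHom (α ▸ β ▸ rfl) := by
  cases α; cases β; simp [id_hComp_id]

instance : Bicategory K.Free where
  homCategory := inferInstance
  whiskerLeft {_ _ _} f {_ _} η := hComp (𝟙 f) η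
  whiskerRight η h := hComp η (𝟙 h)
  associator f g h := eqToIso (Category.assoc f g h)
  leftUnitor f := eqToIso (Category.id_comp f)
  rightUnitor f := eqToIso (Category.comp_id f)
  whiskerLeft_id f g := id_hComp_id f g
  id_whiskerRight f g := id_hComp_id f g
  whiskerLeft_comp := by simp [hComp_comp]
  comp_whiskerRight := by simp [hComp_comp]
  id_whiskerLeft := id_hComp
  comp_whiskerLeft := by simp [← id_hComp_id, hComp_assoc]
  whiskerRight_id := hComp_id
  whiskerRight_comp := by simp [id_hComp_id, hComp_assoc]
  whisker_assoc := by simp [hComp_assoc]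
  whisker_exchange := by simp [hComp_comp]
  pentagon f g h i := by
    simp only [eqToIso.hom, ← eqToHom_refl _ rfl, eqToHom_hComp_eqToHom, eqToHom_trans]
  triangle f g := by
    simp only [eqToIso.hom, ← eqToHom_refl _ rfl, eqToHom_hComp_eqToHom, eqToHom_trans]

instance : Bicategory.Strict K.Free where
  id_comp := Category.id_comp
  comp_id := Category.comp_id
  assoc := Category.assoc
  leftUnitor_eqToIso _ := rfl
  rightUnitor_eqToIso _ := rfl
  associator_eqToIso _ _ _ := rfl

end Free
end TwoComputad

section
open Bicategory

/-- Horizontal composition in a bicategory, as a functor. -/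
@[simps]
def horizontalComp {B : Type u} [Bicategory.{w, v} B] (x y z : B) :
    (x ⟶ y) × (y ⟶ z) ⥤ (x ⟶ z) where
  obj f := f.1 ≫ f.2
  map {f g} η := η.1 ▷ f.2 ≫ g.1 ◁ η.2
  map_id f := by simp
  map_comp {f g h} η θ := by simp [whisker_exchange_assoc]

/-- The objects of the simplicial category `N_* B` obtained from a 2-category `B` by applying the
nerve to each hom-category. -/
structure HomwiseNerve (B : Type u) where
  as : B

namespace HomwiseNerve
open Opposite MonoidalCategory

variable {B : Type u} [Bicategory.{w, v} B] 

/-- Composition of `N_* B`: horizontal composition applied levelwise to chains of 2-cells. -/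
def comp (x y z : B) : nerve (x ⟶ y) ⊗ nerve (y ⟶ z) ⟶ nerve (x ⟶ z) where
  app _ := ↾fun ab => Functor.prod' ab.1 ab.2 ⋙ horizontalComp x y z

/-- Identities of `N_* B`: the constant chains at the identity 1-cells. -/
def unit (x : B) : 𝟙_ SSet.{max w v} ⟶ nerve (x ⟶ x) where
  app _ := ↾fun _ => (Functor.const _).obj (𝟙 x)

instance [Bicategory.Strict B] : EnrichedCategory SSet.{max w v} (HomwiseNerve B) where
  Hom x y := nerve (x.as ⟶ y.as)
  id x := unit x.as
  comp x y z := comp x.as y.as z.as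
  id_comp x y := by
    ext n f
    refine CategoryTheory.Functor.ext (fun i => Strict.id_comp _) (fun i j h => ?_)
    have e (g : x.as ⟶ y.as) : eqToHom (Strict.id_comp g) = (leftUnitor g).hom := by
      rw [Strict.leftUnitor_eqToIso]; rfl
    have e' (g : x.as ⟶ y.as) : eqToHom (Strict.id_comp g).symm = (leftUnitor g).inv := by
      rw [Strict.leftUnitor_eqToIso]; rfl
    change 𝟙 (𝟙 x.as) ▷ f.obj i ≫ 𝟙 x.as ◁ f.map h =
      eqToHom (Strict.id_comp _) ≫ f.map h ≫ eqToHom (Strict.id_comp _).symm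
    rw [e, e']
    simp
  comp_id x y := by
    ext n f
    refine CategoryTheory.Functor.ext (fun i => Strict.comp_id _) (fun i j h => ?_)
    have e (g : x.as ⟶ y.as) : eqToHom (Strict.comp_id g) = (rightUnitor g).hom := by
      rw [Strict.rightUnitor_eqToIso]; rfl
    have e' (g : x.as ⟶ y.as) : eqToHom (Strict.comp_id g).symm = (rightUnitor g).inv := by
      rw [Strict.rightUnitor_eqToIso]; rfl
    change f.map h ▷ 𝟙 y.as ≫ f.obj j ◁ 𝟙 (𝟙 y.as) =
      eqToHom (Strict.comp_id _) ≫ f.map h ≫ eqToHom (Strict.comp_id _).symm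
    rw [e, e']
    simp
  assoc x y z t := by
    ext n f
    refine CategoryTheory.Functor.ext (fun i => Strict.assoc _ _ _) (fun i j h => ?_)
    obtain ⟨a, b, c⟩ := f
    have e (p : x.as ⟶ y.as) (q : y.as ⟶ z.as) (r : z.as ⟶ t.as) :
        eqToHom (Strict.assoc p q r) = (associator p q r).hom := by
      rw [Strict.associator_eqToIso]; rfl
    have e' (p : x.as ⟶ y.as) (q : y.as ⟶ z.as) (r : z.as ⟶ t.as) :
        eqToHom (Strict.assoc p q r).symm = (associator p q r).inv := by
      rw [Strict.associator_eqToIso]; rfl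
    change (a.map h ▷ b.obj i ≫ a.obj j ◁ b.map h) ▷ c.obj i ≫ (a.obj j ≫ b.obj j) ◁ c.map h =
      eqToHom (Strict.assoc _ _ _) ≫
        (a.map h ▷ (b.obj i ≫ c.obj i) ≫
          a.obj j ◁ (b.map h ▷ c.obj i ≫ b.obj j ◁ c.map h)) ≫
        eqToHom (Strict.assoc _ _ _).symm
    rw [e, e']
    simp
end HomwiseNerve

/-- The category `𝒜ₙ` of objects and `n`-arrows of a simplicially enriched category `C`. -/
structure ArrowCat (C : Type u) (n : ℕ) where
  as : C

namespace ArrowCat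
open Opposite MonoidalCategory Simplicial

variable {C : Type u} [EnrichedCategory SSet.{w} C] {n : ℕ}

instance : Category.{w} (ArrowCat C n) where
  Hom x y := (x.as ⟶[SSet] y.as) _⦋n⦌
  id x := (eId SSet x.as).app (op ⦋n⦌) PUnit.unit
  comp {x y z} f g := (eComp SSet x.as y.as z.as).app (op ⦋n⦌) (f, g)
  id_comp {x y} f := congrArg (fun k => k.app (op ⦋n⦌) f) (e_id_comp SSet x.as y.as)
  comp_id {x y} f := congrArg (fun k => k.app (op ⦋n⦌) f) (e_comp_id SSet x.as y.as)
  assoc {x y z t} f g h :=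
    congrArg (fun k => k.app (op ⦋n⦌) (f, g, h)) (e_assoc SSet x.as y.as z.as t.as)

/-- The action `σ^* : 𝒜ₙ → 𝒜ₘ` of a simplicial operator `σ : [m] → [n]` on arrows. -/
def pullback {m n : ℕ} (σ : ⦋m⦌ ⟶ ⦋n⦌) {x y : C}
    (f : (⟨x⟩ : ArrowCat C n) ⟶ ⟨y⟩) : (⟨x⟩ : ArrowCat C m) ⟶ ⟨y⟩ :=
  (x ⟶[SSet] y).map σ.op f

end ArrowCat

/-- The inclusion of a family of arrows of a category. -/
def WideSubquiver.incl {C : Type u} [Category.{v} C] (S : WideSubquiver C) :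
    WideSubquiver.toType C S ⥤q C where
  obj x := x
  map f := f.1

/-- The category `C` is free on the family `S` of its arrows: each arrow of `C` is the composite of
a unique path of arrows in `S`. The arrows in `S` are the non-identity arrows of a reflexive directed
graph on which `C` is free. -/
def IsFreeOn {C : Type u} [Category.{v} C] (S : WideSubquiver C) : Prop :=
  ∀ x y : Paths (WideSubquiver.toType C S),
    Function.Bijective (fun p : x ⟶ y => (Paths.lift (WideSubquiver.incl S)).map p)

open Simplicial in
/-- The simplicially enriched category `C` is a simplicial computad, with the given atomic
`n`-arrows. -/
structure IsSimplicialComputad (C : Type u) [EnrichedCategory SSet.{w} C]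
    (atomic : ∀ n : ℕ, WideSubquiver (ArrowCat C n)) : Prop where
  free (n : ℕ) : IsFreeOn (atomic n)
  degeneracy {m n : ℕ} (σ : ⦋m⦌ ⟶ ⦋n⦌) [Epi σ] (x y : C)
    (f : (⟨x⟩ : ArrowCat C n) ⟶ ⟨y⟩) :
    f ∈ atomic n ⟨x⟩ ⟨y⟩ → ArrowCat.pullback σ f ∈ atomic m ⟨x⟩ ⟨y⟩

/-- The polygonal curve with breakpoints `b 0, b 1, b 2, …`, passing through `b i` at time `i`. -/
noncomputable def polyline (b : ℕ → ℂ) (t : ℝ) : ℂ :=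
  AffineMap.lineMap (b ⌊t⌋₊) (b (⌊t⌋₊ + 1)) (Int.fract t)

/-- A finite directed graph embedded in the plane, its edges drawn as polygonal arcs. Parallel edges
are allowed. The edge `e` is drawn as the polygonal arc with breakpoints
`pt e 0, …, pt e (len e)`. -/
structure PlaneGraph where
  V : Type
  E : Type
  [finite_V : Finite V]
  [finite_E : Finite E]
  src : E → V
  tgt : E → V
  pos : V → ℂ
  len : E → ℕ
  pt : E → ℕ → ℂ
  pos_injective : Function.Injective pos
  len_pos : ∀ e, 0 < len e
  pt_zero : ∀ e, pt e 0 = pos (src e)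
  pt_len : ∀ e, pt e (len e) = pos (tgt e)
  arc_ne_pos : ∀ e (t : ℝ) v, 0 < t → t < len e → polyline (pt e) t ≠ pos v
  arc_injective : ∀ e e' (t t' : ℝ), 0 < t → t < len e → 0 < t' → t' < len e' →
    polyline (pt e) t = polyline (pt e') t' → e = e' ∧ t = t'

namespace PlaneGraph

variable (G : PlaneGraph)

instance : Quiver G.V where
  Hom x y := {e : G.E // G.src e = x ∧ G.tgt e = y}

/-- The subset of the plane occupied by the graph. -/
def support : Set ℂ :=
  Set.range G.pos ∪ {z | ∃ e, ∃ t : ℝ, 0 ≤ t ∧ t ≤ G.len e ∧ z = polyline (G.pt e) t}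

/-- The open faces: the connected components of the complement of the graph. -/
def IsFace (F : Set ℂ) : Prop :=
  ∃ z, z ∉ G.support ∧ F = connectedComponentIn G.supportᶜ z

/-- Bounded faces are called interior. -/
def IsInteriorFace (F : Set ℂ) : Prop := G.IsFace F ∧ Bornology.IsBounded F

/-- The unbounded face is called exterior. -/
def IsExteriorFace (F : Set ℂ) : Prop := G.IsFace F ∧ ¬ Bornology.IsBounded F

open Topology in
/-- The edge `e` has `F` on its left: at some interior point of one of its segments, all points that
are slightly displaced to the left of the segment are in `F`. -/
def HasOnLeft (e : G.E) (F : Set ℂ) : Prop :=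
  ∃ i : ℕ, i < G.len e ∧ ∃ s : ℝ, 0 < s ∧ s < 1 ∧ ∀ᶠ δ : ℝ in 𝓝[>] 0,
    AffineMap.lineMap (G.pt e i) (G.pt e (i + 1)) s +
      δ * (Complex.I * (G.pt e (i + 1) - G.pt e i)) ∈ F

open Topology in
/-- The edge `e` has `F` on its right. -/
def HasOnRight (e : G.E) (F : Set ℂ) : Prop :=
  ∃ i : ℕ, i < G.len e ∧ ∃ s : ℝ, 0 < s ∧ s < 1 ∧ ∀ᶠ δ : ℝ in 𝓝[>] 0,
    AffineMap.lineMap (G.pt e i) (G.pt e (i + 1)) s -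
      δ * (Complex.I * (G.pt e (i + 1) - G.pt e i)) ∈ F

variable {G}

/-- The edges of a directed path, in order. -/
def edges {x : G.V} : {y : G.V} → Quiver.Path x y → List G.E
  | _, .nil => []
  | _, .cons p e => edges p ++ [e.1]

/-- The set `S` of edges forms the non-empty directed path `p` (without repeated vertices). -/
def FormsPath (S : Set G.E) {x y : G.V} (p : Quiver.Path x y) : Prop :=
  0 < p.length ∧ p.vertices.Nodup ∧ ∀ e, e ∈ edges p ↔ e ∈ S

variable (G)

/-- An anchorable interior face with source vertex `x` and target vertex `y`, together with its
source path and target path, which are determined by the face. -/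
structure AnchoredFace (x y : G.V) where
  face : Set ℂ
  isInteriorFace : G.IsInteriorFace face
  dom : Quiver.Path x y
  cod : Quiver.Path x y
  forms_dom : FormsPath {e | G.HasOnRight e face} dom
  forms_cod : FormsPath {e | G.HasOnLeft e face} cod
  disjoint_edges : ∀ e, e ∈ edges dom → e ∉ edges cod
  disjoint_vertices : ∀ v, v ∈ dom.vertices → v ∈ cod.vertices → v = x ∨ v = y

/-- The undirected graph underlying `G` is connected. -/
def IsConnected : Prop :=
  Nonempty G.V ∧
    ∀ x y : G.V, Relation.EqvGen (fun a b => ∃ e, G.src e = a ∧ G.tgt e = b) x y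

end PlaneGraph

/-- A pasting scheme: a finite connected anchorable plane graph in which the source and target
vertices `s` and `t` of the exterior face are the only local source and the only local sink.
The data `s`, `t`, `dom`, `cod` are determined by the plane graph. -/
structure PastingScheme where
  graph : PlaneGraph
  connected : graph.IsConnected
  s : graph.V
  t : graph.V
  dom : Quiver.Path s t
  cod : Quiver.Path s t
  forms_dom : PlaneGraph.FormsPath
    {e | ∃ F, graph.IsExteriorFace F ∧ graph.HasOnLeft e F} dom
  forms_cod : PlaneGraph.FormsPath
    {e | ∃ F, graph.IsExteriorFace F ∧ graph.HasOnRight e F} cod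
  anchorable : ∀ F, graph.IsInteriorFace F →
    ∃ x y, ∃ c : graph.AnchoredFace x y, c.face = F
  local_source : ∀ v, (∀ e, graph.tgt e ≠ v) ↔ v = s
  local_sink : ∀ v, (∀ e, graph.src e ≠ v) ↔ v = t

/-- The angle in `[0, 2π)` by which one has to turn counterclockwise from `a` to `b`. -/
noncomputable def ccwAngle (a b : ℂ) : ℝ := toIcoMod Real.two_pi_pos 0 (Complex.arg (b / a))

namespace PastingScheme

open PlaneGraph

variable (P : PastingScheme)

/-- The direction in which the edge `e` leaves its source. -/
def outDir (e : P.graph.E) : ℂ := P.graph.pt e 1 - P.graph.pt e 0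

/-- The direction in which the edge `e`, traversed backwards, leaves its target. -/
def inDir (e : P.graph.E) : ℂ := P.graph.pt e (P.graph.len e - 1) - P.graph.pt e (P.graph.len e)

/-- The order on the edges going out of `v`: `OutLE v e e'` if, going counterclockwise around `v` and
starting from any incoming edge (or, if `v = s`, from the first edge of `cod`), one meets `e` no later
than `e'`. -/
def OutLE (v : P.graph.V) (e e' : P.graph.E) : Prop :=
  (∀ f, P.graph.tgt f = v → ccwAngle (P.inDir f) (P.outDir e) ≤ ccwAngle (P.inDir f) (P.outDir e')) ∧
  (v = P.s → ∀ f ∈ edges P.cod, P.graph.src f = v →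
    ccwAngle (P.outDir f) (P.outDir e) ≤ ccwAngle (P.outDir f) (P.outDir e'))

/-- The order on the edges coming into `v`: `InLE v e e'` if, going clockwise around `v` and
starting from any outgoing edge (or, if `v = t`, from the last edge of `cod`), one meets `e` no later
than `e'`. -/
def InLE (v : P.graph.V) (e e' : P.graph.E) : Prop :=
  (∀ f, P.graph.src f = v → ccwAngle (P.inDir e) (P.outDir f) ≤ ccwAngle (P.inDir e') (P.outDir f)) ∧
  (v = P.t → ∀ f ∈ edges P.cod, P.graph.tgt f = v →
    ccwAngle (P.inDir e) (P.inDir f) ≤ ccwAngle (P.inDir e') (P.inDir f))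

variable {P}

open Classical in
/-- The edge of the path `p` coming into `v`, or `none`. -/
noncomputable def pred {x y : P.graph.V} (p : Quiver.Path x y) (v : P.graph.V) : Option P.graph.E :=
  (edges p).find? (fun e => P.graph.tgt e = v)

open Classical in
/-- The edge of the path `p` going out of `v`, or `none`. -/
noncomputable def succ {x y : P.graph.V} (p : Quiver.Path x y) (v : P.graph.V) : Option P.graph.E :=
  (edges p).find? (fun e => P.graph.src e = v)

/-- The path `p` lies above the parallel path `q`. (The value `none` of `pred` and `succ` is
comparable only with itself.) -/
def LiesAbove {x y : P.graph.V} (p q : Quiver.Path x y) : Prop :=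
  ∀ v, v ∈ p.vertices → v ∈ q.vertices →
    Option.Rel (P.InLE v) (pred q v) (pred p v) ∧ Option.Rel (P.OutLE v) (succ q v) (succ p v)

variable (P)

/-- The 2-computad of a pasting scheme: its atomic 2-cells are the interior faces. -/
def computad : TwoComputad.{0, 0, 0} P.graph.V where
  Cell x y := P.graph.AnchoredFace x y
  dom c := c.dom
  cod c := c.cod

/-- The free 2-category `𝔉 P` generated by a pasting scheme. -/
abbrev FreeTwoCategory : Type := P.computad.Free

/-- The simplicial category `N_* 𝔉 P`. -/
abbrev SimplicialCat : Type := HomwiseNerve P.FreeTwoCategory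

/-- A vertex as an object of `N_* 𝔉 P`. -/
def vertexObj (v : P.graph.V) : P.SimplicialCat := ⟨⟨v⟩⟩

/-- The set of `n`-arrows of `N_* 𝔉 P` from `x` to `y`. -/
abbrev NArrow (n : ℕ) (x y : P.graph.V) : Type :=
  (⟨P.vertexObj x⟩ : ArrowCat P.SimplicialCat n) ⟶ ⟨P.vertexObj y⟩

variable {P}

/-- The chain of paths `p₀, …, pₙ` underlying an `n`-arrow, which is a chain of `n` vertically
composable 2-cells `p₀ ⇒ ⋯ ⇒ pₙ`. -/
def NArrow.path {n : ℕ} {x y : P.graph.V} (f : P.NArrow n x y) (i : Fin (n + 1)) : Quiver.Path x y :=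
  Functor.obj (C := Fin (n + 1)) (D := P.computad.OneCell x y) f i

/-- An edge as a `0`-arrow of `N_* 𝔉 P`. -/
def edgeArrow {x y : P.graph.V} (e : x ⟶ y) : P.NArrow 0 x y :=
  ComposableArrows.mk₀ (C := P.computad.OneCell x y) (Quiver.Hom.toPath e)

end PastingScheme

/-! The theorem reduces to two facts about a pasting scheme: it has no directed cycles, and each
hom-category of the free 2-category is the poset of parallel paths under "lies above". Given these,
an `n`-arrow is just a descending chain of paths. By `LiesAbove.mem_vertices`, a vertex common to
the first and last path lies on every path of the chain. Cutting at all such vertices factors the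
chain into atomic pieces, and acyclicity makes the factorization unique.

The topology enters through integral 1-cycles. The winding number of a 1-cycle is constant on faces,
jumps across an edge by the coefficient of that edge and vanishes at infinity. Hence each 1-cycle is
the boundary of a unique 2-chain `pot` that vanishes on the exterior (`eq_pot_sub_pot`,
`pot_unique`). By duality, each cycle of the dual graph is the coboundary of a function on the
vertices (`exists_eq_sub_of_dual_cycle`).

Acyclicity (`eq_zero_of_isCirculation`) is a descent that alternates between primal and dual cycles.
A directed cycle encloses a set of faces that can be left in one sense only. Anchorability yields a
directed dual cycle in that set. Its potential on the vertices is monotone along edges and constant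
on the outer boundary, so its extremal vertices carry another directed cycle, which encloses
strictly fewer faces.

For parallel paths `p`, `q`, the 2-chain `between p q` with boundary `p - q` counts the faces
between them. The angle computation at a vertex (`between_left_out`, `between_left_in`) and an
argument about a minimal value show that `p` lies above `q` exactly when this chain is non-negative
(`liesAbove_iff`). In that case `exists_face_below` finds a face whose whole upper side lies on `p`.
Pushing down over such faces builds a 2-cell `p ⇒ q`. Any two such 2-cells agree by a diamond
argument: distinct first faces occupy disjoint stretches of `p`, so the interchange law lets them
commute (`rel_of_parallel`). -/

namespace PlaneGraph
open Topology Filter Set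

/-! ### Segments of the drawing and the faces beside a segment -/

instance (G : PlaneGraph) : Finite G.V := G.finite_V
instance (G : PlaneGraph) : Finite G.E := G.finite_E
noncomputable instance (G : PlaneGraph) : Fintype G.V := Fintype.ofFinite _
noncomputable instance (G : PlaneGraph) : Fintype G.E := Fintype.ofFinite _

variable (G : PlaneGraph)

/-- The displacement along the `j`-th segment of the edge `e`. -/
noncomputable def dir (e : G.E) (j : ℕ) : ℂ := G.pt e (j + 1) - G.pt e j

/-- The point at time `s` on the `j`-th segment of the edge `e`. -/
noncomputable def seg (e : G.E) (j : ℕ) (s : ℝ) : ℂ := G.pt e j + s * G.dir e j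

variable {G}

theorem lineMap_eq_seg (e : G.E) (j : ℕ) (s : ℝ) :
    AffineMap.lineMap (G.pt e j) (G.pt e (j + 1)) s = G.seg e j s := by
  simp [seg, dir, AffineMap.lineMap_apply, add_comm]

theorem seg_zero (e : G.E) (j : ℕ) : G.seg e j 0 = G.pt e j := by simp [seg]

theorem seg_one (e : G.E) (j : ℕ) : G.seg e j 1 = G.pt e (j + 1) := by simp [seg, dir]

theorem polyline_add (e : G.E) (j : ℕ) {s : ℝ} (h0 : 0 ≤ s) (h1 : s < 1) :
    polyline (G.pt e) (j + s) = G.seg e j s := by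
  have h : ⌊(j : ℝ) + s⌋₊ = j := by
    rw [Nat.floor_eq_iff (by positivity)]; constructor <;> linarith
  have h' : Int.fract ((j : ℝ) + s) = s := by
    rw [Int.fract_natCast_add, Int.fract_eq_self.2 ⟨h0, h1⟩]
  rw [polyline, h, h', lineMap_eq_seg]

theorem polyline_nat (e : G.E) (j : ℕ) : polyline (G.pt e) j = G.pt e j := by
  simpa [seg] using polyline_add e j le_rfl one_pos

theorem exists_polyline_eq (e : G.E) {t : ℝ} (h0 : 0 ≤ t) (h1 : t ≤ G.len e) :
    ∃ j < G.len e, ∃ s : ℝ, 0 ≤ s ∧ s ≤ 1 ∧ polyline (G.pt e) t = G.seg e j s := by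
  rcases h1.lt_or_eq with h1 | rfl
  · refine ⟨⌊t⌋₊, (Nat.floor_lt h0).2 h1, Int.fract t, Int.fract_nonneg _,
      (Int.fract_lt_one _).le, ?_⟩
    rw [polyline, lineMap_eq_seg]
  · have := G.len_pos e
    refine ⟨G.len e - 1, by omega, 1, by simp, le_rfl, ?_⟩
    rw [polyline_nat, seg_one, Nat.sub_add_cancel this]

/-- The time `j + s` with `0 < s < 1` determines both `j` and `s`, so injectivity of the arcs passes
to individual open segments. -/
theorem seg_injective {e e' : G.E} {j j' : ℕ} {s s' : ℝ} (hj : j < G.len e) (hj' : j' < G.len e')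
    (h0 : 0 < s) (h1 : s < 1) (h0' : 0 < s') (h1' : s' < 1) (h : G.seg e j s = G.seg e' j' s') :
    e = e' ∧ j = j' ∧ s = s' := by
  rw [← polyline_add e j h0.le h1, ← polyline_add e' j' h0'.le h1'] at h
  have hj2 : (j : ℝ) + 1 ≤ G.len e := by exact_mod_cast hj
  have hj2' : (j' : ℝ) + 1 ≤ G.len e' := by exact_mod_cast hj'
  have hn : (0 : ℝ) ≤ j := by positivity
  have hn' : (0 : ℝ) ≤ j' := by positivity
  obtain ⟨rfl, h⟩ := G.arc_injective e e' _ _ (by linarith) (by linarith) (by linarith)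
    (by linarith) h
  have hjj : j = j' := by
    have a : (j : ℝ) < j' + 1 := by linarith
    have b : (j' : ℝ) < j + 1 := by linarith
    norm_cast at a b
    omega
  subst hjj
  exact ⟨rfl, rfl, by linarith⟩

theorem seg_ne_pos {e : G.E} {j : ℕ} {s : ℝ} (hj : j < G.len e) (h0 : 0 < s) (h1 : s < 1)
    (v : G.V) : G.seg e j s ≠ G.pos v := by
  have hj2 : (j : ℝ) + 1 ≤ G.len e := by exact_mod_cast hj
  have hn : (0 : ℝ) ≤ j := by positivity
  rw [← polyline_add e j h0.le h1]
  exact G.arc_ne_pos e _ v (by linarith) (by linarith)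

theorem pt_ne_pos {e : G.E} {j : ℕ} (h0 : 0 < j) (hj : j < G.len e) (v : G.V) :
    G.pt e j ≠ G.pos v := by
  rw [← polyline_nat]
  exact G.arc_ne_pos e _ v (by exact_mod_cast h0) (by exact_mod_cast hj)

theorem pt_cases (e : G.E) {j : ℕ} (hj : j ≤ G.len e) :
    (j = 0 ∧ G.pt e j = G.pos (G.src e)) ∨ (j = G.len e ∧ G.pt e j = G.pos (G.tgt e)) ∨
      (0 < j ∧ j < G.len e) := by
  rcases Nat.eq_zero_or_pos j with rfl | h
  · exact Or.inl ⟨rfl, G.pt_zero e⟩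
  · rcases hj.lt_or_eq with h' | rfl
    · exact Or.inr (Or.inr ⟨h, h'⟩)
    · exact Or.inr (Or.inl ⟨rfl, G.pt_len e⟩)

theorem seg_ne_pt {e e' : G.E} {j j' : ℕ} {s : ℝ} (hj : j < G.len e) (h0 : 0 < s) (h1 : s < 1)
    (hj' : j' ≤ G.len e') : G.seg e j s ≠ G.pt e' j' := by
  rcases pt_cases e' hj' with ⟨-, h⟩ | ⟨-, h⟩ | ⟨h2, h3⟩
  · rw [h]; exact seg_ne_pos hj h0 h1 _
  · rw [h]; exact seg_ne_pos hj h0 h1 _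
  · have hj2 : (j : ℝ) + 1 ≤ G.len e := by exact_mod_cast hj
    have hn : (0 : ℝ) ≤ j := by positivity
    rw [← polyline_add e j h0.le h1, ← polyline_nat]
    intro h
    have := (G.arc_injective e e' _ _ (by linarith) (by linarith) (by exact_mod_cast h2)
      (by exact_mod_cast h3) h).2
    have a : (j : ℝ) < j' := by linarith
    have b : (j' : ℝ) < j + 1 := by linarith
    norm_cast at a b
    omega

theorem pt_injective {e e' : G.E} {j j' : ℕ} (h0 : 0 < j) (hj : j < G.len e) (hj' : j' ≤ G.len e')
    (h : G.pt e j = G.pt e' j') : e = e' ∧ j = j' := by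
  rcases pt_cases e' hj' with ⟨-, h'⟩ | ⟨-, h'⟩ | ⟨h2, h3⟩
  · exact absurd (h.trans h') (pt_ne_pos h0 hj _)
  · exact absurd (h.trans h') (pt_ne_pos h0 hj _)
  · rw [← polyline_nat, ← polyline_nat] at h
    have := G.arc_injective e e' _ _ (by exact_mod_cast h0) (by exact_mod_cast hj)
      (by exact_mod_cast h2) (by exact_mod_cast h3) h
    exact ⟨this.1, by exact_mod_cast this.2⟩

theorem dir_ne_zero {e : G.E} {j : ℕ} (hj : j < G.len e) : G.dir e j ≠ 0 := by
  intro h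
  refine seg_ne_pt (e := e) (s := 1 / 2) hj (by norm_num) (by norm_num) hj.le ?_
  simp [seg, h]

/-- The `j`-th closed segment of the edge `e`. -/
def closedSeg (e : G.E) (j : ℕ) : Set ℂ := {z | ∃ s : ℝ, 0 ≤ s ∧ s ≤ 1 ∧ z = G.seg e j s}

theorem isClosed_closedSeg (e : G.E) (j : ℕ) : IsClosed (closedSeg e j) := by
  have : closedSeg e j = (fun s : ℝ => G.seg e j s) '' Icc 0 1 := by
    ext z; simp only [closedSeg, mem_ofPred_eq, mem_image, mem_Icc]
    exact ⟨fun ⟨s, h, h', h''⟩ => ⟨s, ⟨h, h'⟩, h''.symm⟩, fun ⟨s, ⟨h, h'⟩, h''⟩ => ⟨s, h, h', h''.symm⟩⟩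
  rw [this]
  exact (isCompact_Icc.image (by unfold seg; fun_prop)).isClosed

theorem seg_mem_closedSeg_iff {e e' : G.E} {j j' : ℕ} {s : ℝ} (hj : j < G.len e)
    (hj' : j' < G.len e') (h0 : 0 < s) (h1 : s < 1) :
    G.seg e j s ∈ closedSeg e' j' ↔ e = e' ∧ j = j' := by
  refine ⟨?_, ?_⟩
  · rintro ⟨s', h0', h1', h⟩
    rcases h0'.eq_or_lt with rfl | h0'
    · rw [seg_zero] at h; exact absurd h (seg_ne_pt hj h0 h1 hj'.le)
    rcases h1'.eq_or_lt with rfl | h1'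
    · rw [seg_one] at h; exact absurd h (seg_ne_pt hj h0 h1 hj')
    obtain ⟨a, b, -⟩ := seg_injective hj hj' h0 h1 h0' h1' h
    exact ⟨a, b⟩
  · rintro ⟨rfl, rfl⟩; exact ⟨s, h0.le, h1.le, rfl⟩

theorem pt_mem_closedSeg {e e' : G.E} {j j' : ℕ} (h0 : 0 < j) (hj : j < G.len e)
    (hj' : j' < G.len e') (h : G.pt e j ∈ closedSeg e' j') : e = e' ∧ (j = j' ∨ j = j' + 1) := by
  obtain ⟨s', h0', h1', h⟩ := h
  rcases h0'.eq_or_lt with rfl | h0'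
  · rw [seg_zero] at h
    obtain ⟨a, b⟩ := pt_injective h0 hj hj'.le h
    exact ⟨a, Or.inl b⟩
  rcases h1'.eq_or_lt with rfl | h1'
  · rw [seg_one] at h
    obtain ⟨a, b⟩ := pt_injective h0 hj hj' h
    exact ⟨a, Or.inr b⟩
  exact absurd h.symm (seg_ne_pt hj' h0' h1' hj.le)

theorem mem_support_iff {z : ℂ} :
    z ∈ G.support ↔ z ∈ range G.pos ∨ ∃ e, ∃ j < G.len e, z ∈ closedSeg e j := by
  refine or_congr Iff.rfl ⟨?_, ?_⟩
  · rintro ⟨e, t, h0, h1, rfl⟩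
    obtain ⟨j, hj, s, hs0, hs1, h⟩ := exists_polyline_eq e h0 h1
    exact ⟨e, j, hj, s, hs0, hs1, h⟩
  · rintro ⟨e, j, hj, s, hs0, hs1, rfl⟩
    have hj2 : (j : ℝ) + 1 ≤ G.len e := by exact_mod_cast hj
    have hn : (0 : ℝ) ≤ j := by positivity
    rcases hs1.lt_or_eq with hs1 | rfl
    · exact ⟨e, j + s, by linarith, by linarith, (polyline_add e j hs0 hs1).symm⟩
    · refine ⟨e, (j + 1 : ℕ), by positivity, by exact_mod_cast hj, ?_⟩
      rw [polyline_nat, seg_one]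

theorem seg_mem_support {e : G.E} {j : ℕ} {s : ℝ} (hj : j < G.len e) (h0 : 0 ≤ s) (h1 : s ≤ 1) :
    G.seg e j s ∈ G.support := mem_support_iff.2 (Or.inr ⟨e, j, hj, s, h0, h1, rfl⟩)

/-- Near a point of the plane, the graph consists only of the segments through that point. -/
theorem exists_ball_support (n : ℂ) (hn : n ∉ range G.pos) :
    ∃ ρ > 0, ∀ z ∈ G.support, dist z n < ρ →
      ∃ e, ∃ j < G.len e, z ∈ closedSeg e j ∧ n ∈ closedSeg e j := by
  let I := {i : Σ e : G.E, Fin (G.len e) // n ∉ closedSeg i.1 i.2}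
  -- The vertices and the segments missing `n` form a finite union of closed sets, so some disc
  -- about `n` avoids them all.
  have hc : IsClosed (range G.pos ∪ ⋃ i : I, closedSeg i.1.1 i.1.2) :=
    (finite_range _).isClosed.union (isClosed_iUnion_of_finite fun i => isClosed_closedSeg _ _)
  have hnc : n ∉ range G.pos ∪ ⋃ i : I, closedSeg i.1.1 i.1.2 := by
    rintro (h | h)
    · exact hn h
    · obtain ⟨i, hi⟩ := mem_iUnion.1 h
      exact i.2 hi
  obtain ⟨ρ, hρ, h⟩ := Metric.isOpen_iff.1 hc.isOpen_compl n hnc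
  refine ⟨ρ, hρ, fun z hz hd => ?_⟩
  have hz' := h (Metric.mem_ball.2 hd)
  rcases mem_support_iff.1 hz with h1 | ⟨e, j, hj, h1⟩
  · exact absurd (Or.inl h1) hz'
  · refine ⟨e, j, hj, h1, ?_⟩
    by_contra h2
    exact hz' (Or.inr (mem_iUnion.2 ⟨⟨⟨e, ⟨j, hj⟩⟩, h2⟩, h1⟩))

theorem isClosed_support : IsClosed G.support := by
  have : G.support = range G.pos ∪ ⋃ i : Σ e : G.E, Fin (G.len e), closedSeg i.1 i.2 := by
    ext z
    rw [mem_support_iff, mem_union, mem_iUnion]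
    exact or_congr Iff.rfl ⟨fun ⟨e, j, hj, h⟩ => ⟨⟨e, ⟨j, hj⟩⟩, h⟩, fun ⟨i, h⟩ => ⟨i.1, i.2, i.2.2, h⟩⟩
  rw [this]
  exact (finite_range _).isClosed.union (isClosed_iUnion_of_finite fun i => isClosed_closedSeg _ _)

/-- The face containing a point off the graph. -/
def faceAt (z : ℂ) : Set ℂ := connectedComponentIn G.supportᶜ z

theorem faceAt_eq {z w : ℂ} (h : w ∈ G.faceAt z) : G.faceAt z = G.faceAt w :=
  connectedComponentIn_eq h

theorem mem_faceAt {z : ℂ} (h : z ∉ G.support) : z ∈ G.faceAt z := mem_connectedComponentIn h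

theorem isFace_faceAt {z : ℂ} (h : z ∉ G.support) : G.IsFace (G.faceAt z) := ⟨z, h, rfl⟩

theorem IsFace.eq_faceAt {F : Set ℂ} (hF : G.IsFace F) {z : ℂ} (h : z ∈ F) : F = G.faceAt z := by
  obtain ⟨w, -, rfl⟩ := hF
  exact faceAt_eq h

theorem IsFace.notMem_support {F : Set ℂ} (hF : G.IsFace F) {z : ℂ} (h : z ∈ F) :
    z ∉ G.support := by
  obtain ⟨w, -, rfl⟩ := hF
  exact connectedComponentIn_subset _ _ h

theorem IsFace.nonempty {F : Set ℂ} (hF : G.IsFace F) : F.Nonempty := by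
  obtain ⟨w, h, rfl⟩ := hF
  exact ⟨w, mem_faceAt h⟩

theorem IsFace.eq_of_mem {F F' : Set ℂ} (hF : G.IsFace F) (hF' : G.IsFace F') {z : ℂ} (h : z ∈ F)
    (h' : z ∈ F') : F = F' := (hF.eq_faceAt h).trans (hF'.eq_faceAt h').symm

theorem exists_face_of_isPreconnected {S : Set ℂ} (hS : IsPreconnected S) (hne : S.Nonempty)
    (h : Disjoint S G.support) : ∃ F, G.IsFace F ∧ S ⊆ F := by
  obtain ⟨z, hz⟩ := hne
  exact ⟨_, isFace_faceAt (disjoint_left.1 h hz), hS.subset_connectedComponentIn hz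
    (fun w hw => disjoint_left.1 h hw)⟩

theorem isOpen_faceAt (z : ℂ) : IsOpen (G.faceAt z) :=
  isClosed_support.isOpen_compl.connectedComponentIn

/-- All points that are slightly displaced from `z` in the direction `u` are in `F`. -/
def Ahead (z u : ℂ) (F : Set ℂ) : Prop := ∀ᶠ δ : ℝ in 𝓝[>] 0, z + δ * u ∈ F

theorem Ahead.unique {z u : ℂ} {F F' : Set ℂ} (h : Ahead z u F) (h' : Ahead z u F')
    (hF : G.IsFace F) (hF' : G.IsFace F') : F = F' := by
  obtain ⟨δ, a, b⟩ := (h.and h').exists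
  exact hF.eq_of_mem hF' a b

theorem exists_ball_seg {e : G.E} {j : ℕ} {s : ℝ} (hj : j < G.len e) (h0 : 0 < s) (h1 : s < 1) :
    ∃ ρ > 0, ∀ z ∈ G.support, dist z (G.seg e j s) < ρ →
      ∃ s' : ℝ, z = G.seg e j s' := by
  obtain ⟨ρ, hρ, h⟩ := exists_ball_support (G := G) (G.seg e j s)
    (by rintro ⟨v, hv⟩; exact seg_ne_pos hj h0 h1 v hv.symm)
  refine ⟨ρ, hρ, fun z hz hd => ?_⟩
  obtain ⟨e', j', hj', ⟨s', -, -, h2⟩, h3⟩ := h z hz hd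
  obtain ⟨rfl, rfl⟩ := (seg_mem_closedSeg_iff hj hj' h0 h1).1 h3
  exact ⟨s', h2⟩

/-- The half of the disc of radius `ρ` about `n`, on the side of the vector `u`. -/
def halfDisc (n u : ℂ) (ρ : ℝ) : Set ℂ := Metric.ball n ρ ∩ {z | 0 < ((z - n) / u).re}

theorem isPreconnected_halfDisc (n u : ℂ) (ρ : ℝ) : IsPreconnected (halfDisc n u ρ) := by
  refine ((convex_ball n ρ).inter ?_).isPreconnected
  intro z hz w hw a b ha hb hab
  have e : (a • z + b • w - n) / u = a • ((z - n) / u) + b • ((w - n) / u) := by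
    simp only [Complex.real_smul]
    have : (a : ℂ) + b = 1 := by exact_mod_cast hab
    linear_combination (n / u) * this
  simp only [mem_ofPred_eq] at hz hw ⊢
  rw [e, Complex.add_re, Complex.smul_re, Complex.smul_re, smul_eq_mul, smul_eq_mul]
  rcases ha.eq_or_lt with rfl | ha
  · have : b = 1 := by linarith
    simp [this, hw]
  · have := mul_pos ha hz
    have := mul_nonneg hb hw.le
    linarith

theorem mem_halfDisc {n u : ℂ} (hu : u ≠ 0) {ρ : ℝ} (z : ℂ) (hz : dist z n < ρ)
    (h : 0 ≤ ((z - n) / u).re) : Ahead z u (halfDisc n u ρ) := by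
  have hc : Tendsto (fun δ : ℝ => dist (z + δ * u) n) (𝓝[>] 0) (𝓝 (dist z n)) := by
    have : ContinuousAt (fun δ : ℝ => dist (z + δ * u) n) 0 := by fun_prop
    simpa [ContinuousAt] using this.tendsto.mono_left nhdsWithin_le_nhds
  filter_upwards [hc.eventually (gt_mem_nhds hz), self_mem_nhdsWithin] with δ h1 h2
  refine ⟨Metric.mem_ball.2 h1, ?_⟩
  have : (z + δ * u - n) / u = (z - n) / u + δ := by field_simp; ring
  simp only [mem_ofPred_eq, this, Complex.add_re, Complex.ofReal_re]
  have : 0 < δ := h2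
  linarith

/-- Inside the disc the graph lies on the line of the segment. That line bounds the half-disc, which
is convex and hence contained in a single face. -/
theorem halfDisc_face {e : G.E} {j : ℕ} {s : ℝ} (hj : j < G.len e)
    {τ : ℂ} (hτ : τ = Complex.I ∨ τ = -Complex.I) {ρ : ℝ} (hρ : 0 < ρ)
    (h : ∀ z ∈ G.support, dist z (G.seg e j s) < ρ → ∃ s' : ℝ, z = G.seg e j s') :
    ∃ F, G.IsFace F ∧ halfDisc (G.seg e j s) (τ * G.dir e j) ρ ⊆ F := by
  have hd := dir_ne_zero hj
  have hτ0 : τ ≠ 0 := by rcases hτ with rfl | rfl <;> simp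
  refine exists_face_of_isPreconnected (isPreconnected_halfDisc _ _ _) ?_ ?_
  · obtain ⟨δ, h⟩ := (mem_halfDisc (n := G.seg e j s) (mul_ne_zero hτ0 hd) (ρ := ρ) (G.seg e j s) (by simpa) (by simp)).exists
    exact ⟨_, h⟩
  · rw [disjoint_left]
    rintro z ⟨hz1, hz2⟩ hz
    obtain ⟨s', rfl⟩ := h z hz hz1
    have : (G.seg e j s' - G.seg e j s) / (τ * G.dir e j) = ((s' - s : ℝ) : ℂ) * τ⁻¹ := by
      simp only [seg]; field_simp; push_cast; ring
    rw [mem_ofPred_eq, this] at hz2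
    rcases hτ with rfl | rfl <;> simp at hz2

theorem eventually_ahead_seg {e : G.E} {j : ℕ} {s : ℝ} (hj : j < G.len e) (h0 : 0 < s)
    (h1 : s < 1) {τ : ℂ} (hτ : τ = Complex.I ∨ τ = -Complex.I) :
    ∃ F, G.IsFace F ∧ ∀ᶠ s' in 𝓝 s, Ahead (G.seg e j s') (τ * G.dir e j) F := by
  have hd := dir_ne_zero hj
  have hτ0 : τ ≠ 0 := by rcases hτ with rfl | rfl <;> simp
  obtain ⟨ρ, hρ, h⟩ := exists_ball_seg hj h0 h1
  obtain ⟨F, hF, hsub⟩ := halfDisc_face hj hτ hρ h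
  refine ⟨F, hF, ?_⟩
  have hc : ContinuousAt (fun s' : ℝ => dist (G.seg e j s') (G.seg e j s)) s := by
    unfold seg; fun_prop
  have := hc.eventually (gt_mem_nhds (by simpa using hρ : dist (G.seg e j s) (G.seg e j s) < ρ))
  filter_upwards [this] with s' hs'
  refine (mem_halfDisc (mul_ne_zero hτ0 hd) _ hs' ?_).mono fun δ hδ => hsub hδ
  have : (G.seg e j s' - G.seg e j s) / (τ * G.dir e j) = ((s' - s : ℝ) : ℂ) * τ⁻¹ := by
    simp only [seg]; field_simp; push_cast; ring
  rw [this]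
  rcases hτ with rfl | rfl <;> simp

theorem _root_.IsPreconnected.eq_of_eventually_eq {X Y : Type*} [TopologicalSpace X] {S : Set X}
    (hS : IsPreconnected S) {f : X → Y} (h : ∀ x ∈ S, ∀ᶠ y in 𝓝[S] x, f y = f x) {x y : X}
    (hx : x ∈ S) (hy : y ∈ S) : f x = f y := by
  have : PreconnectedSpace S := isPreconnected_iff_preconnectedSpace.1 hS
  have hl : IsLocallyConstant (fun z : S => f z) := by
    rw [IsLocallyConstant.iff_eventually_eq]
    intro z
    have := h z z.2
    rw [nhdsWithin_eq_map_subtype_coe z.2] at this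
    exact this
  exact hl.apply_eq_of_preconnectedSpace ⟨x, hx⟩ ⟨y, hy⟩

/-- The face beside a point of the open segment is locally constant in the parameter, and the
parameter interval is connected. -/
theorem exists_ahead_seg {e : G.E} {j : ℕ} (hj : j < G.len e) {τ : ℂ}
    (hτ : τ = Complex.I ∨ τ = -Complex.I) :
    ∃ F, G.IsFace F ∧ ∀ s : ℝ, 0 < s → s < 1 → Ahead (G.seg e j s) (τ * G.dir e j) F := by
  have H : ∀ s : ℝ, s ∈ Ioo (0 : ℝ) 1 →
      ∃ F, G.IsFace F ∧ ∀ᶠ s' in 𝓝 s, Ahead (G.seg e j s') (τ * G.dir e j) F :=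
    fun s hs => eventually_ahead_seg hj hs.1 hs.2 hτ
  choose! Φ h1 h2 using H
  have hc : ∀ s ∈ Ioo (0 : ℝ) 1, ∀ᶠ s' in 𝓝[Ioo 0 1] s, Φ s' = Φ s := by
    intro s hs
    filter_upwards [nhdsWithin_le_nhds (h2 s hs), self_mem_nhdsWithin] with s' a hs'
    exact (h2 s' hs').self_of_nhds.unique a (h1 s' hs') (h1 s hs)
  refine ⟨Φ (1 / 2), h1 _ (by norm_num), fun s h h' => ?_⟩
  rw [← isPreconnected_Ioo.eq_of_eventually_eq hc (x := s) ⟨h, h'⟩ (by norm_num)]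
  exact (h2 s ⟨h, h'⟩).self_of_nhds

end PlaneGraph

/-! ### The two faces of an edge, and connectivity of the faces by crossing edges -/

namespace PlaneGraph
open Topology Filter Set

variable {G : PlaneGraph}

theorem exists_int_of_exp_eq {u : ℂ} {r : ℝ} (hr : 0 ≤ r) (h : Complex.exp u = r) :
    ∃ n : ℤ, u.im = n * (2 * Real.pi) := by
  have hr0 : 0 < r := by
    refine lt_of_le_of_ne hr ?_
    rintro rfl
    exact Complex.exp_ne_zero u (by simp [h])
  rw [← Real.exp_log hr0, Complex.ofReal_exp, Complex.exp_eq_exp_iff_exists_int] at h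
  obtain ⟨n, hn⟩ := h
  refine ⟨n, ?_⟩
  rw [hn]
  simp

/-- The open sector at `n` swept counterclockwise through the angle `Θ` from the direction `β`. -/
def sector (n β : ℂ) (Θ ρ : ℝ) : Set ℂ :=
  (fun w => n + β * Complex.exp w) '' {w | w.re < Real.log ρ ∧ 0 < w.im ∧ w.im < Θ}

theorem isPreconnected_sector (n β : ℂ) (Θ ρ : ℝ) : IsPreconnected (sector n β Θ ρ) := by
  refine IsPreconnected.image ?_ _ (by fun_prop)
  refine Convex.isPreconnected ?_
  exact (convex_halfSpace_re_lt _).inter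
    ((convex_halfSpace_im_gt _).inter (convex_halfSpace_im_lt _))

/-- The open sector from `β` counterclockwise to `η` contains no point of the graph. As the
exponential image of a convex set it is connected even when reflex. It touches the first ray from
the left and the second from the right. -/
theorem sector_face {n β η w₀ : ℂ} (hβ : β ≠ 0) (hη : η = β * Complex.exp w₀) (h0 : 0 < w₀.im)
    (h1 : w₀.im < 2 * Real.pi) {ρ : ℝ} (hρ : 0 < ρ)
    (h : ∀ z ∈ G.support, dist z n < ρ → ∃ r : ℝ, 0 ≤ r ∧ (z = n + r * β ∨ z = n + r * η)) :
    ∃ F, G.IsFace F ∧ ∃ r₀ > 0, ∀ s : ℝ, 0 < s → s < r₀ →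
      Ahead (n + s * β) (Complex.I * β) F ∧ Ahead (n + s * η) (-Complex.I * η) F := by
  have hβn : 0 < ‖β‖ := norm_pos_iff.2 hβ
  obtain ⟨F, hF, hsub⟩ : ∃ F, G.IsFace F ∧ sector n β w₀.im (ρ / ‖β‖) ⊆ F := by
    refine exists_face_of_isPreconnected (isPreconnected_sector _ _ _ _) ?_ ?_
    · refine ⟨_, ⟨⟨Real.log (ρ / ‖β‖) - 1, w₀.im / 2⟩, ⟨?_, ?_, ?_⟩, rfl⟩⟩ <;> dsimp only <;> linarith
    · rw [disjoint_left]
      rintro _ ⟨w, ⟨hw, hw0, hw1⟩, rfl⟩ hz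
      obtain ⟨r, hr, h' | h'⟩ := h _ hz (by
        rw [dist_eq_norm, add_sub_cancel_left, norm_mul, Complex.norm_exp, mul_comm, ← lt_div_iff₀ hβn]
        exact (Real.lt_log_iff_exp_lt (by positivity)).1 hw)
      · have : Complex.exp w = r := by
          apply mul_left_cancel₀ hβ; linear_combination h'
        obtain ⟨k, hk⟩ := exists_int_of_exp_eq hr this
        have hp := Real.pi_pos
        have a : (0 : ℝ) < k := by by_contra hh; nlinarith
        have b : (k : ℝ) < 1 := by by_contra hh; nlinarith
        norm_cast at a b
        omega
      · have : Complex.exp (w - w₀) = r := by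
          rw [Complex.exp_sub, div_eq_iff (Complex.exp_ne_zero _)]
          apply mul_left_cancel₀ hβ; rw [hη] at h'; linear_combination h'
        obtain ⟨k, hk⟩ := exists_int_of_exp_eq hr this
        rw [Complex.sub_im] at hk
        have hp := Real.pi_pos
        have a : (k : ℝ) < 0 := by by_contra hh; nlinarith
        have b : (-1 : ℝ) < k := by by_contra hh; nlinarith
        norm_cast at a
        have b' : (-1 : ℤ) < k := by exact_mod_cast b
        omega
  have hcont : ∀ s : ℝ, 0 < s → ∀ σ : ℝ, Tendsto (fun δ : ℝ => Complex.log (s + δ * (σ * Complex.I)))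
      (𝓝[>] 0) (𝓝 (Complex.log s)) := by
    intro s hs σ
    have h1 : ContinuousAt (fun δ : ℝ => Complex.log (s + δ * (σ * Complex.I))) 0 := by
      refine ContinuousAt.clog (by fun_prop) ?_
      simp [Complex.mem_slitPlane_iff, hs]
    simpa [ContinuousAt] using h1.tendsto.mono_left nhdsWithin_le_nhds
  have hre : ∀ s : ℝ, (Complex.log s).re = Real.log s := fun s => by
    rw [Complex.log_ofReal_re]
  have him : ∀ s : ℝ, 0 < s → (Complex.log s).im = 0 := fun s hs => by
    rw [Complex.log_im, Complex.arg_ofReal_of_nonneg hs.le]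
  refine ⟨F, hF, min (ρ / ‖β‖) (ρ / ‖β‖ / Real.exp w₀.re), by positivity, fun s hs0 hs1 => ⟨?_, ?_⟩⟩
  · have hre1 : (Complex.log s).re < Real.log (ρ / ‖β‖) := by
      rw [hre]; exact Real.log_lt_log hs0 (hs1.trans_le (min_le_left _ _))
    have hl := hcont s hs0 1
    filter_upwards [(Complex.continuous_re.continuousAt.tendsto.comp hl).eventually (gt_mem_nhds hre1),
      (Complex.continuous_im.continuousAt.tendsto.comp hl).eventually
        (gt_mem_nhds (by rw [him s hs0]; exact h0 : (Complex.log s).im < w₀.im)),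
      self_mem_nhdsWithin] with δ a b c
    have hδ : 0 < δ := c
    refine hsub ⟨Complex.log (s + δ * ((1 : ℝ) * Complex.I)), ⟨a, ?_, b⟩, ?_⟩
    · rw [Complex.log_im]
      refine lt_of_le_of_ne (Complex.arg_nonneg_iff.2 (by simp [hδ.le])) fun h => ?_
      have := (Complex.arg_eq_zero_iff.1 h.symm).2
      simp at this
      linarith
    · dsimp only
      rw [Complex.exp_log]
      · push_cast; ring
      · intro h
        have := congrArg Complex.re h
        simp at this
        linarith
  · have hre1 : (w₀ + Complex.log s).re < Real.log (ρ / ‖β‖) := by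
      rw [Complex.add_re, hre]
      have := Real.log_lt_log hs0 (hs1.trans_le (min_le_right _ _))
      rw [Real.log_div (by positivity) (Real.exp_pos _).ne', Real.log_exp] at this
      linarith
    have hl := (hcont s hs0 (-1)).const_add w₀
    filter_upwards [(Complex.continuous_re.continuousAt.tendsto.comp hl).eventually (gt_mem_nhds hre1),
      (Complex.continuous_im.continuousAt.tendsto.comp hl).eventually
        (lt_mem_nhds (by rw [Complex.add_im, him s hs0]; linarith : 0 < (w₀ + Complex.log s).im)),
      self_mem_nhdsWithin] with δ a b c
    have hδ : 0 < δ := c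
    refine hsub ⟨w₀ + Complex.log (s + δ * ((-1 : ℝ) * Complex.I)), ⟨a, b, ?_⟩, ?_⟩
    · rw [Complex.add_im, Complex.log_im, add_lt_iff_neg_left, Complex.arg_neg_iff]
      simpa using hδ
    · dsimp only
      rw [Complex.exp_add, Complex.exp_log, hη]
      · push_cast; ring
      · intro h
        have := congrArg Complex.re h
        simp at this
        linarith

theorem exists_exp_of_not_sameRay {β η : ℂ} (hβ : β ≠ 0) (hη : η ≠ 0)
    (h : ∀ r : ℝ, 0 < r → η ≠ r * β) :
    ∃ w₀ : ℂ, η = β * Complex.exp w₀ ∧ 0 < w₀.im ∧ w₀.im < 2 * Real.pi := by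
  have h0 : η / β ≠ 0 := div_ne_zero hη hβ
  have hpi := Real.pi_pos
  have e : η = β * Complex.exp (Complex.log (η / β)) := by
    rw [Complex.exp_log h0]; field_simp
  have hl := Complex.neg_pi_lt_arg (η / β)
  have hu := Complex.arg_le_pi (η / β)
  rw [← Complex.log_im] at hl hu
  rcases lt_trichotomy (Complex.log (η / β)).im 0 with h1 | h1 | h1
  · refine ⟨Complex.log (η / β) + 2 * Real.pi * Complex.I, ?_, ?_, ?_⟩
    · rw [Complex.exp_add, Complex.exp_two_pi_mul_I, mul_one]; exact e
    · simp; linarith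
    · simp; linarith
  · exfalso
    refine h (Real.exp (Complex.log (η / β)).re) (Real.exp_pos _) ?_
    have h2 : ((Complex.log (η / β)).re : ℂ) = Complex.log (η / β) :=
      Complex.ext (by simp) (by rw [h1, Complex.ofReal_im])
    rw [Complex.ofReal_exp, h2, mul_comm]
    exact e
  · exact ⟨_, e, h1, by linarith⟩

/-- A segment doubling back on its predecessor would overlap it, against injectivity of the arc.
This guarantees a non-degenerate sector on each side of a bend. -/
theorem not_sameRay_bend {e : G.E} {j : ℕ} (hj : j + 1 < G.len e) (r : ℝ) (hr : 0 < r) :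
    -G.dir e j ≠ r * G.dir e (j + 1) := by
  intro h
  let s := min (1 / 2) (1 / (2 * r))
  have hs : 0 < s := by positivity
  have hs1 : s < 1 := (min_le_left _ _).trans_lt (by norm_num)
  have hrs : r * s < 1 := by
    calc r * s ≤ r * (1 / (2 * r)) := by gcongr; exact min_le_right _ _
      _ = 1 / 2 := by field_simp
      _ < 1 := by norm_num
  have := (seg_injective (e := e) (e' := e) (j := j) (j' := j + 1) (s := 1 - s) (s' := r * s)
    (by omega) hj (by linarith) (by linarith) (by positivity) hrs (by
      rw [← sub_eq_zero]
      have h2 : G.pt e (j + 1) = G.pt e j + G.dir e j := by simp [dir]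
      simp only [seg, h2]
      push_cast
      linear_combination (s : ℂ) * h)).2.1
  omega

theorem exists_ball_bend {e : G.E} {j : ℕ} (hj : j + 1 < G.len e) :
    ∃ ρ > 0, ∀ z ∈ G.support, dist z (G.pt e (j + 1)) < ρ →
      ∃ r : ℝ, 0 ≤ r ∧ (z = G.pt e (j + 1) + r * G.dir e (j + 1) ∨
        z = G.pt e (j + 1) + r * (-G.dir e j)) := by
  obtain ⟨ρ, hρ, h⟩ := exists_ball_support (G := G) (G.pt e (j + 1))
    (by rintro ⟨v, hv⟩; exact pt_ne_pos (Nat.succ_pos j) hj v hv.symm)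
  refine ⟨ρ, hρ, fun z hz hd => ?_⟩
  obtain ⟨e', j', hj', ⟨s, hs0, hs1, rfl⟩, h3⟩ := h z hz hd
  obtain ⟨rfl, h4⟩ := pt_mem_closedSeg (Nat.succ_pos j) hj hj' h3
  rcases h4 with rfl | h4
  · exact ⟨s, hs0, Or.inl rfl⟩
  · obtain rfl : j = j' := by omega
    refine ⟨1 - s, by linarith, Or.inr ?_⟩
    simp only [seg, dir]; push_cast; ring

theorem ahead_bend {e : G.E} {j : ℕ} (hj : j + 1 < G.len e) {τ : ℂ}
    (hτ : τ = Complex.I ∨ τ = -Complex.I) :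
    ∃ F, G.IsFace F ∧ ∃ s : ℝ, 0 < s ∧ s < 1 ∧
      Ahead (G.seg e j (1 - s)) (τ * G.dir e j) F ∧
      Ahead (G.seg e (j + 1) s) (τ * G.dir e (j + 1)) F := by
  obtain ⟨ρ, hρ, h⟩ := exists_ball_bend hj
  have hβ := dir_ne_zero hj
  have hη := neg_ne_zero.2 (dir_ne_zero (Nat.lt_of_succ_lt hj))
  have hr := not_sameRay_bend hj
  have e1 (s : ℝ) : G.pt e (j + 1) + s * (-G.dir e j) = G.seg e j (1 - s) := by
    simp only [seg, dir]; push_cast; ring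
  -- The left side of the bend is the sector from the next segment counterclockwise to the reversed
  -- previous one. The right side is the complementary sector, with the two rays exchanged.
  rcases hτ with rfl | rfl
  · obtain ⟨w₀, h1, h2, h3⟩ := exists_exp_of_not_sameRay hβ hη hr
    obtain ⟨F, hF, r₀, hr₀, H⟩ := sector_face hβ h1 h2 h3 hρ h
    refine ⟨F, hF, min (1 / 2) (r₀ / 2), by positivity, (min_le_left _ _).trans_lt (by norm_num), ?_⟩
    obtain ⟨a, b⟩ := H (min (1 / 2) (r₀ / 2)) (by positivity)
      ((min_le_right _ _).trans_lt (by linarith))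
    refine ⟨?_, a⟩
    rw [e1, neg_mul_neg] at b
    exact b
  · obtain ⟨w₀, h1, h2, h3⟩ := exists_exp_of_not_sameRay hη hβ (fun r h h' => hr r⁻¹ (by positivity) (by
      have : (r : ℂ) ≠ 0 := by exact_mod_cast h.ne'
      rw [h']; push_cast; field_simp))
    obtain ⟨F, hF, r₀, hr₀, H⟩ := sector_face hη h1 h2 h3 hρ (fun z hz hd => by
      obtain ⟨r, hr, h⟩ := h z hz hd
      exact ⟨r, hr, h.symm⟩)
    refine ⟨F, hF, min (1 / 2) (r₀ / 2), by positivity, (min_le_left _ _).trans_lt (by norm_num), ?_⟩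
    obtain ⟨a, b⟩ := H (min (1 / 2) (r₀ / 2)) (by positivity)
      ((min_le_right _ _).trans_lt (by linarith))
    refine ⟨?_, b⟩
    rw [e1] at a
    simpa using a

/-- The face is constant along each segment and unchanged at each bend, so a single face accompanies
one side of the whole edge. -/
theorem exists_ahead {e : G.E} {τ : ℂ} (hτ : τ = Complex.I ∨ τ = -Complex.I) :
    ∃ F, G.IsFace F ∧ ∀ j < G.len e, ∀ s : ℝ, 0 < s → s < 1 →
      Ahead (G.seg e j s) (τ * G.dir e j) F := by
  obtain ⟨F, hF, h⟩ := exists_ahead_seg (G.len_pos e) hτ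
  refine ⟨F, hF, fun j => ?_⟩
  induction j with
  | zero => exact fun _ => h
  | succ j ih =>
    intro hj
    obtain ⟨F', hF', s, hs0, hs1, h1, h2⟩ := ahead_bend hj hτ
    obtain ⟨F'', hF'', h3⟩ := exists_ahead_seg hj hτ
    have a : F = F' := (ih (by omega) (1 - s) (by linarith) (by linarith)).unique h1 hF hF'
    have b : F'' = F' := (h3 s hs0 hs1).unique h2 hF'' hF'
    rw [a, ← b]
    exact h3

/-- The faces of a plane graph. -/
def Face (G : PlaneGraph) : Type := {F : Set ℂ // G.IsFace F}

/-- The face on the left of an edge. -/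
noncomputable def left (e : G.E) : G.Face :=
  ⟨(exists_ahead (e := e) (Or.inl rfl)).choose, (exists_ahead (Or.inl rfl)).choose_spec.1⟩

/-- The face on the right of an edge. -/
noncomputable def right (e : G.E) : G.Face :=
  ⟨(exists_ahead (e := e) (Or.inr rfl)).choose, (exists_ahead (Or.inr rfl)).choose_spec.1⟩

theorem ahead_left {e : G.E} {j : ℕ} (hj : j < G.len e) {s : ℝ} (h0 : 0 < s) (h1 : s < 1) :
    Ahead (G.seg e j s) (Complex.I * G.dir e j) (left e).1 :=
  (exists_ahead (e := e) (Or.inl rfl)).choose_spec.2 j hj s h0 h1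

theorem ahead_right {e : G.E} {j : ℕ} (hj : j < G.len e) {s : ℝ} (h0 : 0 < s) (h1 : s < 1) :
    Ahead (G.seg e j s) (-Complex.I * G.dir e j) (right e).1 :=
  (exists_ahead (e := e) (Or.inr rfl)).choose_spec.2 j hj s h0 h1

theorem hasOnLeft_iff (e : G.E) (F : G.Face) : G.HasOnLeft e F.1 ↔ left e = F := by
  constructor
  · rintro ⟨j, hj, s, h0, h1, h⟩
    rw [lineMap_eq_seg] at h
    exact Subtype.ext ((ahead_left hj h0 h1).unique h (left e).2 F.2)
  · rintro rfl
    refine ⟨0, G.len_pos e, 1 / 2, by norm_num, by norm_num, ?_⟩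
    rw [lineMap_eq_seg]
    exact ahead_left (G.len_pos e) (by norm_num) (by norm_num)

theorem hasOnRight_iff (e : G.E) (F : G.Face) : G.HasOnRight e F.1 ↔ right e = F := by
  constructor
  · rintro ⟨j, hj, s, h0, h1, h⟩
    rw [lineMap_eq_seg] at h
    refine Subtype.ext ((ahead_right hj h0 h1).unique ?_ (right e).2 F.2)
    refine h.mono fun δ h => ?_
    rwa [sub_eq_add_neg, ← mul_neg, ← neg_mul] at h
  · rintro rfl
    refine ⟨0, G.len_pos e, 1 / 2, by norm_num, by norm_num, ?_⟩
    rw [lineMap_eq_seg]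
    refine (ahead_right (e := e) (G.len_pos e) (s := 1 / 2) (by norm_num) (by norm_num)).mono
      fun δ h => ?_
    rwa [sub_eq_add_neg, ← mul_neg, ← neg_mul]

/-- The face containing a point off the graph. -/
def face (z : ℂ) (hz : z ∉ G.support) : G.Face := ⟨G.faceAt z, isFace_faceAt hz⟩

open Classical in
/-- The face containing a point, or the left face of the edge through that point. -/
noncomputable def leftFaceAt (z : ℂ) : Set ℂ :=
  if h : ∃ e : G.E, ∃ j < G.len e, ∃ s : ℝ, 0 < s ∧ s < 1 ∧ z = G.seg e j s then
    (left h.choose).1 else G.faceAt z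

theorem leftFaceAt_seg {e : G.E} {j : ℕ} (hj : j < G.len e) {s : ℝ} (h0 : 0 < s) (h1 : s < 1) :
    G.leftFaceAt (G.seg e j s) = (left e).1 := by
  have h : ∃ e' : G.E, ∃ j' < G.len e', ∃ s' : ℝ, 0 < s' ∧ s' < 1 ∧ G.seg e j s = G.seg e' j' s' :=
    ⟨e, j, hj, s, h0, h1, rfl⟩
  rw [leftFaceAt, dif_pos h]
  obtain ⟨j', hj', s', h0', h1', h2⟩ := h.choose_spec
  rw [← (seg_injective hj hj' h0 h1 h0' h1' h2).1]

theorem leftFaceAt_of_notMem {z : ℂ} (hz : z ∉ G.support) : G.leftFaceAt z = G.faceAt z := by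
  rw [leftFaceAt, dif_neg]
  rintro ⟨e, j, hj, s, h0, h1, rfl⟩
  exact hz (seg_mem_support hj h0.le h1.le)

/-- A set of faces closed under crossing edges contains all faces or none. -/
theorem mem_of_forall_left_iff_right {S : Set G.Face} (h : ∀ e, left e ∈ S ↔ right e ∈ S)
    {F F' : G.Face} (hF : F ∈ S) : F' ∈ S := by
  -- Away from vertices and breakpoints the graph looks locally like a line or is empty. Removing
  -- these finitely many points leaves the plane connected.
  let N : Set ℂ := range G.pos ∪ range (fun i : Σ e : G.E, Fin (G.len e + 1) => G.pt i.1 i.2)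
  have hN : N.Finite := (finite_range _).union (finite_range _)
  have hconn : IsPreconnected Nᶜ :=
    (hN.countable.isPathConnected_compl_of_one_lt_rank
      (by rw [Complex.rank_real_complex]; norm_num)).isConnected.isPreconnected
  -- Points on an edge are assigned its left face. By the crossing hypothesis the predicate is then
  -- locally constant also at points of the graph.
  let Q : ℂ → Prop := fun z => G.leftFaceAt z ∈ (Subtype.val '' S : Set (Set ℂ))
  have hval : ∀ F : G.Face, F.1 ∈ (Subtype.val '' S : Set (Set ℂ)) ↔ F ∈ S := fun F =>
    ⟨fun ⟨F', h, h'⟩ => Subtype.ext h' ▸ h, fun h => ⟨F, h, rfl⟩⟩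
  have hloc : ∀ z ∈ Nᶜ, ∀ᶠ w in 𝓝[Nᶜ] z, Q w = Q z := by
    intro z hz
    by_cases hzs : z ∈ G.support
    · obtain h1 | ⟨e, j, hj, s, h0, h1, rfl⟩ := mem_support_iff.1 hzs
      · exact absurd (Or.inl h1) hz
      have hpt : ∀ k ≤ G.len e, G.pt e k ∈ N := fun k hk =>
        Or.inr ⟨⟨e, ⟨k, by omega⟩⟩, rfl⟩
      have h0 : 0 < s := h0.lt_of_ne (by rintro rfl; exact hz (by rw [seg_zero]; exact hpt j hj.le))
      have h1 : s < 1 := h1.lt_of_ne (by rintro rfl; exact hz (by rw [seg_one]; exact hpt _ hj))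
      obtain ⟨ρ, hρ, hb⟩ := exists_ball_seg hj h0 h1
      have hd := dir_ne_zero hj
      obtain ⟨F1, hF1, hs1⟩ := halfDisc_face hj (Or.inl rfl) hρ hb
      obtain ⟨F2, hF2, hs2⟩ := halfDisc_face hj (Or.inr rfl) hρ hb
      have e1 : left e = ⟨F1, hF1⟩ := Subtype.ext ((ahead_left hj h0 h1).unique
        ((mem_halfDisc (mul_ne_zero Complex.I_ne_zero hd) _ (by simpa) (by simp)).mono
          fun _ h => hs1 h) (left e).2 hF1)
      have e2 : right e = ⟨F2, hF2⟩ := Subtype.ext ((ahead_right hj h0 h1).unique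
        ((mem_halfDisc (mul_ne_zero (by simp) hd) _ (by simpa) (by simp)).mono
          fun _ h => hs2 h) (right e).2 hF2)
      have hQ : Q (G.seg e j s) ↔ left e ∈ S := by
        simp only [Q, leftFaceAt_seg hj h0 h1, hval]
      have hcs : ∀ᶠ w in 𝓝 (G.seg e j s), dist w (G.seg e j s) < ρ := Metric.ball_mem_nhds _ hρ
      have hre : ∀ᶠ w in 𝓝 (G.seg e j s), 0 < ((w - G.pt e j) / G.dir e j).re ∧
          ((w - G.pt e j) / G.dir e j).re < 1 := by
        have hc : ContinuousAt (fun w => ((w - G.pt e j) / G.dir e j).re) (G.seg e j s) := by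
          refine Complex.continuous_re.continuousAt.comp ?_
          exact ((continuous_id.sub continuous_const).div_const _).continuousAt
        have e3 : ((G.seg e j s - G.pt e j) / G.dir e j).re = s := by simp [seg, hd]
        exact hc.eventually ((Ioo_mem_nhds (by dsimp only; rw [e3]; exact h0) (by dsimp only; rw [e3]; exact h1)))
      filter_upwards [nhdsWithin_le_nhds hcs, nhdsWithin_le_nhds hre] with w hw1 hw2
      rw [eq_iff_iff, hQ]
      by_cases hws : w ∈ G.support
      · obtain ⟨s', rfl⟩ := hb w hws hw1
        have e3 : ((G.seg e j s' - G.pt e j) / G.dir e j).re = s' := by simp [seg, hd]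
        rw [e3] at hw2
        simp only [Q, leftFaceAt_seg hj hw2.1 hw2.2, hval]
      · have hm : G.faceAt w = (face w hws).1 := rfl
        simp only [Q, leftFaceAt_of_notMem hws, hm, hval]
        have e4 : ((w - G.seg e j s) / (Complex.I * G.dir e j)).re
            = ((w - G.pt e j) / G.dir e j).im := by
          have : (w - G.seg e j s) / (Complex.I * G.dir e j) =
            ((w - G.pt e j) / G.dir e j) * (-Complex.I) + s * Complex.I := by
            simp only [seg]; field_simp; rw [Complex.I_sq]; ring
          rw [this]; simp
        rcases lt_trichotomy (((w - G.pt e j) / G.dir e j).im) 0 with h3 | h3 | h3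
        · have : w ∈ F2 := hs2 ⟨hw1, by
            rw [mem_ofPred_eq, neg_mul, div_neg, Complex.neg_re, e4]; linarith⟩
          rw [show face w hws = right e from
            (Subtype.ext (hF2.eq_faceAt this).symm).trans e2.symm, h]
        · exfalso
          refine hws ?_
          have : w = G.seg e j ((w - G.pt e j) / G.dir e j).re := by
            have : (w - G.pt e j) / G.dir e j = (((w - G.pt e j) / G.dir e j).re : ℂ) :=
              Complex.ext (by simp) (by simp [h3])
            rw [seg, ← this]; field_simp; ring
          rw [this]
          exact seg_mem_support hj hw2.1.le hw2.2.le
        · have : w ∈ F1 := hs1 ⟨hw1, by rw [mem_ofPred_eq, e4]; exact h3⟩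
          rw [show face w hws = left e from
            (Subtype.ext (hF1.eq_faceAt this).symm).trans e1.symm]
    · refine nhdsWithin_le_nhds ?_
      filter_upwards [(isOpen_faceAt z).mem_nhds (mem_faceAt hzs)] with w hw
      have hws := (isFace_faceAt hzs).notMem_support hw
      simp only [Q, leftFaceAt_of_notMem hzs, leftFaceAt_of_notMem hws, faceAt_eq hw]
  have hpick : ∀ F : G.Face, ∃ z ∉ G.support, z ∈ Nᶜ ∧ F.1 = G.faceAt z := by
    intro F
    obtain ⟨z, hz⟩ := F.2.nonempty
    have hzs := F.2.notMem_support hz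
    refine ⟨z, hzs, ?_, F.2.eq_faceAt hz⟩
    rintro (h | ⟨i, rfl⟩)
    · exact hzs (Or.inl h)
    · refine hzs (Or.inr ⟨i.1, (i.2 : ℕ), by positivity, ?_, (polyline_nat _ _).symm⟩)
      exact_mod_cast Nat.lt_succ_iff.1 i.2.2
  obtain ⟨z, hz, hzN, hzF⟩ := hpick F
  obtain ⟨z', hz', hzN', hzF'⟩ := hpick F'
  have := hconn.eq_of_eventually_eq hloc hzN hzN'
  simp only [Q, leftFaceAt_of_notMem hz, leftFaceAt_of_notMem hz', ← hzF, ← hzF', hval] at this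
  exact this ▸ hF

/-- A face bordering no edge forms by itself a set closed under crossing, so it is then the only
face. Otherwise all faces are sides of the finitely many edges. -/
instance : Finite G.Face := by
  by_cases h : ∀ F : G.Face, F ∈ range (left (G := G)) ∪ range right
  · exact Set.finite_univ_iff.1 (((finite_range left).union (finite_range right)).subset
      fun F _ => h F)
  · push Not at h
    obtain ⟨F, hF⟩ := h
    have : Subsingleton G.Face := by
      have H : ∀ F' : G.Face, F' ∈ ({F} : Set G.Face) := fun F' =>
        mem_of_forall_left_iff_right (F := F) (fun e => by
          simp only [mem_singleton_iff]
          exact ⟨fun h => absurd (Or.inl ⟨e, h⟩) hF, fun h => absurd (Or.inr ⟨e, h⟩) hF⟩) rfl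
      exact ⟨fun a b => (H a).trans (H b).symm⟩
    infer_instance

noncomputable instance : Fintype G.Face := Fintype.ofFinite _

end PlaneGraph

/-! ### Winding numbers: every 1-cycle is the boundary of a 2-chain -/

namespace PlaneGraph
open Topology Filter Set

variable {G : PlaneGraph}

/-- Integral 1-cycles of the graph, as the integral 1-chains orthogonal to all gradients. -/
def IsCirculation (c : G.E → ℤ) : Prop :=
  ∀ f : G.V → ℝ, ∑ e, (c e : ℝ) * (f (G.tgt e) - f (G.src e)) = 0

/-- The oriented angle under which the `j`-th segment of `e` is seen from `z`. -/
noncomputable def ang (e : G.E) (j : ℕ) (z : ℂ) : ℝ :=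
  Complex.arg ((G.pt e (j + 1) - z) / (G.pt e j - z))

/-- The winding number of a 1-cycle about a point. -/
noncomputable def wind (c : G.E → ℤ) (z : ℂ) : ℝ :=
  (∑ e, (c e : ℝ) * ∑ j ∈ Finset.range (G.len e), ang e j z) / (2 * Real.pi)

theorem IsCirculation.add {c c' : G.E → ℤ} (h : IsCirculation c) (h' : IsCirculation c') :
    IsCirculation (c + c') := fun f => by
  have := h f
  have := h' f
  simp only [Pi.add_apply, Int.cast_add, add_mul, Finset.sum_add_distrib]
  linarith

theorem wind_add (c c' : G.E → ℤ) (z : ℂ) : wind (c + c') z = wind c z + wind c' z := by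
  simp only [wind, Pi.add_apply, Int.cast_add, add_mul, Finset.sum_add_distrib, add_div]

theorem exists_arg_div {a b : ℂ} (ha : a ≠ 0) (hb : b ≠ 0) :
    ∃ k : ℤ, Complex.arg (b / a) = Complex.arg b - Complex.arg a + 2 * Real.pi * k := by
  have := Complex.arg_div_coe_angle hb ha
  rw [← Real.Angle.coe_sub, Real.Angle.angle_eq_iff_two_pi_dvd_sub] at this
  obtain ⟨k, hk⟩ := this
  exact ⟨k, by linarith⟩

theorem exists_sum_ang (e : G.E) (z : ℂ) (hz : ∀ j ≤ G.len e, G.pt e j ≠ z) :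
    ∃ k : ℤ, ∑ j ∈ Finset.range (G.len e), ang e j z =
      Complex.arg (G.pos (G.tgt e) - z) - Complex.arg (G.pos (G.src e) - z) + 2 * Real.pi * k := by
  rw [← G.pt_zero, ← G.pt_len]
  have : ∀ n ≤ G.len e, ∃ k : ℤ, ∑ j ∈ Finset.range n, ang e j z =
      Complex.arg (G.pt e n - z) - Complex.arg (G.pt e 0 - z) + 2 * Real.pi * k := by
    intro n
    induction n with
    | zero => intro _; exact ⟨0, by simp⟩
    | succ n ih =>
      intro hn
      obtain ⟨k, hk⟩ := ih (by omega)
      obtain ⟨k', hk'⟩ := exists_arg_div (sub_ne_zero.2 (hz n (by omega)))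
        (sub_ne_zero.2 (hz (n + 1) hn))
      refine ⟨k + k', ?_⟩
      rw [Finset.sum_range_succ, hk, ang, hk']
      push_cast; ring
  exact this _ le_rfl

/-- The total angle of an edge is the difference of the arguments of its ends modulo `2π`. These
differences form a gradient, which a circulation annihilates. -/
theorem exists_wind_eq_int {c : G.E → ℤ} (hc : IsCirculation c) {z : ℂ}
    (hz : ∀ e, c e ≠ 0 → ∀ j ≤ G.len e, G.pt e j ≠ z) : ∃ k : ℤ, wind c z = k := by
  have H : ∀ e, ∃ k : ℤ, (c e : ℝ) * ∑ j ∈ Finset.range (G.len e), ang e j z =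
      c e * (Complex.arg (G.pos (G.tgt e) - z) - Complex.arg (G.pos (G.src e) - z)) +
        2 * Real.pi * k := by
    intro e
    by_cases he : c e = 0
    · exact ⟨0, by simp [he]⟩
    · obtain ⟨k, hk⟩ := exists_sum_ang e z (hz e he)
      exact ⟨c e * k, by rw [hk]; push_cast; ring⟩
  choose k hk using H
  refine ⟨∑ e, k e, ?_⟩
  rw [wind, Finset.sum_congr rfl fun e _ => hk e, Finset.sum_add_distrib,
    hc fun v => Complex.arg (G.pos v - z), ← Finset.mul_sum]
  have := Real.pi_pos
  push_cast
  field_simp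
  ring

/-- If the quotient of the two end vectors were a real number `r ≤ 0`, then `z` would be the point
of the segment at parameter `1 / (1 - r)`. So the quotient stays off the branch cut of `arg`. -/
theorem continuousAt_ang {e : G.E} {j : ℕ} {z : ℂ} (hz : z ∉ closedSeg e j) :
    ContinuousAt (ang e j) z := by
  have ha : G.pt e j - z ≠ 0 := fun h => hz ⟨0, le_rfl, zero_le_one, by
    rw [seg_zero]; exact (sub_eq_zero.1 h).symm⟩
  unfold ang
  have hsp : (G.pt e (j + 1) - z) / (G.pt e j - z) ∈ Complex.slitPlane := by
    rw [Complex.mem_slitPlane_iff]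
    by_contra h
    push Not at h
    obtain ⟨h1, h2⟩ := h
    set r := ((G.pt e (j + 1) - z) / (G.pt e j - z)).re with hr
    have h3 : (G.pt e (j + 1) - z) / (G.pt e j - z) = (r : ℂ) := Complex.ext (by simp [hr]) (by simp [h2])
    rw [div_eq_iff ha] at h3
    refine hz ⟨1 / (1 - r), by apply div_nonneg <;> linarith, ?_, ?_⟩
    · rw [div_le_one (by linarith)]; linarith
    · have : (1 - r : ℂ) ≠ 0 := by
        have : (1 - r) ≠ 0 := by linarith
        exact_mod_cast this
      simp only [seg, dir]
      push_cast
      field_simp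
      linear_combination -h3
  have : ContinuousAt (fun z => (G.pt e (j + 1) - z) / (G.pt e j - z)) z :=
    ContinuousAt.div (by fun_prop) (by fun_prop) ha
  exact ContinuousAt.comp (f := fun z => (G.pt e (j + 1) - z) / (G.pt e j - z))
    (g := Complex.arg) (Complex.continuousAt_arg hsp) this

theorem continuousAt_wind (c : G.E → ℤ) {z : ℂ}
    (hz : ∀ e, c e ≠ 0 → ∀ j < G.len e, z ∉ closedSeg e j) : ContinuousAt (wind c) z := by
  unfold wind
  refine ContinuousAt.div_const (tendsto_finsetSum _ fun e _ => ?_) _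
  by_cases he : c e = 0
  · simp [he]
  · exact (tendsto_finsetSum _ fun j hj =>
      continuousAt_ang (hz e he j (Finset.mem_range.1 hj))).const_mul _

theorem seg_add_div {e : G.E} {j : ℕ} (hj : j < G.len e) (s : ℝ) (w : ℂ) :
    (G.pt e (j + 1) - (G.seg e j s + w * G.dir e j)) / (G.pt e j - (G.seg e j s + w * G.dir e j)) =
      - ((1 - s - w) / (s + w)) := by
  have hd := dir_ne_zero hj
  have h1 : G.pt e (j + 1) - (G.seg e j s + w * G.dir e j) = (1 - s - w) * G.dir e j := by
    simp only [seg, dir]; ring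
  have h2 : G.pt e j - (G.seg e j s + w * G.dir e j) = (-(s + w)) * G.dir e j := by
    simp only [seg]; ring
  rw [h1, h2, mul_div_mul_right _ _ hd, div_neg]

theorem ang_seg {e : G.E} {j : ℕ} (hj : j < G.len e) {s : ℝ} (h0 : 0 < s) (h1 : s < 1) :
    ang e j (G.seg e j s) = Real.pi := by
  have := seg_add_div hj s 0
  rw [ang]
  simp only [zero_mul, add_zero, sub_zero] at this
  rw [this, Complex.arg_eq_pi_iff]
  have : -((1 - (s : ℂ)) / s) = ((-((1 - s) / s) : ℝ) : ℂ) := by push_cast; ring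
  rw [this, Complex.ofReal_re, Complex.ofReal_im]
  have : 0 < (1 - s) / s := div_pos (by linarith) h0
  exact ⟨by linarith, rfl⟩

/-- The quotient of the end vectors approaches the negative real axis, from above on the left side
and from below on the right side. Since `arg` is `π` on that axis, its value on the segment agrees
with the limit from the left. -/
theorem tendsto_ang_left {e : G.E} {j : ℕ} (hj : j < G.len e) {s : ℝ} (h0 : 0 < s) (h1 : s < 1) :
    Tendsto (fun δ : ℝ => ang e j (G.seg e j s + δ * (Complex.I * G.dir e j))) (𝓝[>] 0)
      (𝓝 Real.pi) ∧
    Tendsto (fun δ : ℝ => ang e j (G.seg e j s + δ * (-Complex.I * G.dir e j))) (𝓝[>] 0)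
      (𝓝 (-Real.pi)) := by
  have hs : (s : ℂ) ≠ 0 := by exact_mod_cast h0.ne'
  set w : ℂ := -((1 - (s : ℂ)) / s) with hw
  have hwr : w = ((-((1 - s) / s) : ℝ) : ℂ) := by rw [hw]; push_cast; ring
  have hre : w.re < 0 := by
    rw [hwr, Complex.ofReal_re]
    have : 0 < (1 - s) / s := div_pos (by linarith) h0
    linarith
  have him : w.im = 0 := by rw [hwr, Complex.ofReal_im]
  have key : ∀ σ : ℝ, Tendsto (fun δ : ℝ => -((1 - s - (δ * (σ * Complex.I))) / (s + (δ * (σ * Complex.I)))))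
      (𝓝[>] 0) (𝓝 w) := by
    intro σ
    have : ContinuousAt (fun δ : ℝ => -((1 - s - (δ * (σ * Complex.I))) / (s + (δ * (σ * Complex.I))))) 0 := by
      refine ContinuousAt.neg (ContinuousAt.div (by fun_prop) (by fun_prop) (by simpa using hs))
    have := this.tendsto.mono_left (nhdsWithin_le_nhds (s := Ioi 0))
    simpa [hw] using this
  have him' : ∀ σ δ : ℝ, (-((1 - s - (δ * (σ * Complex.I))) / (s + (δ * (σ * Complex.I))))).im =
      δ * σ / (s ^ 2 + (δ * σ) ^ 2) := by
    intro σ δ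
    simp [Complex.div_im, Complex.normSq_apply]
    ring
  constructor
  · have hc := Complex.continuousWithinAt_arg_of_re_neg_of_im_zero hre him
    have hpi : Complex.arg w = Real.pi := Complex.arg_eq_pi_iff.2 ⟨hre, him⟩
    rw [ContinuousWithinAt, hpi] at hc
    refine (hc.comp (tendsto_nhdsWithin_iff.2 ⟨key 1, ?_⟩)).congr fun δ => ?_
    · filter_upwards [self_mem_nhdsWithin] with δ hδ
      have : 0 < δ := hδ
      rw [him']
      positivity
    · have := seg_add_div hj s (δ * Complex.I)
      rw [ang, ← mul_assoc, this]
      simp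
  · have hc := Complex.tendsto_arg_nhdsWithin_im_neg_of_re_neg_of_im_zero hre him
    refine (hc.comp (tendsto_nhdsWithin_iff.2 ⟨key (-1), ?_⟩)).congr fun δ => ?_
    · filter_upwards [self_mem_nhdsWithin] with δ hδ
      have : 0 < δ := hδ
      rw [him', mul_neg_one, neg_div, neg_lt_zero]
      positivity
    · have := seg_add_div hj s (δ * -Complex.I)
      rw [ang, ← mul_assoc, this]
      simp

/-- Only the segment through the point contributes a discontinuity. The parameter `κ` is 0 for
approach from the left and 1 for approach from the right. -/
theorem tendsto_wind_side (c : G.E → ℤ) {e : G.E} {j : ℕ} (hj : j < G.len e) {s : ℝ} (h0 : 0 < s)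
    (h1 : s < 1) {u : ℂ} {κ : ℝ}
    (h : Tendsto (fun δ : ℝ => ang e j (G.seg e j s + δ * u)) (𝓝[>] 0) (𝓝 (Real.pi - κ * (2 * Real.pi)))) :
    Tendsto (fun δ : ℝ => wind c (G.seg e j s + δ * u)) (𝓝[>] 0)
      (𝓝 (wind c (G.seg e j s) - κ * c e)) := by
  classical
  have hlim : Tendsto (fun δ : ℝ => G.seg e j s + δ * u) (𝓝[>] 0) (𝓝 (G.seg e j s)) := by
    have : ContinuousAt (fun δ : ℝ => G.seg e j s + δ * u) 0 := by fun_prop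
    simpa [ContinuousAt] using this.tendsto.mono_left (nhdsWithin_le_nhds (s := Ioi 0))
  have hterm : ∀ e' : G.E, ∀ j' ∈ Finset.range (G.len e'),
      Tendsto (fun δ : ℝ => ang e' j' (G.seg e j s + δ * u)) (𝓝[>] 0)
        (𝓝 (ang e' j' (G.seg e j s) - if e' = e then (if j' = j then κ * (2 * Real.pi) else 0) else 0)) := by
    intro e' j' hj'
    by_cases hm : e = e' ∧ j = j'
    · obtain ⟨rfl, rfl⟩ := hm
      simpa [ang_seg hj h0 h1] using h
    · have := (continuousAt_ang (mt (seg_mem_closedSeg_iff hj (Finset.mem_range.1 hj') h0 h1).1 hm)).tendsto.comp hlim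
      have e1 : (if e' = e then (if j' = j then κ * (2 * Real.pi) else 0) else 0) = 0 := by
        split_ifs with h2 h3
        · exact absurd ⟨h2.symm, h3.symm⟩ hm
        · rfl
        · rfl
      rw [e1, sub_zero]
      exact this
  have := (tendsto_finsetSum Finset.univ fun e' _ =>
    (tendsto_finsetSum _ (hterm e')).const_mul (c e' : ℝ)).div_const (2 * Real.pi)
  unfold wind
  convert this using 2
  have hpi := Real.pi_pos
  simp only [Finset.sum_sub_distrib, mul_sub, sub_div]
  congr 1
  rw [Finset.sum_eq_single e]
  · simp [hj]; field_simp
  · intro b _ hb; simp [hb]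
  · simp

theorem eventually_eq_of_int {X : Type*} {l : Filter X} {f : X → ℝ} {k : ℤ} (h : Tendsto f l (𝓝 k))
    (hi : ∀ᶠ x in l, ∃ m : ℤ, f x = m) : ∀ᶠ x in l, f x = k := by
  filter_upwards [hi, h.eventually (Ioo_mem_nhds (sub_one_lt (k : ℝ)) (lt_add_one (k : ℝ)))] with x ⟨m, hm⟩ hx
  rw [hm] at hx ⊢
  have a : (k : ℝ) - 1 < m := hx.1
  have b : (m : ℝ) < k + 1 := hx.2
  have a' : k - 1 < m := by exact_mod_cast a
  have b' : m < k + 1 := by exact_mod_cast b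
  have : m = k := by omega
  rw [this]

theorem pt_mem_closedSeg_of_le (e : G.E) {j : ℕ} (hj : j ≤ G.len e) :
    ∃ j' < G.len e, G.pt e j ∈ closedSeg e j' := by
  have := G.len_pos e
  rcases hj.lt_or_eq with hj | rfl
  · exact ⟨j, hj, 0, le_rfl, zero_le_one, (seg_zero _ _).symm⟩
  · exact ⟨G.len e - 1, by omega, 1, zero_le_one, le_rfl, by rw [seg_one, Nat.sub_add_cancel this]⟩

theorem eventually_wind_eq {c : G.E → ℤ} (hc : IsCirculation c) {z : ℂ}
    (hz : ∀ e, c e ≠ 0 → ∀ j < G.len e, z ∉ closedSeg e j) : ∀ᶠ w in 𝓝 z, wind c w = wind c z := by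
  have hn : ∀ e, c e ≠ 0 → ∀ j ≤ G.len e, G.pt e j ≠ z := by
    rintro e he j hj rfl
    obtain ⟨j', hj', h⟩ := pt_mem_closedSeg_of_le e hj
    exact hz e he j' hj' h
  obtain ⟨k, hk⟩ := exists_wind_eq_int hc hn
  have hcont := continuousAt_wind c hz
  rw [ContinuousAt, hk] at hcont
  rw [hk]
  refine eventually_eq_of_int hcont ?_
  have hfin : ∀ e : G.E, ∀ᶠ w in 𝓝 z, c e ≠ 0 → ∀ j ≤ G.len e, G.pt e j ≠ w := by
    intro e
    by_cases he : c e = 0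
    · simp [he]
    · have : ∀ᶠ w in 𝓝 z, ∀ j ∈ Finset.range (G.len e + 1), G.pt e j ≠ w :=
        (Finset.eventually_all _).2 fun j hj => by
          have := (hn e he j (Nat.lt_succ_iff.1 (Finset.mem_range.1 hj))).symm
          exact (eventually_ne_nhds this).mono fun w hw => hw.symm
      exact this.mono fun w hw _ j hj => hw j (Finset.mem_range.2 (Nat.lt_succ_iff.2 hj))
  exact (eventually_all.2 hfin).mono fun w hw => exists_wind_eq_int hc hw

/-- The integral 2-chain vanishing on the exterior whose boundary is a given 1-cycle. -/
noncomputable def pot (c : G.E → ℤ) (F : G.Face) : ℤ := -round (wind c F.2.nonempty.choose)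

/-- The winding number is integral and locally constant on a face, which is connected. Hence the
rounding and the chosen point in `pot` do not matter. -/
theorem wind_eq_neg_pot {c : G.E → ℤ} (hc : IsCirculation c) {F : G.Face} {z : ℂ} (hz : z ∈ F.1) :
    wind c z = -pot c F := by
  have hns : ∀ w ∈ F.1, ∀ e, c e ≠ 0 → ∀ j < G.len e, w ∉ closedSeg e j :=
    fun w hw e _ j hj h => F.2.notMem_support hw (mem_support_iff.2 (Or.inr ⟨e, j, hj, h⟩))
  have hz0 := F.2.nonempty.choose_spec
  have hpre : IsPreconnected F.1 := by
    obtain ⟨w, -, h⟩ := F.2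
    rw [h]; exact isPreconnected_connectedComponentIn
  have h1 : wind c z = wind c F.2.nonempty.choose :=
    hpre.eq_of_eventually_eq (fun w hw => nhdsWithin_le_nhds (eventually_wind_eq hc (hns w hw))) hz hz0
  obtain ⟨k, hk⟩ := exists_wind_eq_int hc (z := F.2.nonempty.choose) (by
    rintro e he j hj h
    obtain ⟨j', hj', h2⟩ := pt_mem_closedSeg_of_le e hj
    exact hns _ hz0 e he j' hj' (h ▸ h2))
  rw [h1, pot, hk]
  simp

theorem pot_add {c c' : G.E → ℤ} (h : IsCirculation c) (h' : IsCirculation c') (F : G.Face) :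
    pot (c + c') F = pot c F + pot c' F := by
  obtain ⟨z, hz⟩ := F.2.nonempty
  have := wind_add c c' z
  rw [wind_eq_neg_pot h hz, wind_eq_neg_pot h' hz, wind_eq_neg_pot (h.add h') hz] at this
  have : (pot (c + c') F : ℝ) = pot c F + pot c' F := by linarith
  exact_mod_cast this

theorem wind_seg {c : G.E → ℤ} (hc : IsCirculation c) {e : G.E} {j : ℕ} (hj : j < G.len e) {s : ℝ}
    (h0 : 0 < s) (h1 : s < 1) : wind c (G.seg e j s) = -pot c (left e) := by
  have h := tendsto_wind_side c hj h0 h1 (κ := 0) (by simpa using (tendsto_ang_left hj h0 h1).1)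
  rw [zero_mul, sub_zero] at h
  refine tendsto_nhds_unique h (Tendsto.congr' ?_ tendsto_const_nhds)
  exact (ahead_left hj h0 h1).mono fun δ hδ => (wind_eq_neg_pot hc hδ).symm

theorem wind_seg_right {c : G.E → ℤ} (hc : IsCirculation c) {e : G.E} {j : ℕ} (hj : j < G.len e)
    {s : ℝ} (h0 : 0 < s) (h1 : s < 1) : wind c (G.seg e j s) - c e = -pot c (right e) := by
  have h := tendsto_wind_side c hj h0 h1 (κ := 1) (by
    have := (tendsto_ang_left hj h0 h1).2
    rwa [show -Real.pi = Real.pi - 1 * (2 * Real.pi) by ring] at this)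
  rw [one_mul] at h
  refine tendsto_nhds_unique h (Tendsto.congr' ?_ tendsto_const_nhds)
  exact (ahead_right hj h0 h1).mono fun δ hδ => (wind_eq_neg_pot hc hδ).symm

/-- The boundary of `pot c` is `c`. -/
theorem eq_pot_sub_pot {c : G.E → ℤ} (hc : IsCirculation c) (e : G.E) :
    c e = pot c (right e) - pot c (left e) := by
  have h1 := wind_seg hc (G.len_pos e) (s := 1 / 2) (by norm_num) (by norm_num)
  have h2 := wind_seg_right hc (G.len_pos e) (s := 1 / 2) (by norm_num) (by norm_num)
  have : (c e : ℝ) = pot c (right e) - pot c (left e) := by linarith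
  exact_mod_cast this

/-- Seen from far away, the quotient of the end vectors of a segment tends to 1 and its argument to
0. -/
theorem tendsto_wind_cobounded (c : G.E → ℤ) : Tendsto (wind c) (Bornology.cobounded ℂ) (𝓝 0) := by
  have hang : ∀ (e : G.E) (j : ℕ), Tendsto (ang e j) (Bornology.cobounded ℂ) (𝓝 0) := by
    intro e j
    have h1 : Tendsto (fun z : ℂ => G.pt e j - z) (Bornology.cobounded ℂ) (Bornology.cobounded ℂ) := by
      refine (tendsto_const_sub_cobounded (G.pt e j))
    have h2 : Tendsto (fun z : ℂ => 1 + (G.pt e (j + 1) - G.pt e j) * (G.pt e j - z)⁻¹)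
        (Bornology.cobounded ℂ) (𝓝 1) := by
      simpa using ((tendsto_inv₀_cobounded.comp h1).const_mul (G.pt e (j + 1) - G.pt e j)).const_add 1
    have h3 : Tendsto Complex.arg (𝓝 1) (𝓝 0) := by
      have := (Complex.continuousAt_arg Complex.one_mem_slitPlane).tendsto
      rwa [Complex.arg_one] at this
    refine (h3.comp h2).congr' ?_
    filter_upwards [Bornology.eventually_ne_cobounded (G.pt e j)] with z hz
    have : G.pt e j - z ≠ 0 := sub_ne_zero.2 hz.symm
    simp only [Function.comp, ang]
    congr 1
    field_simp
    ring
  have := (tendsto_finsetSum Finset.univ fun e _ =>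
    (tendsto_finsetSum (Finset.range (G.len e)) fun j _ => hang e j).const_mul (c e : ℝ)).div_const
      (2 * Real.pi)
  unfold wind
  simpa using this

theorem pot_eq_zero {c : G.E → ℤ} (hc : IsCirculation c) {F : G.Face}
    (hF : ¬ Bornology.IsBounded F.1) : pot c F = 0 := by
  have h := (tendsto_wind_cobounded c).eventually (Ioo_mem_nhds neg_one_lt_zero one_pos)
  obtain ⟨z, hz, hz'⟩ : ∃ z ∈ F.1, wind c z ∈ Ioo (-1 : ℝ) 1 := by
    by_contra hcon
    push Not at hcon
    exact hF (Bornology.isBounded_def.2 (mem_of_superset h fun z hz hzF => hcon z hzF hz))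
  rw [wind_eq_neg_pot hc hz] at hz'
  have a : (-1 : ℤ) < -pot c F := by exact_mod_cast hz'.1
  have b : -pot c F < 1 := by exact_mod_cast hz'.2
  omega

/-- Two 2-chains with the same boundary have equal jumps across every edge, so the set where they
agree is closed under crossing and contains `F₀`. -/
theorem pot_unique {c : G.E → ℤ} (hc : IsCirculation c) {D : G.Face → ℤ} {F₀ : G.Face}
    (h0 : ¬ Bornology.IsBounded F₀.1) (hD0 : D F₀ = 0)
    (hD : ∀ e, c e = D (right e) - D (left e)) : D = pot c := by
  funext F
  have : F ∈ {F | D F = pot c F} := by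
    refine mem_of_forall_left_iff_right (F := F₀) (fun e => ?_) ?_
    · have := hD e
      have := eq_pot_sub_pot hc e
      simp only [mem_ofPred_eq]
      omega
    · simp [hD0, pot_eq_zero hc h0]
  exact this

end PlaneGraph

/-! ### The values of `pot` around a vertex -/

namespace PlaneGraph
open Topology Filter Set

variable {G : PlaneGraph}

/-- The edge `e` has an end at `v`, where it leaves `v` in the direction `γ`. -/
def IsEnd (v : G.V) (e : G.E) (γ : ℂ) : Prop :=
  (G.src e = v ∧ γ = G.pt e 1 - G.pt e 0) ∨
    (G.tgt e = v ∧ γ = G.pt e (G.len e - 1) - G.pt e (G.len e))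

theorem IsEnd.exists_seg {v : G.V} {e : G.E} {γ : ℂ} (h : IsEnd v e γ) :
    ∃ j < G.len e, ∀ s : ℝ, 0 < s → s < 1 → ∃ s' : ℝ, 0 < s' ∧ s' < 1 ∧
      G.pos v + s * γ = G.seg e j s' := by
  have hl := G.len_pos e
  rcases h with ⟨rfl, rfl⟩ | ⟨rfl, rfl⟩
  · refine ⟨0, hl, fun s h0 h1 => ⟨s, h0, h1, ?_⟩⟩
    simp [seg, dir, G.pt_zero]
  · refine ⟨G.len e - 1, by omega, fun s h0 h1 => ⟨1 - s, by linarith, by linarith, ?_⟩⟩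
    rw [← G.pt_len]
    simp only [seg, dir, Nat.sub_add_cancel hl]
    push_cast
    ring

theorem IsEnd.ne_zero {v : G.V} {e : G.E} {γ : ℂ} (h : IsEnd v e γ) : γ ≠ 0 := by
  rintro rfl
  obtain ⟨j, hj, H⟩ := h.exists_seg
  obtain ⟨s', h0, h1, h2⟩ := H (1 / 2) (by norm_num) (by norm_num)
  exact seg_ne_pos hj h0 h1 v (by rw [← h2]; simp)

theorem IsEnd.not_sameRay {v : G.V} {e e' : G.E} {γ γ' : ℂ} (h : IsEnd v e γ) (h' : IsEnd v e' γ')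
    (hne : e ≠ e') (r : ℝ) (hr : 0 < r) : γ' ≠ r * γ := by
  rintro rfl
  obtain ⟨j, hj, H⟩ := h.exists_seg
  obtain ⟨j', hj', H'⟩ := h'.exists_seg
  let s := min (1 / 2) (1 / (2 * r))
  have hs : 0 < s := by positivity
  have hs1 : s < 1 := (min_le_left _ _).trans_lt (by norm_num)
  have hrs : r * s < 1 := by
    calc r * s ≤ r * (1 / (2 * r)) := by gcongr; exact min_le_right _ _
      _ = 1 / 2 := by field_simp
      _ < 1 := by norm_num
  obtain ⟨t, h0, h1, h2⟩ := H (r * s) (by positivity) hrs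
  obtain ⟨t', h0', h1', h2'⟩ := H' s hs hs1
  refine hne (seg_injective hj hj' h0 h1 h0' h1' ?_).1
  rw [← h2, ← h2']
  push_cast
  ring

/-- Different edges leave `v` along different rays, since otherwise their end segments would
overlap. The sign turns this into avoidance of the branch cut. -/
theorem IsEnd.neg_div_mem_slitPlane {v : G.V} {e e' : G.E} {γ γ' : ℂ} (h : IsEnd v e γ)
    (h' : IsEnd v e' γ') (hne : e ≠ e') : -γ' / γ ∈ Complex.slitPlane := by
  rw [Complex.mem_slitPlane_iff]
  by_contra hcon
  push Not at hcon
  have h1 : -γ' / γ = ((-γ' / γ).re : ℂ) := Complex.ext (by simp) (by simp [hcon.2])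
  have h0 := h.ne_zero
  have h0' := h'.ne_zero
  refine h.not_sameRay h' hne (-(-γ' / γ).re) ?_ ?_
  · refine neg_pos.2 (lt_of_le_of_ne hcon.1 fun h2 => ?_)
    rw [h2, Complex.ofReal_zero, div_eq_zero_iff] at h1
    rcases h1 with h1 | h1
    · exact h0' (neg_eq_zero.1 h1)
    · exact h0 h1
  · push_cast
    rw [← h1]
    field_simp

theorem notMem_closedSeg_of_not_incident {v : G.V} {e : G.E} (h1 : G.src e ≠ v) (h2 : G.tgt e ≠ v)
    {j : ℕ} (hj : j < G.len e) : G.pos v ∉ closedSeg e j := by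
  rintro ⟨s, h0, h1', h⟩
  have key : ∀ k ≤ G.len e, G.pos v ≠ G.pt e k := by
    intro k hk hk'
    rcases pt_cases e hk with ⟨-, h⟩ | ⟨-, h⟩ | ⟨h3, h4⟩
    · exact h1 (G.pos_injective (hk'.trans h)).symm
    · exact h2 (G.pos_injective (hk'.trans h)).symm
    · exact pt_ne_pos h3 h4 v hk'.symm
  rcases h0.eq_or_lt with rfl | h0
  · rw [seg_zero] at h; exact key j hj.le h
  rcases h1'.eq_or_lt with rfl | h1'
  · rw [seg_one] at h; exact key _ hj h
  exact seg_ne_pos hj h0 h1' v h.symm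

theorem src_notMem_closedSeg {e : G.E} (hne : G.tgt e ≠ G.src e) {j : ℕ} (hj : j + 1 < G.len e) :
    G.pos (G.src e) ∉ closedSeg e (j + 1) := by
  rintro ⟨s, h0, h1', h⟩
  have key : ∀ k ≤ G.len e, 0 < k → G.pos (G.src e) ≠ G.pt e k := by
    intro k hk hk0 hk'
    rcases pt_cases e hk with ⟨h3, -⟩ | ⟨-, h⟩ | ⟨h3, h4⟩
    · omega
    · exact hne (G.pos_injective (hk'.trans h)).symm
    · exact pt_ne_pos h3 h4 _ hk'.symm
  rcases h0.eq_or_lt with rfl | h0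
  · rw [seg_zero] at h; exact key _ hj.le (by omega) h
  rcases h1'.eq_or_lt with rfl | h1'
  · rw [seg_one] at h; exact key _ hj (by omega) h
  exact seg_ne_pos hj h0 h1' _ h.symm

theorem tgt_notMem_closedSeg {e : G.E} (hne : G.tgt e ≠ G.src e) {j : ℕ} (hj : j + 1 < G.len e) :
    G.pos (G.tgt e) ∉ closedSeg e j := by
  rintro ⟨s, h0, h1', h⟩
  have key : ∀ k < G.len e, G.pos (G.tgt e) ≠ G.pt e k := by
    intro k hk hk'
    rcases pt_cases e hk.le with ⟨-, h⟩ | ⟨h3, -⟩ | ⟨h3, h4⟩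
    · exact hne (G.pos_injective (hk'.trans h))
    · omega
    · exact pt_ne_pos h3 h4 _ hk'.symm
  rcases h0.eq_or_lt with rfl | h0
  · rw [seg_zero] at h; exact key _ (by omega) h
  rcases h1'.eq_or_lt with rfl | h1'
  · rw [seg_one] at h; exact key _ hj h
  exact seg_ne_pos (by omega) h0 h1' _ h.symm

theorem tendsto_ray (v : G.V) (γ : ℂ) :
    Tendsto (fun s : ℝ => G.pos v + s * γ) (𝓝[>] 0) (𝓝 (G.pos v)) := by
  have : ContinuousAt (fun s : ℝ => G.pos v + s * γ) 0 := by fun_prop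
  simpa [ContinuousAt] using this.tendsto.mono_left (nhdsWithin_le_nhds (s := Ioi 0))

/-- Around a vertex off the support of a 1-cycle, `pot` is constant. -/
theorem exists_pot_eq_of_not_incident {c : G.E → ℤ} (hc : IsCirculation c) {v : G.V}
    (h : ∀ e, c e ≠ 0 → G.src e ≠ v ∧ G.tgt e ≠ v) :
    ∃ k : ℤ, ∀ e, G.src e = v ∨ G.tgt e = v → pot c (left e) = k ∧ pot c (right e) = k := by
  have hev := eventually_wind_eq hc (z := G.pos v)
    (fun e he j hj => notMem_closedSeg_of_not_incident (h e he).1 (h e he).2 hj)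
  refine ⟨-round (wind c (G.pos v)), fun e he => ?_⟩
  obtain ⟨γ, hγ⟩ : ∃ γ, IsEnd v e γ := by
    rcases he with he | he
    · exact ⟨_, Or.inl ⟨he, rfl⟩⟩
    · exact ⟨_, Or.inr ⟨he, rfl⟩⟩
  obtain ⟨j, hj, H⟩ := hγ.exists_seg
  obtain ⟨s, hs, hs0, hs1⟩ := (((tendsto_ray v γ).eventually hev).and
    (Ioo_mem_nhdsGT (zero_lt_one' ℝ))).exists
  obtain ⟨s', h0, h1, h2⟩ := H s hs0 hs1
  rw [h2, wind_seg hc hj h0 h1] at hs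
  have h3 : c e = 0 := by
    by_contra h3
    rcases he with he | he
    · exact (h e h3).1 he
    · exact (h e h3).2 he
  have h4 : pot c (left e) = -round (wind c (G.pos v)) := by
    rw [← hs, ← Int.cast_neg, round_intCast, neg_neg]
  have := eq_pot_sub_pot hc e
  exact ⟨h4, by omega⟩

open Classical in
/-- The angle under which the end at `v` of the edge `e` is seen from a point approaching `v` in the
direction `γ`. -/
noncomputable def endAng (v : G.V) (γ : ℂ) (e : G.E) : ℝ :=
  if G.src e = v then Complex.arg (-(G.pt e 1 - G.pt e 0) / γ)
  else if G.tgt e = v then Complex.arg (-γ / (G.pt e (G.len e - 1) - G.pt e (G.len e))) else 0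

theorem slitPlane_inv {a b : ℂ} (h : -a / b ∈ Complex.slitPlane) : -b / a ∈ Complex.slitPlane := by
  have h0 : -a / b ≠ 0 := Complex.slitPlane_ne_zero h
  have hn := Complex.normSq_pos.2 h0
  have e : -b / a = (-a / b)⁻¹ := by rw [inv_div, div_neg, ← neg_div]
  rw [e, Complex.mem_slitPlane_iff, Complex.inv_re, Complex.inv_im]
  rcases Complex.mem_slitPlane_iff.1 h with h | h
  · exact Or.inl (div_pos h hn)
  · exact Or.inr (div_ne_zero (neg_ne_zero.2 h) hn.ne')

/-- This is the limit of the angle of an end segment `δ` seen from a point approaching the vertex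
along `γ`. When `δ = γ` the point lies on the segment and the angle is exactly `π`; otherwise `arg`
is continuous at the limit. -/
theorem tendsto_arg_endpoint {δ γ : ℂ} (hδ : δ ≠ 0) (h : δ = γ ∨ -δ / γ ∈ Complex.slitPlane) :
    Tendsto (fun s : ℝ => Complex.arg ((δ - s * γ) / (-(s * γ)))) (𝓝[>] 0)
      (𝓝 (Complex.arg (-δ / γ))) ∧
    Tendsto (fun s : ℝ => Complex.arg ((-(s * γ)) / (δ - s * γ))) (𝓝[>] 0)
      (𝓝 (Complex.arg (-γ / δ))) := by
  rcases h with rfl | h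
  · rw [neg_div_self hδ, Complex.arg_neg_one]
    have e : ∀ s : ℝ, δ - s * δ = ((1 - s : ℝ) : ℂ) * δ := fun s => by push_cast; ring
    have e' : ∀ s : ℝ, -(s * δ) = ((-s : ℝ) : ℂ) * δ := fun s => by push_cast; ring
    have hpi : ∀ x : ℝ, x < 0 → Complex.arg (x : ℂ) = Real.pi := fun x hx =>
      Complex.arg_ofReal_of_neg hx
    constructor
    · refine Tendsto.congr' ?_ tendsto_const_nhds
      filter_upwards [Ioo_mem_nhdsGT (zero_lt_one' ℝ)] with s hs
      rw [e, e', mul_div_mul_right _ _ hδ, ← Complex.ofReal_div, hpi]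
      exact div_neg_of_pos_of_neg (by linarith [hs.2]) (by linarith [hs.1])
    · refine Tendsto.congr' ?_ tendsto_const_nhds
      filter_upwards [Ioo_mem_nhdsGT (zero_lt_one' ℝ)] with s hs
      rw [e, e', mul_div_mul_right _ _ hδ, ← Complex.ofReal_div, hpi]
      exact div_neg_of_neg_of_pos (by linarith [hs.1]) (by linarith [hs.2])
  · have hγ : γ ≠ 0 := by
      rintro rfl
      simp at h
    constructor
    · have hc : ContinuousAt (fun s : ℝ => -(δ - s * γ) / γ) 0 := by fun_prop
      have h2 : ContinuousAt (fun s : ℝ => Complex.arg (-(δ - s * γ) / γ)) 0 :=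
        ContinuousAt.comp (f := fun s : ℝ => -(δ - s * γ) / γ) (g := Complex.arg)
          (Complex.continuousAt_arg (by simpa using h)) hc
      have h3 := h2.tendsto.mono_left (nhdsWithin_le_nhds (s := Ioi 0))
      simp only [Complex.ofReal_zero, zero_mul, sub_zero] at h3
      refine h3.congr' ?_
      filter_upwards [self_mem_nhdsWithin] with s hs
      have hs : 0 < s := hs
      have hs' : (s : ℂ) ≠ 0 := by exact_mod_cast hs.ne'
      rw [← Complex.arg_real_mul ((δ - s * γ) / (-(s * γ))) hs]
      congr 1
      field_simp
    · have hc : ContinuousAt (fun s : ℝ => -γ / (δ - s * γ)) 0 :=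
        ContinuousAt.div (by fun_prop) (by fun_prop) (by simpa using hδ)
      have h2 : ContinuousAt (fun s : ℝ => Complex.arg (-γ / (δ - s * γ))) 0 :=
        ContinuousAt.comp (f := fun s : ℝ => -γ / (δ - s * γ)) (g := Complex.arg)
          (Complex.continuousAt_arg (by simpa using slitPlane_inv h)) hc
      have h3 := h2.tendsto.mono_left (nhdsWithin_le_nhds (s := Ioi 0))
      simp only [Complex.ofReal_zero, zero_mul, sub_zero] at h3
      refine h3.congr' ?_
      filter_upwards [self_mem_nhdsWithin] with s hs
      have hs : 0 < s := hs
      rw [← Complex.arg_real_mul (-γ / (δ - s * γ)) hs]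
      congr 1
      ring

/-- Every segment of `e` not ending at `v` has a continuous angle at `v`, so its contribution `K`
does not depend on the direction of approach. As `e` is not a loop, at most one segment ends at `v`.
-/
theorem exists_tendsto_sum_ang (v : G.V) (e : G.E) (hne : G.tgt e ≠ G.src e) :
    ∃ K : ℝ, ∀ g γ, IsEnd v g γ →
      Tendsto (fun s : ℝ => ∑ j ∈ Finset.range (G.len e), ang e j (G.pos v + s * γ)) (𝓝[>] 0)
        (𝓝 (K + endAng v γ e)) := by
  have hl := G.len_pos e
  have hcase : ∀ g γ δ, IsEnd v g γ → IsEnd v e δ →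
      δ = γ ∨ -δ / γ ∈ Complex.slitPlane := by
    intro g γ δ hg he
    by_cases h : g = e
    · subst h
      left
      rcases hg with ⟨h1, rfl⟩ | ⟨h1, rfl⟩ <;> rcases he with ⟨h2, rfl⟩ | ⟨h2, rfl⟩
      · rfl
      · exact absurd (h2.trans h1.symm) hne
      · exact absurd (h1.trans h2.symm) hne
      · rfl
    · exact Or.inr (hg.neg_div_mem_slitPlane he h)
  by_cases h1 : G.src e = v
  · refine ⟨∑ j ∈ Finset.range (G.len e - 1), ang e (j + 1) (G.pos v), fun g γ hg => ?_⟩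
    have he : IsEnd v e (G.pt e 1 - G.pt e 0) := Or.inl ⟨h1, rfl⟩
    have hc := hcase g γ _ hg he
    have hr : Finset.range (G.len e) = Finset.range (G.len e - 1 + 1) := by
      rw [Nat.sub_add_cancel hl]
    rw [hr, endAng, if_pos h1]
    simp only [Finset.sum_range_succ']
    refine (tendsto_finsetSum _ fun j hj => ?_).add ?_
    · subst h1
      exact (continuousAt_ang (src_notMem_closedSeg hne (by
        have := Finset.mem_range.1 hj; omega))).tendsto.comp (tendsto_ray _ γ)
    · refine (tendsto_arg_endpoint he.ne_zero hc).1.congr fun s => ?_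
      rw [ang, G.pt_zero, h1]
      congr 2 <;> ring
  · by_cases h2 : G.tgt e = v
    · refine ⟨∑ j ∈ Finset.range (G.len e - 1), ang e j (G.pos v), fun g γ hg => ?_⟩
      have he : IsEnd v e (G.pt e (G.len e - 1) - G.pt e (G.len e)) := Or.inr ⟨h2, rfl⟩
      have hc := hcase g γ _ hg he
      have hr : Finset.range (G.len e) = Finset.range (G.len e - 1 + 1) := by
        rw [Nat.sub_add_cancel hl]
      rw [hr, endAng, if_neg h1, if_pos h2]
      simp only [Finset.sum_range_succ]
      refine (tendsto_finsetSum _ fun j hj => ?_).add ?_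
      · subst h2
        exact (continuousAt_ang (tgt_notMem_closedSeg hne (by
          have := Finset.mem_range.1 hj; omega))).tendsto.comp (tendsto_ray _ γ)
      · refine (tendsto_arg_endpoint he.ne_zero hc).2.congr fun s => ?_
        rw [ang, Nat.sub_add_cancel hl, G.pt_len, h2]
        congr 2 <;> ring
    · refine ⟨∑ j ∈ Finset.range (G.len e), ang e j (G.pos v), fun g γ _ => ?_⟩
      rw [endAng, if_neg h1, if_neg h2, add_zero]
      exact tendsto_finsetSum _ fun j hj => (continuousAt_ang
        (notMem_closedSeg_of_not_incident h1 h2 (Finset.mem_range.1 hj))).tendsto.comp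
          (tendsto_ray _ γ)

/-- The values of `pot c` on the faces to the left of the edges at a vertex. -/
theorem exists_pot_left_formula {c : G.E → ℤ} (hc : IsCirculation c)
    (hloop : ∀ e, G.tgt e ≠ G.src e) (v : G.V) :
    ∃ K : ℝ, ∀ g γ, IsEnd v g γ →
      -(2 * Real.pi * pot c (left g)) = K + ∑ e, (c e : ℝ) * endAng v γ e := by
  choose K hK using fun e => exists_tendsto_sum_ang v e (hloop e)
  refine ⟨∑ e, (c e : ℝ) * K e, fun g γ hg => ?_⟩
  have hpi := Real.pi_pos
  have hlim := tendsto_finsetSum Finset.univ fun e _ =>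
    (hK e g γ hg).const_mul (c e : ℝ)
  obtain ⟨j, hj, H⟩ := hg.exists_seg
  -- The approach to `v` runs along `g` itself, where the winding number is the one of the left
  -- face.
  have hconst : ∀ᶠ s : ℝ in 𝓝[>] 0, -(2 * Real.pi * pot c (left g)) =
      ∑ e, (c e : ℝ) * ∑ j ∈ Finset.range (G.len e), ang e j (G.pos v + s * γ) := by
    filter_upwards [Ioo_mem_nhdsGT (zero_lt_one' ℝ)] with s hs
    obtain ⟨s', h0, h1, h2⟩ := H s hs.1 hs.2
    have h3 := wind_seg hc hj h0 h1
    rw [← h2, wind, div_eq_iff (by positivity)] at h3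
    rw [h3]; ring
  have := tendsto_nhds_unique (Tendsto.congr' hconst tendsto_const_nhds) hlim
  rw [this, ← Finset.sum_add_distrib]
  exact Finset.sum_congr rfl fun e _ => by ring

end PlaneGraph

/-! ### Directed cycles, chains of paths, and planar duality -/

/-- In a finite directed graph with sets of vertices `M` from whose members one can always move on
inside `M`, there is a non-zero non-negative circulation. -/
theorem exists_nonneg_circulation {N E : Type*} [Finite N] [Fintype E] (a b : E → N) {M : Set N}
    (hM : M.Nonempty) (h : ∀ n ∈ M, ∃ e, a e = n ∧ b e ∈ M) :
    ∃ φ : E → ℤ, (∀ e, 0 ≤ φ e) ∧ (∃ e, 0 < φ e) ∧ (∀ e, φ e ≠ 0 → a e ∈ M ∧ b e ∈ M) ∧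
      ∀ f : N → ℝ, ∑ e, (φ e : ℝ) * (f (b e) - f (a e)) = 0 := by
  classical
  choose g hg1 hg2 using fun n : M => h n.1 n.2
  let next : M → M := fun n => ⟨b (g n), hg2 n⟩
  obtain ⟨x, hx⟩ := hM
  -- Iterating `next` on the finite set `M` must return to an earlier vertex. The circulation counts
  -- how often each edge is used in one period.
  obtain ⟨y, k, hk, hy⟩ : ∃ (y : M) (k : ℕ), 0 < k ∧ next^[k] y = y := by
    obtain ⟨i, j, hij, he⟩ := Finite.exists_ne_map_eq_of_infinite (fun n : ℕ => next^[n] ⟨x, hx⟩)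
    wlog hlt : i < j generalizing i j
    · exact this j i hij.symm he.symm (by omega)
    refine ⟨next^[i] ⟨x, hx⟩, j - i, by omega, ?_⟩
    rw [← Function.iterate_add_apply, Nat.sub_add_cancel hlt.le]
    exact he.symm
  have key : ∀ h : E → ℝ, ∑ e, ((((Finset.range k).filter fun l => g (next^[l] y) = e).card : ℤ) : ℝ) * h e
      = ∑ l ∈ Finset.range k, h (g (next^[l] y)) := by
    intro h
    rw [← Finset.sum_fiberwise (Finset.range k) (fun l => g (next^[l] y))]
    refine Finset.sum_congr rfl fun e _ => ?_
    rw [Finset.sum_congr rfl (g := fun _ => h e)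
      (fun l hl => by rw [(Finset.mem_filter.1 hl).2]), Finset.sum_const, nsmul_eq_mul]
    norm_cast
  refine ⟨fun e => ((Finset.range k).filter fun l => g (next^[l] y) = e).card,
    fun e => by positivity, ⟨g y, ?_⟩, fun e he => ?_, fun f => ?_⟩
  · have : 0 < ((Finset.range k).filter fun l => g (next^[l] y) = g y).card :=
      Finset.card_pos.2 ⟨0, by simp [hk]⟩
    exact Nat.cast_pos.2 this
  · have he : ((Finset.range k).filter fun l => g (next^[l] y) = e).card ≠ 0 := Nat.cast_ne_zero.1 he
    obtain ⟨l, hl⟩ := Finset.card_pos.1 (Nat.pos_of_ne_zero he)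
    obtain ⟨-, rfl⟩ := Finset.mem_filter.1 hl
    exact ⟨by rw [hg1]; exact (next^[l] y).2, hg2 _⟩
  · rw [key fun e => f (b e) - f (a e)]
    have h1 : ∀ l, f (b (g (next^[l] y))) - f (a (g (next^[l] y))) =
        f (next^[l + 1] y).1 - f (next^[l] y).1 := by
      intro l
      rw [hg1, Function.iterate_succ_apply']
    rw [Finset.sum_congr rfl fun l _ => h1 l, Finset.sum_range_sub (fun l => f (next^[l] y).1), hy]
    simp

namespace PlaneGraph
open Set

variable {G : PlaneGraph}

theorem edges_comp {x y z : G.V} (p : Quiver.Path x y) (q : Quiver.Path y z) :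
    edges (p.comp q) = edges p ++ edges q := by
  induction q with
  | nil => simp [edges]
  | cons q e ih => simp [edges, ih]

open Classical in
/-- The 1-chain of a path. -/
noncomputable def chain {x y : G.V} (p : Quiver.Path x y) (e : G.E) : ℤ := (edges p).count e

@[simp]
theorem chain_nil (x : G.V) : chain (Quiver.Path.nil : Quiver.Path x x) = 0 := by
  funext e; simp [chain, edges]

theorem chain_comp {x y z : G.V} (p : Quiver.Path x y) (q : Quiver.Path y z) :
    chain (p.comp q) = chain p + chain q := by
  funext e; simp [chain, edges_comp]

theorem chain_nonneg {x y : G.V} (p : Quiver.Path x y) (e : G.E) : 0 ≤ chain p e := by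
  simp [chain]

theorem chain_pos_iff {x y : G.V} {p : Quiver.Path x y} {e : G.E} : 0 < chain p e ↔ e ∈ edges p := by
  classical
  simp [chain, List.count_pos_iff]

theorem chain_eq_zero_iff {x y : G.V} {p : Quiver.Path x y} {e : G.E} :
    chain p e = 0 ↔ e ∉ edges p := by
  rw [← chain_pos_iff, not_lt]
  exact ⟨fun h => h.le, fun h => le_antisymm h (chain_nonneg p e)⟩

theorem sum_chain {x y : G.V} (p : Quiver.Path x y) (f : G.V → ℝ) :
    ∑ e, (chain p e : ℝ) * (f (G.tgt e) - f (G.src e)) = f y - f x := by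
  classical
  induction p with
  | nil => simp
  | @cons b c p e ih =>
    obtain ⟨e, rfl, rfl⟩ := e
    have h : ∀ e', (chain (p.cons ⟨e, rfl, rfl⟩) e' : ℝ) = chain p e' + if e' = e then 1 else 0 := by
      intro e'
      by_cases h : e' = e
      · simp [chain, edges, h]
      · simp [chain, edges, h, Ne.symm h]
    simp only [h, add_mul, Finset.sum_add_distrib, ih]
    simp

theorem isCirculation_chain_sub {x y : G.V} (p q : Quiver.Path x y) :
    IsCirculation (chain p - chain q) := fun f => by
  simp only [Pi.sub_apply, Int.cast_sub, sub_mul, Finset.sum_sub_distrib, sum_chain, sub_self]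

theorem isCirculation_chain {x : G.V} (p : Quiver.Path x x) : IsCirculation (chain p) := fun f => by
  rw [sum_chain, sub_self]

theorem exists_chain_of_isConnected (hG : G.IsConnected) (x y : G.V) :
    ∃ c : G.E → ℤ, ∀ f : G.V → ℝ, ∑ e, (c e : ℝ) * (f (G.tgt e) - f (G.src e)) = f y - f x := by
  classical
  induction hG.2 x y with
  | rel x y h =>
    obtain ⟨e, rfl, rfl⟩ := h
    exact ⟨Pi.single e 1, fun f => by simp [Pi.single_apply]⟩
  | refl x => exact ⟨0, fun f => by simp⟩
  | symm x y _ ih =>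
    obtain ⟨c, hc⟩ := ih
    exact ⟨-c, fun f => by
      simp only [Pi.neg_apply, Int.cast_neg, neg_mul, Finset.sum_neg_distrib, hc]; ring⟩
  | trans x y z _ _ ih ih' =>
    obtain ⟨c, hc⟩ := ih
    obtain ⟨c', hc'⟩ := ih'
    exact ⟨c + c', fun f => by
      simp only [Pi.add_apply, Int.cast_add, add_mul, Finset.sum_add_distrib, hc, hc']; ring⟩

/-- A 1-cycle of the dual graph is a coboundary. -/
theorem exists_eq_sub_of_dual_cycle (hG : G.IsConnected) {φ : G.E → ℤ}
    (h : ∀ g : G.Face → ℝ, ∑ e, (φ e : ℝ) * (g (right e) - g (left e)) = 0) :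
    ∃ ψ : G.V → ℝ, ∀ e, ψ (G.tgt e) - ψ (G.src e) = φ e := by
  classical
  obtain ⟨x⟩ := hG.1
  choose c hc using fun y => exists_chain_of_isConnected hG x y
  -- The potential of `y` is the integral of `φ` along a chain from a base vertex to `y`.
  refine ⟨fun y => ∑ e, (c y e : ℝ) * φ e, fun e => ?_⟩
  have hcirc : IsCirculation (c (G.tgt e) - c (G.src e) - Pi.single e 1) := fun f => by
    have h1 := hc (G.tgt e) f
    have h2 := hc (G.src e) f
    simp only [Pi.sub_apply, Int.cast_sub, sub_mul, Finset.sum_sub_distrib, h1, h2]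
    simp [Pi.single_apply]
  -- The chains to the two ends of `e` differ from `e` by a 1-cycle, hence by the boundary of a
  -- 2-chain, and `φ` integrates to zero over such boundaries.
  have h3 := h fun F => pot (c (G.tgt e) - c (G.src e) - Pi.single e 1) F
  have h4 : ∀ e', (pot (c (G.tgt e) - c (G.src e) - Pi.single e 1) (right e') : ℝ) -
      pot (c (G.tgt e) - c (G.src e) - Pi.single e 1) (left e') =
      c (G.tgt e) e' - c (G.src e) e' - if e' = e then 1 else 0 := by
    intro e'
    have := eq_pot_sub_pot hcirc e'
    rw [← Int.cast_sub, ← this]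
    simp [Pi.single_apply]
  simp only [h4, mul_sub, Finset.sum_sub_distrib] at h3
  simp only [mul_ite, mul_one, mul_zero, Finset.sum_ite_eq', Finset.mem_univ, if_true] at h3
  simp only [mul_comm (φ _ : ℝ)] at h3
  linarith

theorem eq_of_forall_mem_edges {ψ : G.V → ℝ} {x y : G.V} (p : Quiver.Path x y)
    (h : ∀ e ∈ edges p, ψ (G.src e) = ψ (G.tgt e)) :
    ψ y = ψ x ∧ ∀ e ∈ edges p, ψ (G.src e) = ψ x ∧ ψ (G.tgt e) = ψ x := by
  induction p with
  | nil => simp [edges]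
  | cons p e ih =>
    obtain ⟨e, rfl, rfl⟩ := e
    obtain ⟨h1, h2⟩ := ih fun e' he' => h e' (by simp [edges, he'])
    have h3 := h e (by simp [edges])
    refine ⟨by rw [← h3, h1], fun e' he' => ?_⟩
    simp only [edges, List.mem_append, List.mem_singleton] at he'
    rcases he' with he' | rfl
    · exact h2 e' he'
    · exact ⟨h1, by rw [← h3, h1]⟩

theorem edges_ne_nil {x y : G.V} {p : Quiver.Path x y} (h : 0 < p.length) : ∃ e, e ∈ edges p := by
  cases p with
  | nil => simp at h
  | cons p e => exact ⟨e.1, by simp [edges]⟩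

/-- The faces that can be reached from an unbounded face by crossing edges without entering `A`. -/
inductive Outside (A : Set G.Face) : G.Face → Prop
  | ext (F : G.Face) : ¬ Bornology.IsBounded F.1 → Outside A F
  | left (e : G.E) : Outside A (right e) → left e ∉ A → Outside A (left e)
  | right (e : G.E) : Outside A (left e) → right e ∉ A → Outside A (right e)

/-- A non-empty set of interior faces that can be left only to the left, or only to the right,
through its boundary. -/
structure IsTrap (A : Set G.Face) : Prop where
  nonempty : A.Nonempty
  bounded : ∀ F ∈ A, Bornology.IsBounded F.1
  closed : (∀ e, left e ∈ A → right e ∈ A) ∨ (∀ e, right e ∈ A → left e ∈ A)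

theorem Outside.mono {A B : Set G.Face} (h : A ⊆ B) {F : G.Face} (hF : Outside B F) :
    Outside A F := by
  induction hF with
  | ext F h => exact .ext F h
  | left e _ h' ih => exact .left e ih fun h2 => h' (h h2)
  | right e _ h' ih => exact .right e ih fun h2 => h' (h h2)

theorem Outside.notMem {A : Set G.Face} (hA : ∀ F ∈ A, Bornology.IsBounded F.1) {F : G.Face}
    (hF : Outside A F) : F ∉ A := by
  induction hF with
  | ext F h => exact fun h' => h (hA F h')
  | left e _ h' _ => exact h'
  | right e _ h' _ => exact h'

theorem outside_fill {A : Set G.Face} {F : G.Face} (hF : Outside A F) :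
    Outside {F | ¬ Outside A F} F := by
  induction hF with
  | ext F h => exact .ext F h
  | left e h h' ih => exact .left e ih fun h2 => h2 (.left e h h')
  | right e h h' ih => exact .right e ih fun h2 => h2 (.right e h h')

/-- An edge between the filled set and the outside must border `A` on its inner side, for otherwise
the inner face could be reached from outside. So filling the holes creates no new exits. -/
theorem IsTrap.fill {A : Set G.Face} (hA : IsTrap A) : IsTrap {F | ¬ Outside A F} where
  nonempty := hA.nonempty.mono fun _ hF h => h.notMem hA.bounded hF
  bounded F hF := by
    by_contra h
    exact hF (.ext F h)
  closed := by
    refine hA.closed.imp (fun h e he he' => ?_) (fun h e he he' => ?_)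
    · by_cases h2 : PlaneGraph.left e ∈ A
      · exact he'.notMem hA.bounded (h e h2)
      · exact he (.left e he' h2)
    · by_cases h2 : PlaneGraph.right e ∈ A
      · exact he'.notMem hA.bounded (h e h2)
      · exact he (.right e he' h2)

/-- A non-negative 1-cycle encloses a trap. -/
theorem exists_isTrap {c : G.E → ℤ} (hc : IsCirculation c) (h0 : ∀ e, 0 ≤ c e) (hne : ∃ e, 0 < c e) :
    ∃ A : Set G.Face, IsTrap A ∧ ∀ F ∈ A, pot c F ≠ 0 := by
  obtain ⟨e₀, he₀⟩ := hne
  have hD := eq_pot_sub_pot hc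
  have : Nonempty G.Face := ⟨left e₀⟩
  obtain ⟨F₁, h1⟩ := Finite.exists_max (pot c)
  obtain ⟨F₂, h2⟩ := Finite.exists_min (pot c)
  -- Since `c` is non-negative, `pot c` cannot decrease from left to right across an edge. The faces
  -- of maximal positive value are closed in that sense; if there are none, the faces of minimal
  -- negative value are closed in the other.
  by_cases hpos : 0 < pot c F₁
  · refine ⟨{F | pot c F = pot c F₁}, ⟨⟨F₁, rfl⟩, fun F hF => ?_, Or.inl fun e he => ?_⟩,
      fun F hF => by rw [show pot c F = _ from hF]; omega⟩
    · by_contra hb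
      have := pot_eq_zero hc hb
      rw [show pot c F = _ from hF] at this
      omega
    · have := hD e
      have := h0 e
      have := h1 (right e)
      simp only [mem_ofPred_eq] at he ⊢
      omega
  · have hneg : pot c F₂ < 0 := by
      have := hD e₀
      have := h1 (right e₀)
      have := h2 (left e₀)
      omega
    refine ⟨{F | pot c F = pot c F₂}, ⟨⟨F₂, rfl⟩, fun F hF => ?_, Or.inr fun e he => ?_⟩,
      fun F hF => by rw [show pot c F = _ from hF]; omega⟩
    · by_contra hb
      have := pot_eq_zero hc hb
      rw [show pot c F = _ from hF] at this
      omega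
    · have := hD e
      have := h0 e
      have := h2 (left e)
      simp only [mem_ofPred_eq] at he ⊢
      omega

end PlaneGraph

/-! ### Absence of directed cycles -/

namespace PastingScheme
open PlaneGraph Set

variable (P : PastingScheme)

theorem mem_dom_iff (e : P.graph.E) : e ∈ edges P.dom ↔ ¬ Bornology.IsBounded (left e).1 := by
  rw [P.forms_dom.2.2 e]
  constructor
  · rintro ⟨F, hF, h⟩
    rw [(hasOnLeft_iff e ⟨F, hF.1⟩).1 h]
    exact hF.2
  · exact fun h => ⟨_, ⟨(left e).2, h⟩, (hasOnLeft_iff e _).2 rfl⟩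

theorem mem_cod_iff (e : P.graph.E) : e ∈ edges P.cod ↔ ¬ Bornology.IsBounded (right e).1 := by
  rw [P.forms_cod.2.2 e]
  constructor
  · rintro ⟨F, hF, h⟩
    rw [(hasOnRight_iff e ⟨F, hF.1⟩).1 h]
    exact hF.2
  · exact fun h => ⟨_, ⟨(right e).2, h⟩, (hasOnRight_iff e _).2 rfl⟩

variable {P}

/-- An anchored interior face as a face. -/
def _root_.PlaneGraph.AnchoredFace.toFace {x y : P.graph.V} (c : P.graph.AnchoredFace x y) :
    P.graph.Face := ⟨c.face, c.isInteriorFace.1⟩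

theorem mem_edges_dom {x y : P.graph.V} (c : P.graph.AnchoredFace x y) (e : P.graph.E) :
    e ∈ edges c.dom ↔ right e = c.toFace := by
  rw [c.forms_dom.2.2 e]
  exact hasOnRight_iff e c.toFace

theorem mem_edges_cod {x y : P.graph.V} (c : P.graph.AnchoredFace x y) (e : P.graph.E) :
    e ∈ edges c.cod ↔ left e = c.toFace := by
  rw [c.forms_cod.2.2 e]
  exact hasOnLeft_iff e c.toFace

theorem exists_anchoredFace {F : P.graph.Face} (hF : Bornology.IsBounded F.1) :
    ∃ x y, ∃ c : P.graph.AnchoredFace x y, c.toFace = F := by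
  obtain ⟨x, y, c, h⟩ := P.anchorable F.1 ⟨F.2, hF⟩
  exact ⟨x, y, c, Subtype.ext h⟩

theorem exists_not_isBounded : ∃ F : P.graph.Face, ¬ Bornology.IsBounded F.1 := by
  obtain ⟨e, he⟩ := edges_ne_nil P.forms_dom.1
  exact ⟨_, (P.mem_dom_iff e).1 he⟩

/-- This is the descent step. A directed dual cycle in the trap gives a potential on the vertices,
whose extremal level carries a directed cycle inside `A`. That cycle encloses a trap whose filling
is strictly smaller. -/
theorem IsTrap.false_of_minimal {A : Set P.graph.Face} (hA : IsTrap A)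
    (hfill : ∀ F, ¬ Outside A F → F ∈ A)
    (hmin : ∀ B : Set P.graph.Face, IsTrap B → A.ncard ≤ {F | ¬ Outside B F}.ncard) : False := by
  -- An interior face has edges on both its upper and its lower side, so from each face of `A` one
  -- can cross an edge in the sense in which `A` is closed.
  obtain ⟨φ, hφ0, hφ1, hφA, hφ⟩ : ∃ φ : P.graph.E → ℤ, (∀ e, 0 ≤ φ e) ∧ (∃ e, 0 < φ e) ∧
      (∀ e, φ e ≠ 0 → left e ∈ A ∧ right e ∈ A) ∧
      ∀ g : P.graph.Face → ℝ, ∑ e, (φ e : ℝ) * (g (right e) - g (left e)) = 0 := by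
    rcases hA.closed with h | h
    · refine exists_nonneg_circulation left right hA.nonempty fun F hF => ?_
      obtain ⟨x, y, c, rfl⟩ := exists_anchoredFace (hA.bounded F hF)
      obtain ⟨e, he⟩ := edges_ne_nil c.forms_cod.1
      rw [mem_edges_cod] at he
      exact ⟨e, he, h e (he ▸ hF)⟩
    · obtain ⟨φ, h1, h2, h3, h4⟩ := exists_nonneg_circulation (right (G := P.graph)) left hA.nonempty
        fun F hF => by
          obtain ⟨x, y, c, rfl⟩ := exists_anchoredFace (hA.bounded F hF)
          obtain ⟨e, he⟩ := edges_ne_nil c.forms_dom.1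
          rw [mem_edges_dom] at he
          exact ⟨e, he, h e (he ▸ hF)⟩
      refine ⟨φ, h1, h2, fun e he => (h3 e he).symm, fun g => ?_⟩
      rw [← neg_zero, ← h4 g, ← Finset.sum_neg_distrib]
      exact Finset.sum_congr rfl fun e _ => by ring
  obtain ⟨ψ, hψ⟩ := exists_eq_sub_of_dual_cycle P.connected hφ
  have hflat : ∀ e, left e ∉ A ∨ right e ∉ A → ψ (P.graph.src e) = ψ (P.graph.tgt e) := by
    intro e he
    have h0 : φ e = 0 := by
      by_contra h
      have := hφA e h
      tauto
    have := hψ e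
    rw [h0] at this
    push_cast at this
    linarith
  have hext : ∀ F : P.graph.Face, ¬ Bornology.IsBounded F.1 → F ∉ A := fun F hF h =>
    hF (hA.bounded F h)
  have hdom := eq_of_forall_mem_edges P.dom fun e he =>
    hflat e (Or.inl (hext _ ((P.mem_dom_iff e).1 he)))
  have hcod := eq_of_forall_mem_edges P.cod fun e he =>
    hflat e (Or.inr (hext _ ((P.mem_cod_iff e).1 he)))
  -- The two sides of a face outside `A` start at the same vertex and `ψ` is constant along each, so
  -- `ψ` is constant on the boundary of the face. The value `ψ P.s` spreads from the exterior
  -- through shared edges.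
  have hbdry : ∀ F, Outside A F → ∀ e, left e = F ∨ right e = F →
      ψ (P.graph.src e) = ψ P.s ∧ ψ (P.graph.tgt e) = ψ P.s := by
    have hbase : ∀ F : P.graph.Face, ¬ Bornology.IsBounded F.1 → ∀ e, left e = F ∨ right e = F →
        ψ (P.graph.src e) = ψ P.s ∧ ψ (P.graph.tgt e) = ψ P.s := by
      rintro F hF e (rfl | rfl)
      · exact hdom.2 e ((P.mem_dom_iff e).2 hF)
      · exact hcod.2 e ((P.mem_cod_iff e).2 hF)
    have hstep : ∀ (F : P.graph.Face) (e₀ : P.graph.E), F ∉ A → left e₀ = F ∨ right e₀ = F →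
        ψ (P.graph.src e₀) = ψ P.s → ∀ e, left e = F ∨ right e = F →
        ψ (P.graph.src e) = ψ P.s ∧ ψ (P.graph.tgt e) = ψ P.s := by
      intro F e₀ hF he₀ h0
      by_cases hb : Bornology.IsBounded F.1
      · obtain ⟨x, y, c, rfl⟩ := exists_anchoredFace hb
        have hd := eq_of_forall_mem_edges c.dom fun e he =>
          hflat e (Or.inr (by rwa [(mem_edges_dom c e).1 he]))
        have hc := eq_of_forall_mem_edges c.cod fun e he =>
          hflat e (Or.inl (by rwa [(mem_edges_cod c e).1 he]))
        have hall : ∀ e, left e = c.toFace ∨ right e = c.toFace →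
            ψ (P.graph.src e) = ψ x ∧ ψ (P.graph.tgt e) = ψ x := by
          rintro e (he | he)
          · exact hc.2 e ((mem_edges_cod c e).2 he)
          · exact hd.2 e ((mem_edges_dom c e).2 he)
        rw [(hall e₀ he₀).1] at h0
        rwa [← h0]
      · exact hbase F hb
    intro F hF
    induction hF with
    | ext F h => exact hbase F h
    | left e _ h' ih => exact hstep _ e h' (Or.inl rfl) (ih e (Or.inr rfl)).1
    | right e _ h' ih => exact hstep _ e h' (Or.inr rfl) (ih e (Or.inl rfl)).1
  -- As `ψ` is not constant, its maximum or its minimum differs from its common value at `s` and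
  -- `t`. Vertices of that level are not sinks, respectively not sources, and moving along edges,
  -- respectively against them, stays in the level by monotonicity.
  obtain ⟨c, hc0, hc1, hcM, hcirc⟩ : ∃ c : P.graph.E → ℤ, (∀ e, 0 ≤ c e) ∧ (∃ e, 0 < c e) ∧
      (∀ e, c e ≠ 0 → ψ (P.graph.src e) ≠ ψ P.s) ∧ IsCirculation c := by
    have : Nonempty P.graph.V := ⟨P.s⟩
    obtain ⟨v₁, h1⟩ := Finite.exists_max ψ
    obtain ⟨v₂, h2⟩ := Finite.exists_min ψ
    have hmono : ∀ e, ψ (P.graph.src e) ≤ ψ (P.graph.tgt e) := fun e => by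
      have := hψ e
      have : (0 : ℝ) ≤ φ e := by exact_mod_cast hφ0 e
      linarith
    by_cases hpos : ψ P.s < ψ v₁
    · obtain ⟨c, a1, a2, a3, a4⟩ := exists_nonneg_circulation P.graph.src P.graph.tgt
        (M := {v | ψ v = ψ v₁}) ⟨v₁, rfl⟩ fun v hv => by
          have hv : ψ v = ψ v₁ := hv
          obtain ⟨e, he⟩ : ∃ e, P.graph.src e = v := by
            by_contra hcon
            push Not at hcon
            have := (P.local_sink v).1 hcon
            subst this
            linarith [hdom.1]
          refine ⟨e, he, le_antisymm (h1 _) ?_⟩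
          rw [← hv, ← he]
          exact hmono e
      exact ⟨c, a1, a2, fun e he => by rw [(a3 e he).1]; exact hpos.ne', a4⟩
    · have hneg : ψ v₂ < ψ P.s := by
        obtain ⟨e, he⟩ := hφ1
        have h3 := hψ e
        have h4 : (0 : ℝ) < φ e := by exact_mod_cast he
        have := h1 (P.graph.tgt e)
        have := h2 (P.graph.src e)
        linarith
      obtain ⟨c, a1, a2, a3, a4⟩ := exists_nonneg_circulation P.graph.tgt P.graph.src
        (M := {v | ψ v = ψ v₂}) ⟨v₂, rfl⟩ fun v hv => by
          have hv : ψ v = ψ v₂ := hv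
          obtain ⟨e, he⟩ : ∃ e, P.graph.tgt e = v := by
            by_contra hcon
            push Not at hcon
            have := (P.local_source v).1 hcon
            subst this
            linarith
          refine ⟨e, he, le_antisymm ?_ (h2 _)⟩
          rw [← hv, ← he]
          exact hmono e
      refine ⟨c, a1, a2, fun e he => by rw [(a3 e he).2]; exact hneg.ne, fun f => ?_⟩
      rw [← neg_zero, ← a4 f, ← Finset.sum_neg_distrib]
      exact Finset.sum_congr rfl fun e _ => by ring
  have hcA : ∀ e, left e ∉ A ∨ right e ∉ A → c e = 0 := by
    intro e he
    by_contra h0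
    refine hcM e h0 ?_
    rcases he with he | he
    · exact (hbdry _ (not_not.1 fun h => he (hfill _ h)) e (Or.inl rfl)).1
    · exact (hbdry _ (not_not.1 fun h => he (hfill _ h)) e (Or.inr rfl)).1
  have hD := eq_pot_sub_pot hcirc
  have hD0 : ∀ F, Outside A F → pot c F = 0 := by
    intro F hF
    induction hF with
    | ext F h => exact pot_eq_zero hcirc h
    | left e _ h' ih => have := hD e; have := hcA e (Or.inl h'); omega
    | right e _ h' ih => have := hD e; have := hcA e (Or.inr h'); omega
  obtain ⟨B, hB, hB0⟩ := exists_isTrap hcirc hc0 hc1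
  have hBA : B ⊆ A := fun F hF => hfill F fun h => hB0 F hF (hD0 F h)
  -- Some edge separates `A` from its complement. The cycle `c` does not use it, so `pot c` vanishes
  -- on its inner face as well; that face is reachable from outside without entering `B`.
  obtain ⟨F₁, hF₁, hF₁B⟩ : ∃ F ∈ A, Outside B F := by
    by_contra hcon
    push Not at hcon
    obtain ⟨F, hF⟩ := hA.nonempty
    obtain ⟨F', hF'⟩ := exists_not_isBounded (P := P)
    refine hext F' hF' (mem_of_forall_left_iff_right (fun e => ?_) hF)
    by_contra hne
    have hce : c e = 0 := hcA e (by tauto)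
    have hde := hD e
    by_cases hl : left e ∈ A
    · have hr : right e ∉ A := by tauto
      have hro : Outside A (right e) := not_not.1 fun h => hr (hfill _ h)
      have := hD0 _ hro
      exact hcon _ hl (.left e (hro.mono hBA) fun h => hB0 _ h (by omega))
    · have hr : right e ∈ A := by tauto
      have hlo : Outside A (left e) := not_not.1 fun h => hl (hfill _ h)
      have := hD0 _ hlo
      exact hcon _ hr (.right e (hlo.mono hBA) fun h => hB0 _ h (by omega))
  have hlt : {F | ¬ Outside B F}.ncard < A.ncard := by
    refine Set.ncard_lt_ncard ⟨fun F hF => hfill F fun h => hF (h.mono hBA), fun h => ?_⟩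
      (Set.toFinite A)
    exact h hF₁ hF₁B
  exact absurd (hmin B hB) (by omega)

/-- A pasting scheme has no directed cycles. -/
theorem eq_zero_of_isCirculation {c : P.graph.E → ℤ} (hc : IsCirculation c) (h0 : ∀ e, 0 ≤ c e) :
    c = 0 := by
  by_contra hne
  obtain ⟨e, he⟩ : ∃ e, c e ≠ 0 := Function.ne_iff.1 hne
  obtain ⟨A₀, hA₀, -⟩ := exists_isTrap hc h0 ⟨e, lt_of_le_of_ne (h0 e) he.symm⟩
  have hex : ∃ n, ∃ B : Set P.graph.Face, IsTrap B ∧ {F | ¬ Outside B F}.ncard = n := ⟨_, A₀, hA₀, rfl⟩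
  classical
  obtain ⟨B, hB, hn⟩ := Nat.find_spec hex
  refine IsTrap.false_of_minimal hB.fill (fun F hF => fun h => hF (outside_fill h)) fun B' hB' => ?_
  rw [hn]
  exact Nat.find_min' hex ⟨B', hB', rfl⟩

theorem eq_nil_of_loop {x : P.graph.V} (p : Quiver.Path x x) : p = Quiver.Path.nil := by
  have h := eq_zero_of_isCirculation (isCirculation_chain p) (chain_nonneg p)
  by_contra hne
  have : 0 < p.length := Nat.pos_of_ne_zero fun h0 => hne (Quiver.Path.eq_nil_of_length_zero p h0)
  obtain ⟨e, he⟩ := edges_ne_nil this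
  have := chain_pos_iff.2 he
  rw [h] at this
  simp at this

end PastingScheme

/-! ### Factorizations of paths, and paths as sets of edges -/

namespace Quiver.Path

variable {V : Type*} [Quiver V]

theorem mem_vertices_comp {x y z : V} (p : Path x y) (q : Path y z) {v : V} :
    v ∈ (p.comp q).vertices ↔ v ∈ p.vertices ∨ v ∈ q.vertices := by
  induction q with
  | nil =>
    simp only [comp_nil, vertices_nil, List.mem_singleton]
    exact ⟨Or.inl, fun h => h.elim id fun h => h ▸ end_mem_vertices p⟩
  | cons q e ih => rw [comp_cons, mem_vertices_cons, mem_vertices_cons, ih]; tauto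

/-- Two factorizations of a path have a common refinement. -/
theorem comp_eq_comp {x y y' z : V} {p : Path x y} {q : Path y z} {p' : Path x y'} {q' : Path y' z}
    (h : p.comp q = p'.comp q') :
    (∃ m : Path y y', p' = p.comp m ∧ q = m.comp q') ∨
      ∃ m : Path y' y, p = p'.comp m ∧ q' = m.comp q := by
  induction q' with
  | nil => exact Or.inl ⟨q, by simpa using h.symm, rfl⟩
  | @cons b c q' e ih =>
    cases q with
    | nil => exact Or.inr ⟨q'.cons e, by simpa using h, rfl⟩
    | @cons b' _ q e' =>
      rw [comp_cons, comp_cons] at h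
      obtain rfl := obj_eq_of_cons_eq_cons h
      have h1 := eq_of_heq (heq_of_cons_eq_cons h)
      obtain rfl := eq_of_heq (hom_heq_of_cons_eq_cons h)
      rcases ih h1 with ⟨m, h2, h3⟩ | ⟨m, h2, h3⟩
      · exact Or.inl ⟨m, h2, by rw [h3]; rfl⟩
      · exact Or.inr ⟨m, h2, by rw [h3]; rfl⟩

end Quiver.Path

namespace PlaneGraph

variable {G : PlaneGraph}

/-- An edge as an arrow of the quiver of the graph. -/
def hom (e : G.E) : G.src e ⟶ G.tgt e := ⟨e, rfl, rfl⟩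

theorem exists_eq_comp_of_mem_edges {x y : G.V} {p : Quiver.Path x y} {e : G.E} (h : e ∈ edges p) :
    ∃ (p₁ : Quiver.Path x (G.src e)) (p₂ : Quiver.Path (G.tgt e) y),
      p = (p₁.cons (hom e)).comp p₂ := by
  induction p with
  | nil => simp [edges] at h
  | cons p f ih =>
    simp only [edges, List.mem_append, List.mem_singleton] at h
    rcases h with h | h
    · obtain ⟨p₁, p₂, rfl⟩ := ih h
      exact ⟨p₁, p₂.cons f, rfl⟩
    · obtain ⟨f, rfl, rfl⟩ := f
      subst h
      exact ⟨p, .nil, rfl⟩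

theorem src_mem_vertices {x y : G.V} {p : Quiver.Path x y} {e : G.E} (h : e ∈ edges p) :
    G.src e ∈ p.vertices := by
  obtain ⟨p₁, p₂, rfl⟩ := exists_eq_comp_of_mem_edges h
  rw [Quiver.Path.mem_vertices_comp, Quiver.Path.mem_vertices_cons]
  exact Or.inl (Or.inl p₁.end_mem_vertices)

theorem tgt_mem_vertices {x y : G.V} {p : Quiver.Path x y} {e : G.E} (h : e ∈ edges p) :
    G.tgt e ∈ p.vertices := by
  obtain ⟨p₁, p₂, rfl⟩ := exists_eq_comp_of_mem_edges h
  rw [Quiver.Path.mem_vertices_comp]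
  exact Or.inr p₂.start_mem_vertices

theorem exists_src_eq {x y v : G.V} {p : Quiver.Path x y} (hv : v ∈ p.vertices) (hne : v ≠ y) :
    ∃ e ∈ edges p, G.src e = v := by
  induction p with
  | nil => simp at hv; exact absurd hv hne
  | @cons b c p f ih =>
    obtain ⟨f, rfl, rfl⟩ := f
    rw [Quiver.Path.mem_vertices_cons] at hv
    by_cases h : v = G.src f
    · exact ⟨f, by simp [edges], h.symm⟩
    · obtain ⟨e, he, h'⟩ := ih (hv.resolve_right hne) h
      exact ⟨e, by simp [edges, he], h'⟩

theorem exists_tgt_eq {x y v : G.V} {p : Quiver.Path x y} (hv : v ∈ p.vertices) (hne : v ≠ x) :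
    ∃ e ∈ edges p, G.tgt e = v := by
  induction p with
  | nil => simp at hv; exact absurd hv hne
  | @cons b c p f ih =>
    obtain ⟨f, rfl, rfl⟩ := f
    rw [Quiver.Path.mem_vertices_cons] at hv
    by_cases h : v = G.tgt f
    · exact ⟨f, by simp [edges], h.symm⟩
    · obtain ⟨e, he, h'⟩ := ih (hv.resolve_right h)
      exact ⟨e, by simp [edges, he], h'⟩

theorem nonempty_path_of_mem {x y v : G.V} {p : Quiver.Path x y} (hv : v ∈ p.vertices) :
    Nonempty (Quiver.Path x v) ∧ Nonempty (Quiver.Path v y) := by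
  obtain ⟨p₁, p₂, -⟩ := Quiver.Path.exists_eq_comp_of_mem_vertices p hv
  exact ⟨⟨p₁⟩, ⟨p₂⟩⟩

end PlaneGraph

/-! ### Consequences of acyclicity, and the faces between parallel paths -/

namespace PastingScheme
open PlaneGraph

variable {P : PastingScheme}

theorem eq_of_paths {x y : P.graph.V} (p : Quiver.Path x y) (q : Quiver.Path y x) : x = y := by
  have := congrArg Quiver.Path.length (eq_nil_of_loop (p.comp q))
  rw [Quiver.Path.length_comp, Quiver.Path.length_nil] at this
  exact Quiver.Path.eq_of_length_zero p (by omega)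

theorem tgt_ne_src (e : P.graph.E) : P.graph.tgt e ≠ P.graph.src e := by
  intro h
  have key : ∀ (x y : P.graph.V) (h : y = x) (f : x ⟶ y), False := by
    rintro x _ rfl f
    exact Quiver.Path.cons_ne_nil Quiver.Path.nil f (eq_nil_of_loop _)
  exact key _ _ h (hom e)

/-- There is no path from the target of an edge to its source. -/
theorem not_path_tgt_src (e : P.graph.E) (p : Quiver.Path (P.graph.tgt e) (P.graph.src e)) : False :=
  tgt_ne_src e (eq_of_paths p (hom e).toPath)

theorem eq_of_src_eq {x y : P.graph.V} {p : Quiver.Path x y} {e e' : P.graph.E} (h : e ∈ edges p)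
    (h' : e' ∈ edges p) (hs : P.graph.src e = P.graph.src e') : e = e' := by
  obtain ⟨p₁, p₂, rfl⟩ := exists_eq_comp_of_mem_edges h
  simp only [edges_comp, edges, List.mem_append, List.mem_singleton] at h'
  rcases h' with (h' | h') | h'
  · obtain ⟨q₁, q₂, -⟩ := exists_eq_comp_of_mem_edges h'
    exact (not_path_tgt_src e' (hs ▸ q₂)).elim
  · exact h'.symm
  · obtain ⟨q₁, q₂, -⟩ := exists_eq_comp_of_mem_edges h'
    exact (not_path_tgt_src e (hs ▸ q₁)).elim

theorem eq_of_tgt_eq {x y : P.graph.V} {p : Quiver.Path x y} {e e' : P.graph.E} (h : e ∈ edges p)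
    (h' : e' ∈ edges p) (hs : P.graph.tgt e = P.graph.tgt e') : e = e' := by
  obtain ⟨p₁, p₂, rfl⟩ := exists_eq_comp_of_mem_edges h
  simp only [edges_comp, edges, List.mem_append, List.mem_singleton] at h'
  rcases h' with (h' | h') | h'
  · obtain ⟨q₁, q₂, -⟩ := exists_eq_comp_of_mem_edges h'
    exact (not_path_tgt_src e (hs ▸ q₂)).elim
  · exact h'.symm
  · obtain ⟨q₁, q₂, -⟩ := exists_eq_comp_of_mem_edges h'
    exact (not_path_tgt_src e' (hs ▸ q₁)).elim

theorem src_ne_end {x y : P.graph.V} {p : Quiver.Path x y} {e : P.graph.E} (h : e ∈ edges p) :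
    P.graph.src e ≠ y := by
  rintro rfl
  obtain ⟨-, p₂, -⟩ := exists_eq_comp_of_mem_edges h
  exact not_path_tgt_src e p₂

theorem tgt_ne_start {x y : P.graph.V} {p : Quiver.Path x y} {e : P.graph.E} (h : e ∈ edges p) :
    P.graph.tgt e ≠ x := by
  rintro rfl
  obtain ⟨p₁, -, -⟩ := exists_eq_comp_of_mem_edges h
  exact not_path_tgt_src e p₁

theorem chain_le_one {x y : P.graph.V} (p : Quiver.Path x y) (e : P.graph.E) : chain p e ≤ 1 := by
  classical
  induction p with
  | nil => simp [chain, edges]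
  | cons p f ih =>
    obtain ⟨f, rfl, rfl⟩ := f
    by_cases h : f = e
    · subst h
      have : chain p f = 0 := chain_eq_zero_iff.2 fun h => by
        obtain ⟨-, p₂, -⟩ := exists_eq_comp_of_mem_edges h
        exact not_path_tgt_src f p₂
      simp only [chain] at this
      simp only [chain, edges, List.count_append, List.count_singleton_self]
      omega
    · simp only [chain] at ih
      simpa [chain, edges, h] using ih

theorem chain_eq_one {x y : P.graph.V} {p : Quiver.Path x y} {e : P.graph.E} (h : e ∈ edges p) :
    chain p e = 1 := by
  have := chain_pos_iff.2 h
  have := chain_le_one p e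
  omega

/-- By acyclicity a path has at most one edge into each vertex, so the last edges coincide and can
be removed. -/
theorem path_eq_of_edges {x y : P.graph.V} {p q : Quiver.Path x y}
    (h : ∀ e, e ∈ edges p ↔ e ∈ edges q) : p = q := by
  induction p with
  | nil => exact (eq_nil_of_loop q).symm
  | @cons b c p f ih =>
    cases q with
    | nil => exact eq_nil_of_loop _
    | @cons b' _ q f' =>
      have hf : f.1 ∈ edges (q.cons f') := (h f.1).1 (by simp [edges])
      have he : f.1 = f'.1 := eq_of_tgt_eq hf (e' := f'.1) (by simp [edges])
        (f.2.2.trans f'.2.2.symm)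
      have hb : b = b' := by rw [← f.2.1, he, f'.2.1]
      subst hb
      obtain rfl : f = f' := Subtype.ext he
      rw [ih fun e => ?_]
      have := h e
      simp only [edges, List.mem_append, List.mem_singleton] at this
      by_cases hef : e = f.1
      · subst hef
        have h1 : f.1 ∉ edges p := fun h => src_ne_end h f.2.1
        have h2 : f.1 ∉ edges q := fun h => src_ne_end h f.2.1
        simp [h1, h2]
      · simpa [hef] using this

theorem comp_inj {x y z : P.graph.V} {p p' : Quiver.Path x y} {q q' : Quiver.Path y z}
    (h : p.comp q = p'.comp q') : p = p' ∧ q = q' := by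
  rcases Quiver.Path.comp_eq_comp h with ⟨m, rfl, rfl⟩ | ⟨m, rfl, rfl⟩ <;>
  · obtain rfl := eq_nil_of_loop m
    exact ⟨rfl, by simp⟩

theorem mem_edges_of_comp_left {x v y : P.graph.V} {p₁ : Quiver.Path x v} {p₂ : Quiver.Path v y}
    {e : P.graph.E} (h : e ∈ edges (p₁.comp p₂)) (ht : P.graph.tgt e = v) : e ∈ edges p₁ := by
  rw [edges_comp, List.mem_append] at h
  exact h.resolve_right fun h => tgt_ne_start h ht

theorem mem_edges_of_comp_right {x v y : P.graph.V} {p₁ : Quiver.Path x v} {p₂ : Quiver.Path v y}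
    {e : P.graph.E} (h : e ∈ edges (p₁.comp p₂)) (ht : P.graph.src e = v) : e ∈ edges p₂ := by
  rw [edges_comp, List.mem_append] at h
  exact h.resolve_left fun h => src_ne_end h ht

theorem exists_src_of_ne {v : P.graph.V} (h : v ≠ P.t) : ∃ e, P.graph.src e = v := by
  by_contra hcon
  push Not at hcon
  exact h ((P.local_sink v).1 hcon)

theorem exists_tgt_of_ne {v : P.graph.V} (h : v ≠ P.s) : ∃ e, P.graph.tgt e = v := by
  by_contra hcon
  push Not at hcon
  exact h ((P.local_source v).1 hcon)

variable (P) in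
theorem s_ne_t : P.s ≠ P.t := fun h => by
  obtain ⟨e, he⟩ := edges_ne_nil P.forms_dom.1
  obtain ⟨p₁, p₂, -⟩ := exists_eq_comp_of_mem_edges he
  exact not_path_tgt_src e (p₂.comp (h ▸ p₁))

/-- Vertices that cannot reach `t` are not sinks, and their successors cannot reach `t` either. They
would therefore carry a directed cycle. -/
theorem nonempty_path_to_t (v : P.graph.V) : Nonempty (Quiver.Path v P.t) := by
  by_contra hv
  obtain ⟨c, h0, ⟨e, he⟩, -, hc⟩ := exists_nonneg_circulation P.graph.src P.graph.tgt
    (M := {v | ¬ Nonempty (Quiver.Path v P.t)}) ⟨v, hv⟩ fun u hu => by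
      obtain ⟨e, rfl⟩ := exists_src_of_ne (v := u) (by rintro rfl; exact hu ⟨.nil⟩)
      exact ⟨e, rfl, fun ⟨p⟩ => hu ⟨(hom e).toPath.comp p⟩⟩
  rw [eq_zero_of_isCirculation hc h0] at he
  simp at he

theorem nonempty_path_from_s (v : P.graph.V) : Nonempty (Quiver.Path P.s v) := by
  by_contra hv
  obtain ⟨c, h0, ⟨e, he⟩, -, hc⟩ := exists_nonneg_circulation P.graph.tgt P.graph.src
    (M := {v | ¬ Nonempty (Quiver.Path P.s v)}) ⟨v, hv⟩ fun u hu => by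
      obtain ⟨e, rfl⟩ := exists_tgt_of_ne (v := u) (by rintro rfl; exact hu ⟨.nil⟩)
      exact ⟨e, rfl, fun ⟨p⟩ => hu ⟨p.cons (hom e)⟩⟩
  have hc' : IsCirculation c := fun f => by
    rw [← neg_zero, ← hc f, ← Finset.sum_neg_distrib]
    exact Finset.sum_congr rfl fun e _ => by ring
  rw [eq_zero_of_isCirculation hc' h0] at he
  simp at he

/-- The 1-cycle `c` does not meet the vertex `v`. -/
def Avoids (c : P.graph.E → ℤ) (v : P.graph.V) : Prop :=
  ∀ e, c e ≠ 0 → P.graph.src e ≠ v ∧ P.graph.tgt e ≠ v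

/-- The vertex `v` is not adjacent to any face in the support of `pot c`. -/
def PotZero (c : P.graph.E → ℤ) (v : P.graph.V) : Prop :=
  ∀ e, P.graph.src e = v ∨ P.graph.tgt e = v → pot c (left e) = 0 ∧ pot c (right e) = 0

/-- Around a vertex off the cycle all adjacent faces have the same value of `pot c`, so one zero
suffices. -/
theorem potZero_of_mem {c : P.graph.E → ℤ} (hc : IsCirculation c) {v : P.graph.V} (hv : Avoids c v)
    {e : P.graph.E} (he : P.graph.src e = v ∨ P.graph.tgt e = v)
    (h0 : pot c (left e) = 0 ∨ pot c (right e) = 0) : PotZero c v := by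
  obtain ⟨k, hk⟩ := exists_pot_eq_of_not_incident hc hv
  have hk0 : k = 0 := by
    have := hk e he
    omega
  subst hk0
  exact hk

theorem potZero_iff_of_path {c : P.graph.E → ℤ} (hc : IsCirculation c) {u v : P.graph.V}
    (p : Quiver.Path u v) (h : ∀ w ∈ p.vertices, Avoids c w) : PotZero c u ↔ PotZero c v := by
  induction p with
  | nil => rfl
  | cons p f ih =>
    obtain ⟨f, rfl, rfl⟩ := f
    rw [ih fun w hw => h w (by rw [Quiver.Path.mem_vertices_cons]; exact Or.inl hw)]
    have h1 := h (P.graph.src f) (by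
      rw [Quiver.Path.mem_vertices_cons]; exact Or.inl p.end_mem_vertices)
    have h2 := h (P.graph.tgt f) (Quiver.Path.end_mem_vertices _)
    exact ⟨fun h3 => potZero_of_mem hc h2 (Or.inr rfl) (Or.inl (h3 f (Or.inl rfl)).1),
      fun h3 => potZero_of_mem hc h1 (Or.inl rfl) (Or.inl (h3 f (Or.inr rfl)).1)⟩

/-- A path from `u` to `t` never meets the cycle, and an exterior face is adjacent to `t`, so the
value zero is carried back from `t` to `u`. -/
theorem potZero_of_descendants {c : P.graph.E → ℤ} (hc : IsCirculation c) {u : P.graph.V}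
    (h : ∀ w, Nonempty (Quiver.Path u w) → Avoids c w) : PotZero c u := by
  obtain ⟨p⟩ := nonempty_path_to_t u
  rw [potZero_iff_of_path hc p fun w hw => h w (nonempty_path_of_mem hw).1]
  obtain ⟨e, he, het⟩ := exists_tgt_eq P.dom.end_mem_vertices (P.s_ne_t).symm
  exact potZero_of_mem hc (h _ ⟨p⟩) (Or.inr het) (Or.inl (pot_eq_zero hc ((P.mem_dom_iff e).1 he)))

theorem potZero_of_ancestors {c : P.graph.E → ℤ} (hc : IsCirculation c) {u : P.graph.V}
    (h : ∀ w, Nonempty (Quiver.Path w u) → Avoids c w) : PotZero c u := by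
  obtain ⟨p⟩ := nonempty_path_from_s u
  rw [← potZero_iff_of_path hc p fun w hw => h w (nonempty_path_of_mem hw).2]
  obtain ⟨e, he, hes⟩ := exists_src_eq P.dom.start_mem_vertices P.s_ne_t
  exact potZero_of_mem hc (h _ ⟨p⟩) (Or.inl hes) (Or.inl (pot_eq_zero hc ((P.mem_dom_iff e).1 he)))

theorem chain_sub_ne_zero {x y : P.graph.V} {p q : Quiver.Path x y} {e : P.graph.E}
    (h : (chain p - chain q) e ≠ 0) : e ∈ edges p ∨ e ∈ edges q := by
  by_contra hcon
  push Not at hcon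
  rw [Pi.sub_apply, chain_eq_zero_iff.2 hcon.1, chain_eq_zero_iff.2 hcon.2] at h
  exact h rfl

theorem avoids_of_not_path {x y w : P.graph.V} (p q : Quiver.Path x y)
    (h : ¬ (Nonempty (Quiver.Path x w) ∧ Nonempty (Quiver.Path w y))) :
    Avoids (chain p - chain q) w := by
  intro e he
  have key : ∀ r : Quiver.Path x y, e ∈ edges r → P.graph.src e ≠ w ∧ P.graph.tgt e ≠ w := fun r hr =>
    ⟨fun h' => h (h' ▸ nonempty_path_of_mem (src_mem_vertices hr)),
      fun h' => h (h' ▸ nonempty_path_of_mem (tgt_mem_vertices hr))⟩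
  exact (chain_sub_ne_zero he).elim (key p) (key q)

/-- Between parallel paths to `v`, there are no faces adjacent to edges out of `v`. -/
theorem pot_eq_zero_of_src {x v : P.graph.V} (p q : Quiver.Path x v) {b : P.graph.E}
    (hb : P.graph.src b = v) :
    pot (chain p - chain q) (left b) = 0 ∧ pot (chain p - chain q) (right b) = 0 := by
  -- A vertex reachable from the target of `b` cannot lie on a path to `v`, as it would close a
  -- directed cycle through `b`.
  refine potZero_of_descendants (isCirculation_chain_sub p q) (u := P.graph.tgt b)
    (fun w ⟨r⟩ => avoids_of_not_path p q ?_) b (Or.inr rfl)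
  rintro ⟨-, ⟨r'⟩⟩
  subst hb
  exact not_path_tgt_src b (r.comp r')

/-- Between parallel paths from `v`, there are no faces adjacent to edges into `v`. -/
theorem pot_eq_zero_of_tgt {v y : P.graph.V} (p q : Quiver.Path v y) {a : P.graph.E}
    (ha : P.graph.tgt a = v) :
    pot (chain p - chain q) (left a) = 0 ∧ pot (chain p - chain q) (right a) = 0 := by
  refine potZero_of_ancestors (isCirculation_chain_sub p q) (u := P.graph.src a)
    (fun w ⟨r⟩ => avoids_of_not_path p q ?_) a (Or.inl rfl)
  rintro ⟨⟨r'⟩, -⟩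
  subst ha
  exact not_path_tgt_src a (r'.comp r)

/-- The faces between two parallel paths, counted with multiplicity. -/
noncomputable def between {x y : P.graph.V} (p q : Quiver.Path x y) (F : P.graph.Face) : ℤ :=
  pot (chain p - chain q) F

theorem between_comp {x v y : P.graph.V} (p₁ q₁ : Quiver.Path x v) (p₂ q₂ : Quiver.Path v y)
    (F : P.graph.Face) :
    between (p₁.comp p₂) (q₁.comp q₂) F = between p₁ q₁ F + between p₂ q₂ F := by
  rw [between, between, between, ← pot_add (isCirculation_chain_sub _ _)
    (isCirculation_chain_sub _ _), chain_comp, chain_comp, add_sub_add_comm]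

theorem between_add {x y : P.graph.V} (p q r : Quiver.Path x y) (F : P.graph.Face) :
    between p r F = between p q F + between q r F := by
  rw [between, between, between, ← pot_add (isCirculation_chain_sub _ _)
    (isCirculation_chain_sub _ _), sub_add_sub_cancel]

theorem between_right_sub_left {x y : P.graph.V} (p q : Quiver.Path x y) (e : P.graph.E) :
    between p q (right e) - between p q (left e) = chain p e - chain q e :=
  (eq_pot_sub_pot (isCirculation_chain_sub p q) e).symm

theorem between_eq_zero {x y : P.graph.V} (p q : Quiver.Path x y) {F : P.graph.Face}
    (hF : ¬ Bornology.IsBounded F.1) : between p q F = 0 :=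
  pot_eq_zero (isCirculation_chain_sub p q) hF

theorem between_unique {x y : P.graph.V} (p q : Quiver.Path x y) {D : P.graph.Face → ℤ}
    (h0 : ∀ F : P.graph.Face, ¬ Bornology.IsBounded F.1 → D F = 0)
    (hD : ∀ e, chain p e - chain q e = D (right e) - D (left e)) : between p q = D := by
  obtain ⟨F, hF⟩ := exists_not_isBounded (P := P)
  exact (pot_unique (isCirculation_chain_sub p q) hF (h0 F hF) hD).symm

/-- At a vertex common to two parallel paths, no face adjacent to both an incoming and an outgoing
edge lies between the paths. -/
theorem between_eq_zero_of_mem {x y v : P.graph.V} {p q : Quiver.Path x y} (hp : v ∈ p.vertices)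
    (hq : v ∈ q.vertices) {a b : P.graph.E} (ha : P.graph.tgt a = v) (hb : P.graph.src b = v)
    {F : P.graph.Face} (haF : left a = F ∨ right a = F) (hbF : left b = F ∨ right b = F) :
    between p q F = 0 := by
  obtain ⟨p₁, p₂, rfl⟩ := Quiver.Path.exists_eq_comp_of_mem_vertices p hp
  obtain ⟨q₁, q₂, rfl⟩ := Quiver.Path.exists_eq_comp_of_mem_vertices q hq
  have h1 := pot_eq_zero_of_src p₁ q₁ hb
  have h2 := pot_eq_zero_of_tgt p₂ q₂ ha
  rw [between_comp]
  have e1 : between p₁ q₁ F = 0 := by rcases hbF with rfl | rfl <;> [exact h1.1; exact h1.2]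
  have e2 : between p₂ q₂ F = 0 := by rcases haF with rfl | rfl <;> [exact h2.1; exact h2.2]
  omega

end PastingScheme

/-! ### Comparing the cyclic order of edges at a vertex with the faces between paths -/

theorem ccwAngle_spec {a b : ℂ} (h : -b / a ∈ Complex.slitPlane) :
    Complex.arg (-b / a) = ccwAngle a b - Real.pi ∧ 0 < ccwAngle a b ∧
      ccwAngle a b < 2 * Real.pi := by
  have hpi := Real.pi_pos
  have hba : b / a ≠ 0 := by
    have := Complex.slitPlane_ne_zero h
    rwa [neg_div, neg_ne_zero] at this
  have hm := toIcoMod_mem_Ico Real.two_pi_pos 0 (Complex.arg (b / a))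
  rw [zero_add] at hm
  have h1 : Complex.arg (-b / a) < Real.pi :=
    lt_of_le_of_ne (Complex.arg_le_pi _) (Complex.mem_slitPlane_iff_arg.1 h).1
  have h2 := Complex.neg_pi_lt_arg (-b / a)
  have h3 := Complex.arg_neg_coe_angle hba
  rw [← neg_div, ← Real.Angle.coe_add, Real.Angle.angle_eq_iff_two_pi_dvd_sub] at h3
  obtain ⟨k, hk⟩ := h3
  have h4 := toIcoMod_add_toIcoDiv_zsmul Real.two_pi_pos 0 (Complex.arg (b / a))
  rw [zsmul_eq_mul] at h4
  set m := toIcoDiv Real.two_pi_pos 0 (Complex.arg (b / a))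
  change ccwAngle a b + m * (2 * Real.pi) = _ at h4
  change ccwAngle a b ∈ _ at hm
  have h5 : Complex.arg (-b / a) - (ccwAngle a b - Real.pi) = 2 * Real.pi * (k + m + 1 : ℤ) := by
    push_cast; linarith
  have h6 : ((k + m + 1 : ℤ) : ℝ) < 1 := by
    by_contra hc; push Not at hc; nlinarith [hm.1]
  have h7 : (-1 : ℝ) < ((k + m + 1 : ℤ) : ℝ) := by
    by_contra hc; push Not at hc; nlinarith [hm.2]
  have h8 : k + m + 1 = 0 := by
    have : k + m + 1 < 1 := by exact_mod_cast h6
    have : -1 < k + m + 1 := by exact_mod_cast h7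
    omega
  rw [h8] at h5
  push_cast at h5
  refine ⟨by linarith, ?_, hm.2⟩
  rcases hm.1.lt_or_eq with h9 | h9
  · exact h9
  · linarith

theorem ccwAngle_self (a : ℂ) : ccwAngle a a = 0 := by
  rcases eq_or_ne a 0 with rfl | h
  · simp [ccwAngle, toIcoMod_apply_left]
  · rw [ccwAngle, div_self h, Complex.arg_one]; exact toIcoMod_apply_left _ _

theorem exists_ccwAngle_eq (a b : ℂ) :
    ∃ k : ℤ, ccwAngle a b = Complex.arg (b / a) + k * (2 * Real.pi) := by
  have h4 := toIcoMod_add_toIcoDiv_zsmul Real.two_pi_pos 0 (Complex.arg (b / a))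
  rw [zsmul_eq_mul] at h4
  exact ⟨-toIcoDiv Real.two_pi_pos 0 (Complex.arg (b / a)), by rw [ccwAngle]; push_cast; linarith⟩

theorem exists_ccwAngle_add {a b c : ℂ} (ha : a ≠ 0) (hb : b ≠ 0) (hc : c ≠ 0) :
    ∃ k : ℤ, ccwAngle a c = ccwAngle a b + ccwAngle b c + k * (2 * Real.pi) := by
  obtain ⟨k1, h1⟩ := exists_ccwAngle_eq a c
  obtain ⟨k2, h2⟩ := exists_ccwAngle_eq a b
  obtain ⟨k3, h3⟩ := exists_ccwAngle_eq b c
  obtain ⟨k4, h4⟩ := PlaneGraph.exists_arg_div (div_ne_zero hb ha) (div_ne_zero hc ha)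
  rw [div_div_div_cancel_right₀ ha] at h4
  exact ⟨k1 - k2 - k3 - k4, by rw [h1, h2, h3, h4]; push_cast; ring⟩

/-- The bounds leave only `k = 0` and `k = -1`, that is, whether turning by `B` after `A` stays
below a full turn or passes it. The comparison of `A'` with `A` distinguishes the two cases. -/
theorem angle_jump {A A' B : ℝ} (hA : 0 < A) (hA2 : A < 2 * Real.pi) (hA' : 0 < A')
    (hA2' : A' < 2 * Real.pi) (hB : 0 < B) (hB2 : B < 2 * Real.pi)
    (h : ∃ k : ℤ, A' = A + B + k * (2 * Real.pi)) :
    (A' ≤ A → A' - A - B + 2 * Real.pi = 0) ∧ (¬ A' ≤ A → A' - A - B + 2 * Real.pi = 2 * Real.pi) := by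
  have hpi := Real.pi_pos
  obtain ⟨k, hk⟩ := h
  have h1 : (k : ℝ) < 1 := by by_contra hc; push Not at hc; nlinarith
  have h2 : (-2 : ℝ) < k := by by_contra hc; push Not at hc; nlinarith
  have h3 : k = 0 ∨ k = -1 := by
    have : k < 1 := by exact_mod_cast h1
    have : -2 < k := by exact_mod_cast h2
    omega
  rcases h3 with rfl | rfl <;> push_cast at hk <;> constructor <;> intro h <;> linarith

/-- Three directions `φ, β, β'`: the change of the angle subtended by `β, β'` from `φ` to `β`. -/
theorem arg_jump {φ β β' : ℂ} (h1 : -β / φ ∈ Complex.slitPlane) (h2 : -β' / φ ∈ Complex.slitPlane)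
    (h3 : -β' / β ∈ Complex.slitPlane) :
    (ccwAngle φ β' ≤ ccwAngle φ β →
      (Real.pi - Complex.arg (-β' / β)) - (Complex.arg (-β / φ) - Complex.arg (-β' / φ)) = 0) ∧
    (¬ ccwAngle φ β' ≤ ccwAngle φ β →
      (Real.pi - Complex.arg (-β' / β)) - (Complex.arg (-β / φ) - Complex.arg (-β' / φ))
        = 2 * Real.pi) := by
  have hne : ∀ {a b : ℂ}, -b / a ∈ Complex.slitPlane → a ≠ 0 ∧ b ≠ 0 := fun h => by
    have := Complex.slitPlane_ne_zero h
    simpa [not_or, and_comm] using this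
  obtain ⟨e1, a1, b1⟩ := ccwAngle_spec h1
  obtain ⟨e2, a2, b2⟩ := ccwAngle_spec h2
  obtain ⟨e3, a3, b3⟩ := ccwAngle_spec h3
  have := angle_jump a1 b1 a2 b2 a3 b3 (exists_ccwAngle_add (hne h1).1 (hne h1).2 (hne h2).2)
  refine ⟨fun h => ?_, fun h => ?_⟩
  · have := this.1 h; linarith
  · have := this.2 h; linarith

/-- The same for directions towards a point. -/
theorem arg_jump' {φ α α' : ℂ} (h1 : -φ / α ∈ Complex.slitPlane) (h2 : -φ / α' ∈ Complex.slitPlane)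
    (h3 : -α / α' ∈ Complex.slitPlane) :
    (ccwAngle α' φ ≤ ccwAngle α φ →
      (Real.pi - Complex.arg (-α / α')) - (Complex.arg (-φ / α) - Complex.arg (-φ / α')) = 0) ∧
    (¬ ccwAngle α' φ ≤ ccwAngle α φ →
      (Real.pi - Complex.arg (-α / α')) - (Complex.arg (-φ / α) - Complex.arg (-φ / α'))
        = 2 * Real.pi) := by
  have hne : ∀ {a b : ℂ}, -b / a ∈ Complex.slitPlane → a ≠ 0 ∧ b ≠ 0 := fun h => by
    have := Complex.slitPlane_ne_zero h
    simpa [not_or, and_comm] using this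
  obtain ⟨e1, a1, b1⟩ := ccwAngle_spec h1
  obtain ⟨e2, a2, b2⟩ := ccwAngle_spec h2
  obtain ⟨e3, a3, b3⟩ := ccwAngle_spec h3
  obtain ⟨k, hk⟩ := exists_ccwAngle_add (hne h2).1 (hne h1).1 (hne h1).2
  have := angle_jump a1 b1 a2 b2 a3 b3 ⟨k, by linarith⟩
  refine ⟨fun h => ?_, fun h => ?_⟩
  · have := this.1 h; linarith
  · have := this.2 h; linarith

theorem arg_add_arg {β β' : ℂ} (h : -β' / β ∈ Complex.slitPlane) :
    Complex.arg (-β' / β) + Complex.arg (-β / β') = 0 := by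
  have h' := PlaneGraph.slitPlane_inv h
  have e : -β / β' = (-β' / β)⁻¹ := by rw [inv_div, div_neg, ← neg_div]
  rw [e, Complex.arg_inv, if_neg (Complex.mem_slitPlane_iff_arg.1 h).1]
  ring

namespace PastingScheme
open PlaneGraph

variable {P : PastingScheme}

theorem isEnd_outDir (b : P.graph.E) : IsEnd (P.graph.src b) b (P.outDir b) := Or.inl ⟨rfl, rfl⟩

theorem isEnd_inDir (a : P.graph.E) : IsEnd (P.graph.tgt a) a (P.inDir a) := Or.inr ⟨rfl, rfl⟩

section out

variable {v y : P.graph.V} {p q : Quiver.Path v y} {b b' : P.graph.E}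

/-- A path starting at `v` uses exactly one edge out of `v` and, by acyclicity, none into `v`. So
only `b` and `b'` can contribute. -/
theorem sum_endAng_out (hb : b ∈ edges p) (hb' : b' ∈ edges q) (hv : P.graph.src b = v)
    (hv' : P.graph.src b' = v) (γ : ℂ) :
    ∑ e, ((chain p - chain q) e : ℝ) * endAng v γ e =
      Complex.arg (-P.outDir b / γ) - Complex.arg (-P.outDir b' / γ) := by
  classical
  have key : ∀ {r : Quiver.Path v y} {c : P.graph.E}, c ∈ edges r → P.graph.src c = v →
      ∑ e, (chain r e : ℝ) * endAng v γ e = Complex.arg (-P.outDir c / γ) := by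
    intro r c hc hcv
    rw [Finset.sum_eq_single c]
    · rw [chain_eq_one hc, endAng, if_pos hcv, Int.cast_one, one_mul]; rfl
    · intro e _ hec
      by_cases he : e ∈ edges r
      · rw [endAng, if_neg fun h => hec (eq_of_src_eq he hc (h.trans hcv.symm)),
          if_neg (tgt_ne_start he), mul_zero]
      · rw [chain_eq_zero_iff.2 he, Int.cast_zero, zero_mul]
    · simp
  simp only [Pi.sub_apply, Int.cast_sub, sub_mul, Finset.sum_sub_distrib, key hb hv, key hb' hv']

/-- Subtracting the local formulas along `g` and along `b` cancels the unknown constant. The edge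
`b` sees itself under the angle `π`. -/
theorem between_left_sub (hb : b ∈ edges p) (hb' : b' ∈ edges q) (hv : P.graph.src b = v)
    (hv' : P.graph.src b' = v) {g : P.graph.E} {γ : ℂ} (hg : IsEnd v g γ) :
    2 * Real.pi * (between p q (left g) - between p q (left b)) =
      (Real.pi - Complex.arg (-P.outDir b' / P.outDir b)) -
        (Complex.arg (-P.outDir b / γ) - Complex.arg (-P.outDir b' / γ)) := by
  obtain ⟨K, hK⟩ := exists_pot_left_formula (isCirculation_chain_sub p q) tgt_ne_src v
  have hbe : IsEnd v b (P.outDir b) := hv ▸ isEnd_outDir b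
  have h1 := hK g γ hg
  have h2 := hK b _ hbe
  rw [sum_endAng_out hb hb' hv hv'] at h1 h2
  rw [neg_div_self hbe.ne_zero, Complex.arg_neg_one] at h2
  simp only [between]
  linarith

/-- The edge `f` serves as the origin of the angular order: with value zero known on its right, the
angle jump gives the value beside `b`. When `f` is `b` or `b'`, the value to its left is shifted by
-1 or 1 and is treated separately. -/
theorem between_left_eq (hb : b ∈ edges p) (hb' : b' ∈ edges q) (hv : P.graph.src b = v)
    (hv' : P.graph.src b' = v) (hne : b ≠ b') {f : P.graph.E} {φ : ℂ} (hf : IsEnd v f φ)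
    (h0 : between p q (right f) = 0) (hfs : P.graph.tgt f = v ∨ P.graph.src f = v ∧ φ = P.outDir f) :
    (ccwAngle φ (P.outDir b') ≤ ccwAngle φ (P.outDir b) → between p q (left b) = 0) ∧
    (¬ ccwAngle φ (P.outDir b') ≤ ccwAngle φ (P.outDir b) → between p q (left b) = -1) := by
  have hbe : IsEnd v b (P.outDir b) := hv ▸ isEnd_outDir b
  have hbe' : IsEnd v b' (P.outDir b') := hv' ▸ isEnd_outDir b'
  have hpi := Real.pi_pos
  have hform := between_left_sub hb hb' hv hv' hf
  have hrl := between_right_sub_left p q f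
  have hbb := hbe.neg_div_mem_slitPlane hbe' hne
  by_cases hfb : f = b
  · obtain ⟨-, rfl⟩ : P.graph.src f = v ∧ φ = P.outDir f := hfs.resolve_left fun h => by
      subst hfb
      exact tgt_ne_src f (h.trans hv.symm)
    subst hfb
    have hq : f ∉ edges q := fun h => hne (eq_of_src_eq h hb' (hv.trans hv'.symm))
    rw [chain_eq_one hb, chain_eq_zero_iff.2 hq] at hrl
    refine ⟨fun h => ?_, fun _ => by omega⟩
    rw [ccwAngle_self] at h
    have := (ccwAngle_spec hbb).2.1
    linarith
  by_cases hfb' : f = b'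
  · obtain ⟨-, rfl⟩ : P.graph.src f = v ∧ φ = P.outDir f := hfs.resolve_left fun h => by
      subst hfb'
      exact tgt_ne_src f (h.trans hv'.symm)
    subst hfb'
    have hp : f ∉ edges p := fun h => hfb (eq_of_src_eq h hb (hv'.trans hv.symm))
    rw [chain_eq_one hb', chain_eq_zero_iff.2 hp] at hrl
    rw [neg_div_self hbe'.ne_zero, Complex.arg_neg_one] at hform
    have h2 := arg_add_arg hbb
    have h1 : between p q (left f) = 1 := by omega
    rw [h1] at hform
    have h3 : (between p q (left b) : ℝ) = 0 := by
      have : 2 * Real.pi * (between p q (left b) : ℝ) = 0 := by push_cast at hform; linarith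
      rcases mul_eq_zero.1 this with h | h
      · linarith
      · exact h
    refine ⟨fun _ => by exact_mod_cast h3, fun h => ?_⟩
    rw [ccwAngle_self] at h
    have := (ccwAngle_spec (hbe'.neg_div_mem_slitPlane hbe (Ne.symm hne))).2.1
    exact absurd this.le h
  · have hp : f ∉ edges p := fun h => hfs.elim (fun h' => tgt_ne_start h h')
      fun h' => hfb (eq_of_src_eq h hb (h'.1.trans hv.symm))
    have hq : f ∉ edges q := fun h => hfs.elim (fun h' => tgt_ne_start h h')
      fun h' => hfb' (eq_of_src_eq h hb' (h'.1.trans hv'.symm))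
    rw [chain_eq_zero_iff.2 hp, chain_eq_zero_iff.2 hq] at hrl
    have h1 : between p q (left f) = 0 := by omega
    rw [h1] at hform
    have hj := arg_jump (hf.neg_div_mem_slitPlane hbe hfb) (hf.neg_div_mem_slitPlane hbe' hfb') hbb
    refine ⟨fun h => ?_, fun h => ?_⟩
    · rw [hj.1 h] at hform
      rcases mul_eq_zero.1 hform with h | h
      · linarith
      · have : (between p q (left b) : ℝ) = 0 := by push_cast at h; linarith
        exact_mod_cast this
    · rw [hj.2 h] at hform
      have : (between p q (left b) : ℝ) = -1 := by
        have : (2 * Real.pi) * (between p q (left b) + 1 : ℝ) = 0 := by push_cast at hform; linarith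
        rcases mul_eq_zero.1 this with h | h
        · linarith
        · linarith
      exact_mod_cast this

/-- Edges into `v` border no face between the paths, and at `s` the first edge of `cod` has the
exterior on its right. So every reference edge in the definition of `OutLE` is admissible, and at
least one exists. -/
theorem between_left_out (hb : b ∈ edges p) (hb' : b' ∈ edges q) (hv : P.graph.src b = v)
    (hv' : P.graph.src b' = v) (hne : b ≠ b') :
    (P.OutLE v b' b → between p q (left b) = 0) ∧ (¬ P.OutLE v b' b → between p q (left b) = -1) := by
  have hin : ∀ f, P.graph.tgt f = v → between p q (right f) = 0 := fun f hf =>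
    (pot_eq_zero_of_tgt p q hf).2
  have hcod : ∀ f ∈ edges P.cod, between p q (right f) = 0 := fun f hf =>
    between_eq_zero p q ((P.mem_cod_iff f).1 hf)
  have H1 : ∀ f (hf : P.graph.tgt f = v), _ := fun f hf => between_left_eq hb hb' hv hv' hne
    (hf ▸ isEnd_inDir f : IsEnd v f (P.inDir f)) (hin f hf) (Or.inl hf)
  have H2 : ∀ f (hf : P.graph.src f = v) (hc : f ∈ edges P.cod), _ := fun f hf hc =>
    between_left_eq hb hb' hv hv' hne
    (hf ▸ isEnd_outDir f : IsEnd v f (P.outDir f)) (hcod f hc) (Or.inr ⟨hf, rfl⟩)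
  constructor
  · rintro ⟨h1, h2⟩
    by_cases hvs : v = P.s
    · obtain ⟨f, hf, hfs⟩ := exists_src_eq P.cod.start_mem_vertices P.s_ne_t
      exact (H2 f (hfs.trans hvs.symm) hf).1 (h2 hvs f hf (hfs.trans hvs.symm))
    · obtain ⟨f, hf⟩ := exists_tgt_of_ne hvs
      exact (H1 f hf).1 (h1 f hf)
  · intro h
    rw [OutLE, not_and_or] at h
    rcases h with h | h
    · push Not at h
      obtain ⟨f, hf, h⟩ := h
      exact (H1 f hf).2 (not_le.2 h)
    · push Not at h
      obtain ⟨-, f, hf, hfs, h⟩ := h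
      exact (H2 f hfs hf).2 (not_le.2 h)

end out

section inc

variable {x v : P.graph.V} {p q : Quiver.Path x v} {a a' : P.graph.E}

/-- Paths ending at `v` mirror the previous case: each contributes only its last edge, and the
reference edges go out of `v`, or are the last edge of `cod` when `v` is `t`. -/
theorem sum_endAng_in (ha : a ∈ edges p) (ha' : a' ∈ edges q) (hv : P.graph.tgt a = v)
    (hv' : P.graph.tgt a' = v) (γ : ℂ) :
    ∑ e, ((chain p - chain q) e : ℝ) * endAng v γ e =
      Complex.arg (-γ / P.inDir a) - Complex.arg (-γ / P.inDir a') := by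
  classical
  have key : ∀ {r : Quiver.Path x v} {c : P.graph.E}, c ∈ edges r → P.graph.tgt c = v →
      ∑ e, (chain r e : ℝ) * endAng v γ e = Complex.arg (-γ / P.inDir c) := by
    intro r c hc hcv
    rw [Finset.sum_eq_single c]
    · rw [chain_eq_one hc, endAng, if_neg (src_ne_end hc), if_pos hcv, Int.cast_one, one_mul]; rfl
    · intro e _ hec
      by_cases he : e ∈ edges r
      · rw [endAng, if_neg (src_ne_end he),
          if_neg fun h => hec (eq_of_tgt_eq he hc (h.trans hcv.symm)), mul_zero]
      · rw [chain_eq_zero_iff.2 he, Int.cast_zero, zero_mul]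
    · simp
  simp only [Pi.sub_apply, Int.cast_sub, sub_mul, Finset.sum_sub_distrib, key ha hv, key ha' hv']

theorem between_left_sub' (ha : a ∈ edges p) (ha' : a' ∈ edges q) (hv : P.graph.tgt a = v)
    (hv' : P.graph.tgt a' = v) {g : P.graph.E} {γ : ℂ} (hg : IsEnd v g γ) :
    2 * Real.pi * (between p q (left g) - between p q (left a)) =
      (Real.pi - Complex.arg (-P.inDir a / P.inDir a')) -
        (Complex.arg (-γ / P.inDir a) - Complex.arg (-γ / P.inDir a')) := by
  obtain ⟨K, hK⟩ := exists_pot_left_formula (isCirculation_chain_sub p q) tgt_ne_src v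
  have hae : IsEnd v a (P.inDir a) := hv ▸ isEnd_inDir a
  have h1 := hK g γ hg
  have h2 := hK a _ hae
  rw [sum_endAng_in ha ha' hv hv'] at h1 h2
  rw [neg_div_self hae.ne_zero, Complex.arg_neg_one] at h2
  simp only [between]
  linarith

theorem between_left_eq' (ha : a ∈ edges p) (ha' : a' ∈ edges q) (hv : P.graph.tgt a = v)
    (hv' : P.graph.tgt a' = v) (hne : a ≠ a') {f : P.graph.E} {φ : ℂ} (hf : IsEnd v f φ)
    (h0 : between p q (right f) = 0) (hfs : P.graph.src f = v ∨ P.graph.tgt f = v ∧ φ = P.inDir f) :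
    (ccwAngle (P.inDir a') φ ≤ ccwAngle (P.inDir a) φ → between p q (left a) = 0) ∧
    (¬ ccwAngle (P.inDir a') φ ≤ ccwAngle (P.inDir a) φ → between p q (left a) = -1) := by
  have hae : IsEnd v a (P.inDir a) := hv ▸ isEnd_inDir a
  have hae' : IsEnd v a' (P.inDir a') := hv' ▸ isEnd_inDir a'
  have hpi := Real.pi_pos
  have hform := between_left_sub' ha ha' hv hv' hf
  have hrl := between_right_sub_left p q f
  have haa := hae'.neg_div_mem_slitPlane hae (Ne.symm hne)
  by_cases hfa : f = a
  · obtain ⟨-, rfl⟩ : P.graph.tgt f = v ∧ φ = P.inDir f := hfs.resolve_left fun h => by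
      subst hfa
      exact tgt_ne_src f (hv.trans h.symm)
    subst hfa
    have hq : f ∉ edges q := fun h => hne (eq_of_tgt_eq h ha' (hv.trans hv'.symm))
    rw [chain_eq_one ha, chain_eq_zero_iff.2 hq] at hrl
    refine ⟨fun h => ?_, fun _ => by omega⟩
    rw [ccwAngle_self] at h
    have := (ccwAngle_spec haa).2.1
    linarith
  by_cases hfa' : f = a'
  · obtain ⟨-, rfl⟩ : P.graph.tgt f = v ∧ φ = P.inDir f := hfs.resolve_left fun h => by
      subst hfa'
      exact tgt_ne_src f (hv'.trans h.symm)
    subst hfa'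
    have hp : f ∉ edges p := fun h => hfa (eq_of_tgt_eq h ha (hv'.trans hv.symm))
    rw [chain_eq_one ha', chain_eq_zero_iff.2 hp] at hrl
    rw [neg_div_self hae'.ne_zero, Complex.arg_neg_one] at hform
    have h2 := arg_add_arg haa
    have h1 : between p q (left f) = 1 := by omega
    rw [h1] at hform
    have h3 : (between p q (left a) : ℝ) = 0 := by
      have : 2 * Real.pi * (between p q (left a) : ℝ) = 0 := by push_cast at hform; linarith
      rcases mul_eq_zero.1 this with h | h
      · linarith
      · exact h
    refine ⟨fun _ => by exact_mod_cast h3, fun h => ?_⟩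
    rw [ccwAngle_self] at h
    have := (ccwAngle_spec (hae.neg_div_mem_slitPlane hae' hne)).2.1
    exact absurd this.le h
  · have hp : f ∉ edges p := fun h => hfs.elim (fun h' => src_ne_end h h')
      fun h' => hfa (eq_of_tgt_eq h ha (h'.1.trans hv.symm))
    have hq : f ∉ edges q := fun h => hfs.elim (fun h' => src_ne_end h h')
      fun h' => hfa' (eq_of_tgt_eq h ha' (h'.1.trans hv'.symm))
    rw [chain_eq_zero_iff.2 hp, chain_eq_zero_iff.2 hq] at hrl
    have h1 : between p q (left f) = 0 := by omega
    rw [h1] at hform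
    have hj := arg_jump' (hae.neg_div_mem_slitPlane hf (Ne.symm hfa))
      (hae'.neg_div_mem_slitPlane hf (Ne.symm hfa')) haa
    refine ⟨fun h => ?_, fun h => ?_⟩
    · rw [hj.1 h] at hform
      rcases mul_eq_zero.1 hform with h | h
      · linarith
      · have : (between p q (left a) : ℝ) = 0 := by push_cast at h; linarith
        exact_mod_cast this
    · rw [hj.2 h] at hform
      have : (between p q (left a) : ℝ) = -1 := by
        have : (2 * Real.pi) * (between p q (left a) + 1 : ℝ) = 0 := by push_cast at hform; linarith
        rcases mul_eq_zero.1 this with h | h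
        · linarith
        · linarith
      exact_mod_cast this

theorem between_left_in (ha : a ∈ edges p) (ha' : a' ∈ edges q) (hv : P.graph.tgt a = v)
    (hv' : P.graph.tgt a' = v) (hne : a ≠ a') :
    (P.InLE v a' a → between p q (left a) = 0) ∧ (¬ P.InLE v a' a → between p q (left a) = -1) := by
  have hout : ∀ f, P.graph.src f = v → between p q (right f) = 0 := fun f hf =>
    (pot_eq_zero_of_src p q hf).2
  have hcod : ∀ f ∈ edges P.cod, between p q (right f) = 0 := fun f hf =>
    between_eq_zero p q ((P.mem_cod_iff f).1 hf)
  have H1 : ∀ f (hf : P.graph.src f = v), _ := fun f hf => between_left_eq' ha ha' hv hv' hne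
    (hf ▸ isEnd_outDir f : IsEnd v f (P.outDir f)) (hout f hf) (Or.inl hf)
  have H2 : ∀ f (hf : P.graph.tgt f = v) (hc : f ∈ edges P.cod), _ := fun f hf hc =>
    between_left_eq' ha ha' hv hv' hne
    (hf ▸ isEnd_inDir f : IsEnd v f (P.inDir f)) (hcod f hc) (Or.inr ⟨hf, rfl⟩)
  constructor
  · rintro ⟨h1, h2⟩
    by_cases hvt : v = P.t
    · obtain ⟨f, hf, hft⟩ := exists_tgt_eq P.cod.end_mem_vertices P.s_ne_t.symm
      exact (H2 f (hft.trans hvt.symm) hf).1 (h2 hvt f hf (hft.trans hvt.symm))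
    · obtain ⟨f, hf⟩ := exists_src_of_ne hvt
      exact (H1 f hf).1 (h1 f hf)
  · intro h
    rw [InLE, not_and_or] at h
    rcases h with h | h
    · push Not at h
      obtain ⟨f, hf, h⟩ := h
      exact (H1 f hf).2 (not_le.2 h)
    · push Not at h
      obtain ⟨-, f, hf, hft, h⟩ := h
      exact (H2 f hft hf).2 (not_le.2 h)

end inc

end PastingScheme

/-! ### Lying above as non-negativity of the 2-chain between two paths -/

namespace PastingScheme
open PlaneGraph

variable {P : PastingScheme}

theorem pred_eq_some {x y v : P.graph.V} {p : Quiver.Path x y} {a : P.graph.E} (h : a ∈ edges p)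
    (hv : P.graph.tgt a = v) : pred p v = some a := by
  classical
  obtain ⟨e, he⟩ : ∃ e, pred p v = some e := by
    rw [← Option.isSome_iff_exists, pred, List.find?_isSome]
    exact ⟨a, h, by simpa using hv⟩
  rw [he]
  rw [pred] at he
  rw [eq_of_tgt_eq (List.mem_of_find?_eq_some he) h
    ((by simpa using List.find?_some he : P.graph.tgt e = v).trans hv.symm)]

theorem succ_eq_some {x y v : P.graph.V} {p : Quiver.Path x y} {b : P.graph.E} (h : b ∈ edges p)
    (hv : P.graph.src b = v) : succ p v = some b := by
  classical
  obtain ⟨e, he⟩ : ∃ e, succ p v = some e := by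
    rw [← Option.isSome_iff_exists, succ, List.find?_isSome]
    exact ⟨b, h, by simpa using hv⟩
  rw [he]
  rw [succ] at he
  rw [eq_of_src_eq (List.mem_of_find?_eq_some he) h
    ((by simpa using List.find?_some he : P.graph.src e = v).trans hv.symm)]

theorem pred_start {x y : P.graph.V} (p : Quiver.Path x y) : pred p x = none := by
  rw [pred, List.find?_eq_none]
  intro e he
  simpa using tgt_ne_start he

theorem succ_end {x y : P.graph.V} (p : Quiver.Path x y) : succ p y = none := by
  rw [succ, List.find?_eq_none]
  intro e he
  simpa using src_ne_end he

/-- Acyclicity makes the edges into and out of a vertex of a path unique, and parallel paths lack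
them only at the same ends. The `none` cases therefore always match. -/
theorem liesAbove_iff_edges {x y : P.graph.V} {p q : Quiver.Path x y} :
    LiesAbove p q ↔
      (∀ a ∈ edges p, ∀ a' ∈ edges q, P.graph.tgt a' = P.graph.tgt a → P.InLE (P.graph.tgt a) a' a) ∧
      (∀ b ∈ edges p, ∀ b' ∈ edges q, P.graph.src b' = P.graph.src b → P.OutLE (P.graph.src b) b' b) := by
  constructor
  · intro h
    refine ⟨fun a ha a' ha' e => ?_, fun b hb b' hb' e => ?_⟩
    · have := (h _ (tgt_mem_vertices ha) (e ▸ tgt_mem_vertices ha')).1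
      rw [pred_eq_some ha rfl, pred_eq_some ha' e] at this
      cases this
      assumption
    · have := (h _ (src_mem_vertices hb) (e ▸ src_mem_vertices hb')).2
      rw [succ_eq_some hb rfl, succ_eq_some hb' e] at this
      cases this
      assumption
  · rintro ⟨h1, h2⟩ v hp hq
    constructor
    · by_cases hvx : v = x
      · subst hvx
        rw [pred_start, pred_start]
        exact .none
      · obtain ⟨a, ha, rfl⟩ := exists_tgt_eq hp hvx
        obtain ⟨a', ha', e⟩ := exists_tgt_eq hq hvx
        rw [pred_eq_some ha rfl, pred_eq_some ha' e]
        exact .some (h1 a ha a' ha' e)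
    · by_cases hvy : v = y
      · subst hvy
        rw [succ_end, succ_end]
        exact .none
      · obtain ⟨b, hb, rfl⟩ := exists_src_eq hp hvy
        obtain ⟨b', hb', e⟩ := exists_src_eq hq hvy
        rw [succ_eq_some hb rfl, succ_eq_some hb' e]
        exact .some (h2 b hb b' hb' e)

theorem LiesAbove.of_comp {x v y : P.graph.V} {p₁ q₁ : Quiver.Path x v} {p₂ q₂ : Quiver.Path v y}
    (h : LiesAbove (p₁.comp p₂) (q₁.comp q₂)) : LiesAbove p₁ q₁ ∧ LiesAbove p₂ q₂ := by
  simp only [liesAbove_iff_edges, edges_comp, List.mem_append] at h ⊢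
  exact ⟨⟨fun a ha a' ha' => h.1 a (Or.inl ha) a' (Or.inl ha'),
    fun a ha a' ha' => h.2 a (Or.inl ha) a' (Or.inl ha')⟩,
    ⟨fun a ha a' ha' => h.1 a (Or.inr ha) a' (Or.inr ha'),
    fun a ha a' ha' => h.2 a (Or.inr ha) a' (Or.inr ha')⟩⟩

/-- Cutting both paths at the common vertex, the parts after it contribute nothing beside the
incoming edge `a`, so the case of paths ending there applies. -/
theorem between_left_of_tgt_eq {x y : P.graph.V} {p q : Quiver.Path x y} {a a' : P.graph.E}
    (ha : a ∈ edges p) (ha' : a' ∈ edges q) (h : P.graph.tgt a' = P.graph.tgt a) (hne : a ≠ a') :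
    (P.InLE (P.graph.tgt a) a' a → between p q (left a) = 0) ∧
      (¬ P.InLE (P.graph.tgt a) a' a → between p q (left a) = -1) := by
  obtain ⟨p₁, p₂, rfl⟩ := Quiver.Path.exists_eq_comp_of_mem_vertices p (tgt_mem_vertices ha)
  obtain ⟨q₁, q₂, rfl⟩ := Quiver.Path.exists_eq_comp_of_mem_vertices q (h ▸ tgt_mem_vertices ha')
  have h2 : between p₂ q₂ (left a) = 0 := (pot_eq_zero_of_tgt p₂ q₂ rfl).1
  rw [between_comp, h2, add_zero]
  exact between_left_in (mem_edges_of_comp_left ha rfl) (mem_edges_of_comp_left ha' h) rfl h hne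

theorem between_left_of_src_eq {x y : P.graph.V} {p q : Quiver.Path x y} {b b' : P.graph.E}
    (hb : b ∈ edges p) (hb' : b' ∈ edges q) (h : P.graph.src b' = P.graph.src b) (hne : b ≠ b') :
    (P.OutLE (P.graph.src b) b' b → between p q (left b) = 0) ∧
      (¬ P.OutLE (P.graph.src b) b' b → between p q (left b) = -1) := by
  obtain ⟨p₁, p₂, rfl⟩ := Quiver.Path.exists_eq_comp_of_mem_vertices p (src_mem_vertices hb)
  obtain ⟨q₁, q₂, rfl⟩ := Quiver.Path.exists_eq_comp_of_mem_vertices q (h ▸ src_mem_vertices hb')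
  have h2 : between p₁ q₁ (left b) = 0 := (pot_eq_zero_of_src p₁ q₁ rfl).1
  rw [between_comp, h2, zero_add]
  exact between_left_out (mem_edges_of_comp_right hb rfl) (mem_edges_of_comp_right hb' h) rfl h hne

open Classical in
theorem chain_dom_sub_chain_cod {x y : P.graph.V} (c : P.graph.AnchoredFace x y) (e : P.graph.E) :
    chain c.dom e - chain c.cod e =
      (if right e = c.toFace then 1 else 0) - (if left e = c.toFace then 1 else 0) := by
  have h1 : chain c.dom e = if right e = c.toFace then 1 else 0 := by
    by_cases h : e ∈ edges c.dom
    · rw [chain_eq_one h, if_pos ((mem_edges_dom c e).1 h)]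
    · rw [chain_eq_zero_iff.2 h, if_neg (mt (mem_edges_dom c e).2 h)]
  have h2 : chain c.cod e = if left e = c.toFace then 1 else 0 := by
    by_cases h : e ∈ edges c.cod
    · rw [chain_eq_one h, if_pos ((mem_edges_cod c e).1 h)]
    · rw [chain_eq_zero_iff.2 h, if_neg (mt (mem_edges_cod c e).2 h)]
  rw [h1, h2]

/-- Boundaries of 2-chains are 1-cycles. -/
theorem isCirculation_boundary {D : P.graph.Face → ℤ}
    (hD : ∀ F : P.graph.Face, ¬ Bornology.IsBounded F.1 → D F = 0) :
    IsCirculation (G := P.graph) fun e => D (right e) - D (left e) := by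
  classical
  intro f
  -- The boundary is decomposed face by face; that of an interior face is the difference of its two
  -- parallel sides.
  have h1 : ∀ e : P.graph.E, ((D (right e) - D (left e) : ℤ) : ℝ) =
      ∑ F, (D F : ℝ) * ((if right e = F then 1 else 0) - (if left e = F then 1 else 0)) := by
    intro e
    simp [mul_sub, Finset.sum_sub_distrib]
  simp only [h1, Finset.sum_mul]
  rw [Finset.sum_comm]
  refine Finset.sum_eq_zero fun F _ => ?_
  by_cases hF : Bornology.IsBounded F.1
  · obtain ⟨x, y, c, rfl⟩ := exists_anchoredFace hF
    have h2 := isCirculation_chain_sub c.dom c.cod f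
    refine Eq.trans ?_ ((congrArg (fun t => (D c.toFace : ℝ) * t) h2).trans (mul_zero _))
    rw [Finset.mul_sum]
    refine Finset.sum_congr rfl fun e _ => ?_
    rw [Pi.sub_apply, chain_dom_sub_chain_cod]
    push_cast
    ring
  · simp [hD F hF]

/-- The boundary of the region of most negative value consists of pieces of `p` and `q`. At a vertex
where this boundary begins, an edge of `p` and an edge of `q` leave in the order forbidden by the
hypothesis. -/
theorem LiesAbove.between_nonneg {x y : P.graph.V} {p q : Quiver.Path x y} (h : LiesAbove p q)
    (F : P.graph.Face) : 0 ≤ between p q F := by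
  classical
  by_contra hneg
  have : Nonempty P.graph.Face := ⟨F⟩
  obtain ⟨F₀, hF₀⟩ := Finite.exists_min (between p q)
  have hm : between p q F₀ < 0 := by have := hF₀ F; omega
  -- The value -1 makes positive coefficients of the boundary belong to edges of `p`, and negative
  -- ones to edges of `q`.
  let D : P.graph.Face → ℤ := fun F => if between p q F = between p q F₀ then -1 else 0
  have hD0 : ∀ F : P.graph.Face, ¬ Bornology.IsBounded F.1 → D F = 0 := fun F hF => by
    simp only [D]
    rw [if_neg]
    rw [between_eq_zero p q hF]
    omega
  have hc := isCirculation_boundary hD0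
  set c : P.graph.E → ℤ := fun e => D (right e) - D (left e) with hcdef
  have hc_pos : ∀ e, 0 < c e → e ∈ edges p ∧ between p q (left e) < 0 := by
    intro e he
    simp only [hcdef, D] at he
    have h1 := hF₀ (right e)
    have h2 := between_right_sub_left p q e
    have h3 := chain_nonneg q e
    split_ifs at he <;> first | omega | (refine ⟨chain_pos_iff.1 ?_, ?_⟩ <;> omega)
  have hc_neg : ∀ e, c e < 0 → e ∈ edges q := by
    intro e he
    simp only [hcdef, D] at he
    have h1 := hF₀ (left e)
    have h2 := between_right_sub_left p q e
    have h3 := chain_nonneg p e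
    split_ifs at he <;> first | omega | (refine chain_pos_iff.1 ?_; omega)
  -- Without such an initial vertex, one could follow the support of `c` backwards forever and find
  -- a directed cycle.
  obtain ⟨v, ⟨e₀, he₀, he₀v⟩, hv⟩ : ∃ v, (∃ e, c e ≠ 0 ∧ P.graph.src e = v) ∧
      ∀ e, c e ≠ 0 → P.graph.tgt e ≠ v := by
    by_contra hcon
    push Not at hcon
    have hne : ∃ e, c e ≠ 0 := by
      by_contra hz
      push Not at hz
      obtain ⟨F', hF'⟩ := exists_not_isBounded (P := P)
      have := mem_of_forall_left_iff_right (S := {F | D F = -1}) (F := F₀) (F' := F')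
        (fun e => by
          have := hz e
          simp only [hcdef] at this
          simp only [Set.mem_ofPred_eq]
          omega) (by simp [D])
      rw [Set.mem_ofPred_eq, hD0 F' hF'] at this
      omega
    obtain ⟨e₁, he₁⟩ := hne
    obtain ⟨c', h0, ⟨e, he⟩, -, hc'⟩ := exists_nonneg_circulation P.graph.tgt P.graph.src
      (M := {v | ∃ e, c e ≠ 0 ∧ P.graph.src e = v}) ⟨_, e₁, he₁, rfl⟩ fun u hu => by
        obtain ⟨e, he, het⟩ := hcon u hu
        exact ⟨e, het, e, he, rfl⟩
    have hc'' : IsCirculation c' := fun f => by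
      rw [← neg_zero, ← hc' f, ← Finset.sum_neg_distrib]
      exact Finset.sum_congr rfl fun e _ => by ring
    rw [eq_zero_of_isCirculation hc'' h0] at he
    simp at he
  -- Testing the circulation on the indicator function of `v` balances the outgoing coefficients, so
  -- both signs occur among them.
  have hsum : ∑ e, (if P.graph.src e = v then c e else 0) = 0 := by
    have h1 := hc fun w => if w = v then 1 else 0
    have h2 : ∀ e, (c e : ℝ) * ((if P.graph.tgt e = v then 1 else 0) -
        (if P.graph.src e = v then 1 else 0)) = -((if P.graph.src e = v then c e else 0 : ℤ) : ℝ) := by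
      intro e
      by_cases h : c e = 0
      · simp [h]
      · rw [if_neg (hv e h)]
        split_ifs <;> simp
    simp only [h2, Finset.sum_neg_distrib, neg_eq_zero] at h1
    exact_mod_cast h1
  obtain ⟨b, -, hb⟩ := Finset.exists_pos_of_sum_zero_of_exists_nonzero _ hsum
    ⟨e₀, Finset.mem_univ _, by rwa [if_pos he₀v]⟩
  obtain ⟨b', -, hb'⟩ := Finset.exists_pos_of_sum_zero_of_exists_nonzero
    (fun e => -(if P.graph.src e = v then c e else 0)) (s := Finset.univ)
    (by rw [Finset.sum_neg_distrib, hsum, neg_zero])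
    ⟨e₀, Finset.mem_univ _, by rw [if_pos he₀v]; exact neg_ne_zero.2 he₀⟩
  have hbv : P.graph.src b = v := by by_contra h; simp [h] at hb
  have hbv' : P.graph.src b' = v := by by_contra h; simp [h] at hb'
  rw [if_pos hbv] at hb
  rw [if_pos hbv'] at hb'
  obtain ⟨hbp, hbneg⟩ := hc_pos b hb
  have hbq := hc_neg b' (by omega)
  have hne : b ≠ b' := by rintro rfl; omega
  have hOut := (liesAbove_iff_edges.1 h).2 b hbp b' hbq (hbv'.trans hbv.symm)
  have := (between_left_of_src_eq hbp hbq (hbv'.trans hbv.symm) hne).1 hOut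
  omega

/-- For the converse, a wrongly ordered pair of edges at a common vertex would have a face of value
-1 beside it. -/
theorem liesAbove_iff {x y : P.graph.V} {p q : Quiver.Path x y} :
    LiesAbove p q ↔ ∀ F, 0 ≤ between p q F := by
  refine ⟨LiesAbove.between_nonneg, fun h => liesAbove_iff_edges.2 ⟨?_, ?_⟩⟩
  · intro a ha a' ha' he
    by_cases hne : a = a'
    · subst hne; exact ⟨fun _ _ => le_rfl, fun _ _ _ _ => le_rfl⟩
    · by_contra hcon
      have := (between_left_of_tgt_eq ha ha' he hne).2 hcon
      have := h (left a)
      omega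
  · intro b hb b' hb' he
    by_cases hne : b = b'
    · subst hne; exact ⟨fun _ _ => le_rfl, fun _ _ _ _ => le_rfl⟩
    · by_contra hcon
      have := (between_left_of_src_eq hb hb' he hne).2 hcon
      have := h (left b)
      omega

theorem LiesAbove.trans {x y : P.graph.V} {p q r : Quiver.Path x y} (h : LiesAbove p q)
    (h' : LiesAbove q r) : LiesAbove p r := by
  rw [liesAbove_iff] at *
  intro F
  rw [between_add p q r]
  exact add_nonneg (h F) (h' F)

end PastingScheme

/-! ### Pushing a path down over one face at a time -/

namespace PastingScheme
open PlaneGraph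

variable {P : PastingScheme}

/-- The dual graph of a pasting scheme has no directed cycles through interior faces. -/
theorem eq_zero_of_dual_cycle {φ : P.graph.E → ℤ} (h0 : ∀ e, 0 ≤ φ e)
    (hφ : ∀ g : P.graph.Face → ℝ, ∑ e, (φ e : ℝ) * (g (left e) - g (right e)) = 0)
    (hb : ∀ e, φ e ≠ 0 → Bornology.IsBounded (left e : P.graph.Face).1) :
    φ = 0 := by
  obtain ⟨ψ, hψ⟩ := exists_eq_sub_of_dual_cycle P.connected (φ := φ) fun g => by
    rw [← neg_zero, ← hφ g, ← Finset.sum_neg_distrib]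
    exact Finset.sum_congr rfl fun e _ => by ring
  have hmono : ∀ {x y : P.graph.V} (p : Quiver.Path x y), ψ x ≤ ψ y := by
    intro x y p
    induction p with
    | nil => exact le_rfl
    | cons p e ih =>
      obtain ⟨e, rfl, rfl⟩ := e
      have h1 := hψ e
      have h2 : (0 : ℝ) ≤ φ e := by exact_mod_cast h0 e
      linarith
  -- Edges of `dom` have the exterior on their left, so `φ` vanishes on them. Since `ψ` is monotone
  -- and every vertex lies on some path from `s` to `t`, it must then be constant.
  have hst : ψ P.t = ψ P.s := by
    refine (eq_of_forall_mem_edges P.dom fun e he => ?_).1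
    have h1 : φ e = 0 := by
      by_contra h
      exact (P.mem_dom_iff e).1 he (hb e h)
    have h2 := hψ e
    rw [h1, Int.cast_zero] at h2
    linarith
  have hconst : ∀ v, ψ v = ψ P.s := fun v => by
    obtain ⟨p⟩ := nonempty_path_from_s v
    obtain ⟨q⟩ := nonempty_path_to_t v
    exact le_antisymm ((hmono q).trans hst.le) (hmono p)
  funext e
  have h1 := hψ e
  rw [hconst (P.graph.tgt e), hconst (P.graph.src e), sub_self] at h1
  exact_mod_cast h1.symm

theorem exists_eq_comp_of_edges_subset {x y u w : P.graph.V} {p : Quiver.Path x y}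
    (d : Quiver.Path u w) (hu : u ∈ p.vertices) (h : ∀ e ∈ edges d, e ∈ edges p) :
    ∃ (p₁ : Quiver.Path x u) (p₂ : Quiver.Path w y), p = p₁.comp (d.comp p₂) := by
  induction d with
  | nil =>
    obtain ⟨p₁, p₂, h⟩ := Quiver.Path.exists_eq_comp_of_mem_vertices p hu
    exact ⟨p₁, p₂, by rw [h, Quiver.Path.nil_comp]⟩
  | cons d e ih =>
    obtain ⟨p₁, p₂, rfl⟩ := ih fun e he => h e (by simp [edges, he])
    obtain ⟨e, rfl, rfl⟩ := e
    have he := h e (by simp [edges])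
    rw [← Quiver.Path.comp_assoc] at he
    obtain ⟨r, p₃, rfl⟩ := exists_eq_comp_of_mem_edges (mem_edges_of_comp_right he rfl)
    obtain rfl := eq_nil_of_loop r
    refine ⟨p₁, p₃, ?_⟩
    congr 1
    rw [← Quiver.Path.comp_assoc]
    rfl

theorem between_self {x y : P.graph.V} (p : Quiver.Path x y) (F : P.graph.Face) :
    between p p F = 0 := by
  have := between_add p p p F
  omega

open Classical in
/-- Exactly one face lies between the two sides of that face. -/
theorem between_dom_cod {u w x y : P.graph.V} (p₁ : Quiver.Path x u) (c : P.graph.AnchoredFace u w)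
    (p₂ : Quiver.Path w y) (F : P.graph.Face) :
    between (p₁.comp (c.dom.comp p₂)) (p₁.comp (c.cod.comp p₂)) F =
      if F = c.toFace then 1 else 0 := by
  rw [between_comp, between_comp, between_self, between_self, zero_add, add_zero]
  refine congrFun (between_unique c.dom c.cod (D := fun F => if F = c.toFace then 1 else 0)
    (fun F hF => ?_) (chain_dom_sub_chain_cod c)) F
  rw [if_neg]
  rintro rfl
  exact hF c.isInteriorFace.2

theorem eq_of_between_eq_zero {x y : P.graph.V} {p q : Quiver.Path x y}
    (h : ∀ F, between p q F = 0) : p = q := by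
  refine path_eq_of_edges fun e => ?_
  rw [← chain_pos_iff, ← chain_pos_iff]
  have := between_right_sub_left p q e
  rw [h, h] at this
  rw [show chain p e = chain q e by omega]

/-- If `p` lies strictly above `q`, one can push `p` down over a face between `p` and `q`. -/
theorem exists_face_below {x y : P.graph.V} {p q : Quiver.Path x y} (h : ∀ F, 0 ≤ between p q F)
    (hne : p ≠ q) : ∃ (u w : P.graph.V) (p₁ : Quiver.Path x u) (c : P.graph.AnchoredFace u w)
      (p₂ : Quiver.Path w y), p = p₁.comp (c.dom.comp p₂) ∧ 0 < between p q c.toFace := by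
  -- This is an uppermost face between the paths. If there were none, one could move upwards among
  -- these faces forever, giving a directed dual cycle.
  obtain ⟨F, hF, hFe⟩ : ∃ F, 0 < between p q F ∧ ∀ e, right e = F → between p q (left e) = 0 := by
    by_contra hcon
    push Not at hcon
    have hM : {F | 0 < between p q F}.Nonempty := by
      by_contra hM
      refine hne (eq_of_between_eq_zero fun F => le_antisymm ?_ (h F))
      by_contra hF
      exact hM ⟨F, not_le.1 hF⟩
    obtain ⟨φ, h0, ⟨e, he⟩, hφM, hφ⟩ := exists_nonneg_circulation
      (right (G := P.graph)) left hM fun F hF => by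
        obtain ⟨e, he, hne⟩ := hcon F hF
        exact ⟨e, he, lt_of_le_of_ne (h _) hne.symm⟩
    rw [eq_zero_of_dual_cycle h0 hφ fun e he => by
      by_contra hb
      exact (hφM e he).2.ne' (between_eq_zero p q hb)] at he
    simp at he
  have hFb : Bornology.IsBounded F.1 := by
    by_contra hb
    exact hF.ne' (between_eq_zero p q hb)
  obtain ⟨u, w, c, rfl⟩ := exists_anchoredFace hFb
  -- Across an upper edge of the face the 2-chain jumps from zero to a positive value, which only an
  -- edge of `p` can cause.
  have hsub : ∀ e ∈ edges c.dom, e ∈ edges p := fun e he => by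
    have h1 := (mem_edges_dom c e).1 he
    have h2 := between_right_sub_left p q e
    rw [h1, hFe e h1] at h2
    rw [← chain_pos_iff]
    have := chain_nonneg q e
    omega
  obtain ⟨p₁, p₂, hp⟩ := exists_eq_comp_of_edges_subset c.dom (p := p) (by
    have hu : u ≠ w := by
      rintro rfl
      have := c.forms_dom.1
      rw [eq_nil_of_loop c.dom] at this
      simp at this
    obtain ⟨e, he, rfl⟩ := exists_src_eq c.dom.start_mem_vertices hu
    exact src_mem_vertices (hsub e he)) hsub
  exact ⟨u, w, p₁, c, p₂, hp, hF⟩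

open Classical in
theorem between_cod {x y u w : P.graph.V} (p₁ : Quiver.Path x u) (c : P.graph.AnchoredFace u w)
    (p₂ : Quiver.Path w y) (q : Quiver.Path x y) (F : P.graph.Face) :
    between (p₁.comp (c.cod.comp p₂)) q F =
      between (p₁.comp (c.dom.comp p₂)) q F - if F = c.toFace then 1 else 0 := by
  rw [between_add (p₁.comp (c.dom.comp p₂)) (p₁.comp (c.cod.comp p₂)) q F, between_dom_cod]
  omega

/-- Induction over the paths above `q`, by pushing paths down over single faces. -/
theorem induction_above {x y : P.graph.V} {q : Quiver.Path x y} {motive : Quiver.Path x y → Prop}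
    (base : motive q)
    (step : ∀ (u w : P.graph.V) (p₁ : Quiver.Path x u) (c : P.graph.AnchoredFace u w)
      (p₂ : Quiver.Path w y), (∀ F, 0 ≤ between (p₁.comp (c.cod.comp p₂)) q F) →
      motive (p₁.comp (c.cod.comp p₂)) → motive (p₁.comp (c.dom.comp p₂)))
    {p : Quiver.Path x y} (h : ∀ F, 0 ≤ between p q F) : motive p := by
  classical
  obtain ⟨n, hn⟩ : ∃ n : ℕ, ∑ F, between p q F = n :=
    Int.eq_ofNat_of_zero_le (Finset.sum_nonneg fun F _ => h F)
  induction n generalizing p with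
  | zero =>
    have := (Finset.sum_eq_zero_iff_of_nonneg fun F _ => h F).1 (by simpa using hn)
    rwa [eq_of_between_eq_zero fun F => this F (Finset.mem_univ F)]
  | succ n ih =>
    have hne : p ≠ q := by
      rintro rfl
      simp only [between_self, Finset.sum_const_zero] at hn
      omega
    obtain ⟨u, w, p₁, c, p₂, rfl, hc⟩ := exists_face_below h hne
    have h' : ∀ F, 0 ≤ between (p₁.comp (c.cod.comp p₂)) q F := fun F => by
      rw [between_cod]
      split_ifs with hF
      · subst hF; omega
      · have := h F; omega
    refine step u w p₁ c p₂ h' (ih h' ?_)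
    simp only [between_cod, Finset.sum_sub_distrib, hn, Finset.sum_ite_eq', Finset.mem_univ, if_true]
    push_cast
    ring

/-- A common vertex of `p` and `r` is on each path between them. -/
theorem LiesAbove.mem_vertices {x y v : P.graph.V} {p q r : Quiver.Path x y} (hpq : LiesAbove p q)
    (hqr : LiesAbove q r) (hp : v ∈ p.vertices) (hr : v ∈ r.vertices) : v ∈ q.vertices := by
  classical
  rw [liesAbove_iff] at hpq hqr
  refine induction_above (motive := fun p => v ∈ p.vertices → v ∈ q.vertices) (q := q) id ?_ hpq hp
  intro u w p₁ c p₂ h ih hv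
  apply ih
  simp only [Quiver.Path.mem_vertices_comp] at hv ⊢
  rcases hv with hv | hv | hv
  · exact Or.inl hv
  · by_cases hu : v = u
    · subst hu; exact Or.inl p₁.end_mem_vertices
    · by_cases hw : v = w
      · subst hw; exact Or.inr (Or.inr p₂.start_mem_vertices)
      · exfalso
        -- At an inner vertex of the upper side, the face meets both an incoming and an outgoing
        -- edge. As the vertex is also on `r`, the face is not between the upper path and `r`, yet
        -- it has just been pushed over.
        obtain ⟨a, ha, hav⟩ := exists_tgt_eq hv hu
        obtain ⟨b, hb, hbv⟩ := exists_src_eq hv hw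
        have h1 := between_eq_zero_of_mem (p := p₁.comp (c.dom.comp p₂)) (q := r)
          (by simp only [Quiver.Path.mem_vertices_comp]; tauto) hr hav hbv
          (Or.inr ((mem_edges_dom c a).1 ha)) (Or.inr ((mem_edges_dom c b).1 hb))
        have h2 := h c.toFace
        rw [between_cod, if_pos rfl] at h2
        have h3 := hqr c.toFace
        rw [between_add _ q] at h1
        omega
  · exact Or.inr (Or.inr hv)

end PastingScheme

/-! ### Normal forms and interchange in the free 2-category -/

namespace TwoComputad

variable {V : Type*} [Quiver V] {K : TwoComputad V}

namespace Term

/-- An atomic 2-cell whiskered by paths on both sides. -/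
def whisk {x u w y : V} (p₁ : Quiver.Path x u) (α : K.Cell u w) (p₂ : Quiver.Path w y) :
    K.Term (p₁.comp ((K.dom α).comp p₂)) (p₁.comp ((K.cod α).comp p₂)) :=
  (id p₁).hcomp ((atom α).hcomp (id p₂))

end Term

/-- Reassociating paths changes the type of a term; this transport keeps its class under the
heterogeneous relation. -/
theorem Rel.exists_cast {x y : V} {p q p' q' : Quiver.Path x y} (a : K.Term p q) (hp : p = p')
    (hq : q = q') : ∃ a' : K.Term p' q', Rel a a' := by
  subst hp hq
  exact ⟨a, .refl a⟩

theorem Rel.id_hcomp_whisk {x z u w y : V} (p : Quiver.Path x z) (p₁ : Quiver.Path z u)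
    (α : K.Cell u w) (p₂ : Quiver.Path w y) :
    Rel ((Term.id p).hcomp (Term.whisk p₁ α p₂)) (Term.whisk (p.comp p₁) α p₂) :=
  (Rel.hcomp_assoc _ _ _).symm.trans (.hcomp_congr (.id_hcomp_id _ _) (.refl _))

theorem Rel.whisk_hcomp_id {x u w y z : V} (p₁ : Quiver.Path x u) (α : K.Cell u w)
    (p₂ : Quiver.Path w y) (p : Quiver.Path y z) :
    Rel ((Term.whisk p₁ α p₂).hcomp (Term.id p)) (Term.whisk p₁ α (p₂.comp p)) :=
  (Rel.hcomp_assoc _ _ _).trans (.hcomp_congr (.refl _)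
    ((Rel.hcomp_assoc _ _ _).trans (.hcomp_congr (.refl _) (.id_hcomp_id _ _))))

/-- Each 2-cell of the free 2-category is an identity or begins with a whiskered atomic 2-cell. -/
theorem Term.eq_id_or_exists_whisk {x y : V} {p q : Quiver.Path x y} (a : K.Term p q) :
    Rel a (Term.id p) ∨ ∃ (u w : V) (p₁ : Quiver.Path x u) (α : K.Cell u w) (p₂ : Quiver.Path w y)
      (q' : Quiver.Path x y) (t : K.Term (p₁.comp ((K.cod α).comp p₂)) q'),
      Rel a ((Term.whisk p₁ α p₂).vcomp t) := by
  induction a with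
  | atom α =>
    refine Or.inr ⟨_, _, .nil, α, .nil, _, Term.id _, ?_⟩
    exact (((Rel.vcomp_id _).trans (Rel.nil_hcomp _)).trans (Rel.hcomp_nil _)).symm
  | id p => exact Or.inl (.refl _)
  | vcomp a b iha ihb =>
    rcases iha with ha | ⟨u, w, p₁, α, p₂, q', t, ha⟩
    · obtain ⟨-, rfl⟩ := ha.boundary
      have h1 : Rel (a.vcomp b) b := (Rel.vcomp_congr ha (.refl b)).trans (.id_vcomp b)
      rcases ihb with hb | ⟨u, w, p₁, α, p₂, q', t, hb⟩
      · exact Or.inl (h1.trans hb)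
      · exact Or.inr ⟨u, w, p₁, α, p₂, q', t, h1.trans hb⟩
    · obtain ⟨-, rfl⟩ := ha.boundary
      exact Or.inr ⟨u, w, p₁, α, p₂, _, t.vcomp b,
        (Rel.vcomp_congr ha (.refl b)).trans (.vcomp_assoc _ _ _)⟩
  | @hcomp x z y p q p' q' a b iha ihb =>
    rcases iha with ha | ⟨u, w, p₁, α, p₂, q₁, t, ha⟩
    · rcases ihb with hb | ⟨u, w, p₁, α, p₂, q₁, t, hb⟩
      · exact Or.inl ((Rel.hcomp_congr ha hb).trans (.id_hcomp_id _ _))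
      · obtain ⟨t', ht'⟩ := Rel.exists_cast ((Term.id p).hcomp t) (Quiver.Path.comp_assoc p p₁ _).symm rfl
        refine Or.inr ⟨u, w, p.comp p₁, α, p₂, _, t', ?_⟩
        exact (Rel.hcomp_congr (ha.trans (Rel.id_vcomp _).symm) hb).trans
          ((Rel.interchange _ _ _ _).symm.trans (.vcomp_congr (.id_hcomp_whisk _ _ _ _) ht'))
    · obtain ⟨t', ht'⟩ := Rel.exists_cast (t.hcomp b)
        (show _ = p₁.comp ((K.cod α).comp (p₂.comp p')) by simp only [Quiver.Path.comp_assoc]) rfl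
      refine Or.inr ⟨u, w, p₁, α, p₂.comp p', _, t', ?_⟩
      exact (Rel.hcomp_congr ha (Rel.id_vcomp b).symm).trans
        ((Rel.interchange _ _ _ _).symm.trans (.vcomp_congr (.whisk_hcomp_id _ _ _ _) ht'))

/-- Atomic 2-cells at disjoint places of a path commute. -/
theorem Rel.exists_whisk_vcomp {x u w u' w' y : V} (p₁ : Quiver.Path x u) (α : K.Cell u w)
    (m : Quiver.Path w u') (β : K.Cell u' w') (p₂ : Quiver.Path w' y) {q : Quiver.Path x y}
    (k : K.Term (p₁.comp ((K.cod α).comp (m.comp ((K.cod β).comp p₂)))) q) :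
    ∃ (t : K.Term (p₁.comp ((K.cod α).comp (m.comp ((K.dom β).comp p₂)))) q)
      (t' : K.Term ((p₁.comp ((K.dom α).comp m)).comp ((K.cod β).comp p₂)) q),
      Rel ((Term.whisk p₁ α (m.comp ((K.dom β).comp p₂))).vcomp t)
        ((Term.whisk (p₁.comp ((K.dom α).comp m)) β p₂).vcomp t') := by
  let B : K.Term (m.comp ((K.dom β).comp p₂)) (m.comp ((K.cod β).comp p₂)) := Term.whisk m β p₂
  obtain ⟨t', ht'⟩ := Rel.exists_cast ((Term.whisk p₁ α (m.comp ((K.cod β).comp p₂))).vcomp k)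
    (show _ = (p₁.comp ((K.dom α).comp m)).comp ((K.cod β).comp p₂) by
      simp only [Quiver.Path.comp_assoc]) rfl
  refine ⟨((Term.id p₁).hcomp ((Term.id (K.cod α)).hcomp B)).vcomp k, t', ?_⟩
  -- Both orders of the two cells are compared with the horizontal composite in which they act
  -- simultaneously.
  have h1 : Rel ((Term.whisk p₁ α (m.comp ((K.dom β).comp p₂))).vcomp
      ((Term.id p₁).hcomp ((Term.id (K.cod α)).hcomp B))) ((Term.id p₁).hcomp ((Term.atom α).hcomp B)) :=
    (Rel.interchange _ _ _ _).trans (.hcomp_congr (.id_vcomp _)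
      ((Rel.interchange _ _ _ _).trans (.hcomp_congr (.vcomp_id _) (.id_vcomp _))))
  have h2 : Rel (((Term.id p₁).hcomp ((Term.id (K.dom α)).hcomp B)).vcomp
      (Term.whisk p₁ α (m.comp ((K.cod β).comp p₂)))) ((Term.id p₁).hcomp ((Term.atom α).hcomp B)) :=
    (Rel.interchange _ _ _ _).trans (.hcomp_congr (.id_vcomp _)
      ((Rel.interchange _ _ _ _).trans (.hcomp_congr (.id_vcomp _) (.vcomp_id _))))
  have h3 : Rel ((Term.id p₁).hcomp ((Term.id (K.dom α)).hcomp B))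
      (Term.whisk (p₁.comp ((K.dom α).comp m)) β p₂) :=
    (Rel.hcomp_congr (.refl _) (.id_hcomp_whisk _ _ _ _)).trans (.id_hcomp_whisk _ _ _ _)
  exact (Rel.vcomp_assoc _ _ _).symm.trans ((Rel.vcomp_congr (h1.trans h2.symm) (.refl k)).trans
    ((Rel.vcomp_assoc _ _ _).trans (.vcomp_congr h3 ht')))

end TwoComputad

namespace PlaneGraph

variable {G : PlaneGraph}

theorem comp_eq_comp_of_disjoint_aux {x y u w u' w' : G.V} {d : Quiver.Path u w}
    {d' : Quiver.Path u' w'} (hd' : ∃ e, e ∈ edges d') (hdd : ∀ e, e ∈ edges d → e ∉ edges d')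
    {p₁ : Quiver.Path x u} {p₁' : Quiver.Path x u'}
    {p₂ : Quiver.Path w y} {p₂' : Quiver.Path w' y} {n : Quiver.Path u u'} (hn : p₁' = p₁.comp n)
    (h : d.comp p₂ = n.comp (d'.comp p₂')) :
    ∃ m : Quiver.Path w u', p₁' = p₁.comp (d.comp m) ∧ p₂ = m.comp (d'.comp p₂') := by
  rcases Quiver.Path.comp_eq_comp h with ⟨m, rfl, rfl⟩ | ⟨m, rfl, h2⟩
  · exact ⟨m, hn, rfl⟩
  · rcases Quiver.Path.comp_eq_comp h2 with ⟨m', rfl, rfl⟩ | ⟨m', rfl, rfl⟩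
    · obtain ⟨e, he⟩ := hd'
      exact absurd he (hdd e (by simp [edges_comp, he]))
    · cases m with
      | nil => exact ⟨.nil, hn, by simp⟩
      | cons m e => exact absurd (by simp [edges_comp, edges]) (hdd e.1 (by simp [edges_comp, edges]))

/-- Two subpaths of a path without common edges lie one behind the other. -/
theorem comp_eq_comp_of_disjoint {x y u w u' w' : G.V} {d : Quiver.Path u w}
    {d' : Quiver.Path u' w'} (hd : ∃ e, e ∈ edges d) (hd' : ∃ e, e ∈ edges d')
    (hdd : ∀ e, e ∈ edges d → e ∉ edges d') {p₁ : Quiver.Path x u} {p₁' : Quiver.Path x u'}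
    {p₂ : Quiver.Path w y} {p₂' : Quiver.Path w' y}
    (h : p₁.comp (d.comp p₂) = p₁'.comp (d'.comp p₂')) :
    (∃ m : Quiver.Path w u', p₁' = p₁.comp (d.comp m) ∧ p₂ = m.comp (d'.comp p₂')) ∨
      ∃ m : Quiver.Path w' u, p₁ = p₁'.comp (d'.comp m) ∧ p₂' = m.comp (d.comp p₂) := by
  rcases Quiver.Path.comp_eq_comp h with ⟨n, hn, h1⟩ | ⟨n, hn, h1⟩
  · exact Or.inl (comp_eq_comp_of_disjoint_aux hd' hdd hn h1)
  · exact Or.inr (comp_eq_comp_of_disjoint_aux hd (fun e he he' => hdd e he' he) hn h1)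

end PlaneGraph

/-! ### Parallel 2-cells of a pasting scheme are equal -/

namespace PastingScheme
open PlaneGraph TwoComputad

variable {P : PastingScheme}

/-- An atomic 2-cell sweeps its own face once, and `between` is additive under both compositions. -/
theorem between_nonneg_of_term {x y : P.graph.V} {p q : Quiver.Path x y} (a : P.computad.Term p q)
    (F : P.graph.Face) : 0 ≤ between p q F := by
  classical
  induction a with
  | @atom u w α =>
    have := between_dom_cod (P := P) .nil α .nil F
    simp only [Quiver.Path.nil_comp, Quiver.Path.comp_nil] at this
    refine le_of_le_of_eq ?_ this.symm
    split_ifs <;> simp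
  | id p => exact (between_self p F).ge
  | vcomp a b iha ihb => rw [between_add]; exact add_nonneg iha ihb
  | hcomp a b iha ihb => rw [between_comp]; exact add_nonneg iha ihb

/-- A path that lies above another can be pushed down to it over single faces. -/
theorem nonempty_term {x y : P.graph.V} {p q : Quiver.Path x y} (h : ∀ F, 0 ≤ between p q F) :
    Nonempty (P.computad.Term p q) :=
  induction_above (motive := fun p => Nonempty (P.computad.Term p q)) ⟨.id q⟩
    (fun _ _ p₁ c p₂ _ ⟨t⟩ => ⟨(Term.whisk (K := P.computad) p₁ c p₂).vcomp t⟩) h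

theorem _root_.PlaneGraph.AnchoredFace.ne {u w : P.graph.V} (c : P.graph.AnchoredFace u w) :
    u ≠ w := by
  rintro rfl
  have := c.forms_dom.1
  rw [eq_nil_of_loop c.dom] at this
  simp at this

/-- The boundary data of an anchored face are determined by the face. -/
theorem _root_.PlaneGraph.AnchoredFace.eq_of_toFace {u w u' w' : P.graph.V}
    {c : P.graph.AnchoredFace u w} {c' : P.graph.AnchoredFace u' w'} (h : c.toFace = c'.toFace) :
    u = u' ∧ w = w' ∧ HEq c c' := by
  have hd : ∀ e, e ∈ edges c.dom ↔ e ∈ edges c'.dom := fun e => by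
    rw [mem_edges_dom, mem_edges_dom, h]
  have hu : u = u' := by
    by_contra hne
    obtain ⟨e, he, rfl⟩ := exists_src_eq c.dom.start_mem_vertices c.ne
    obtain ⟨a, ha, hau⟩ := exists_tgt_eq (src_mem_vertices ((hd e).1 he)) hne
    exact tgt_ne_start ((hd a).2 ha) hau
  have hw : w = w' := by
    by_contra hne
    obtain ⟨e, he, rfl⟩ := exists_tgt_eq c.dom.end_mem_vertices c.ne.symm
    obtain ⟨a, ha, hau⟩ := exists_src_eq (tgt_mem_vertices ((hd e).1 he)) hne
    exact src_ne_end ((hd a).2 ha) hau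
  subst hu hw
  refine ⟨rfl, rfl, heq_of_eq ?_⟩
  have h1 : c.dom = c'.dom := path_eq_of_edges hd
  have h2 : c.cod = c'.cod := path_eq_of_edges fun e => by rw [mem_edges_cod, mem_edges_cod, h]
  have h3 : c.face = c'.face := congrArg Subtype.val h
  cases c
  cases c'
  cases h1
  cases h2
  cases h3
  rfl

theorem sum_between_cod {x y u w : P.graph.V} (p₁ : Quiver.Path x u) (c : P.graph.AnchoredFace u w)
    (p₂ : Quiver.Path w y) (q : Quiver.Path x y) :
    ∑ F, between (p₁.comp (c.cod.comp p₂)) q F =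
      ∑ F, between (p₁.comp (c.dom.comp p₂)) q F - 1 := by
  classical
  simp only [between_cod, Finset.sum_sub_distrib, Finset.sum_ite_eq', Finset.mem_univ, if_true]

/-- Coherence at two first steps, given coherence below. -/
theorem rel_of_disjoint {x y u w u' w' : P.graph.V} {p₁ : Quiver.Path x u}
    {α : P.graph.AnchoredFace u w} {m : Quiver.Path w u'} {β : P.graph.AnchoredFace u' w'}
    {p₂ : Quiver.Path w' y} {q : Quiver.Path x y} (hne : α.toFace ≠ β.toFace)
    (ih : ∀ (p' : Quiver.Path x y), ∑ F, between p' q F + 1 =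
      ∑ F, between (p₁.comp (α.dom.comp (m.comp (β.dom.comp p₂)))) q F →
      ∀ a b : P.computad.Term p' q, Rel a b)
    (t : P.computad.Term (p₁.comp (α.cod.comp (m.comp (β.dom.comp p₂)))) q)
    (t' : P.computad.Term ((p₁.comp (α.dom.comp m)).comp (β.cod.comp p₂)) q) :
    Rel ((Term.whisk (K := P.computad) p₁ α (m.comp (β.dom.comp p₂))).vcomp t)
      ((Term.whisk (K := P.computad) (p₁.comp (α.dom.comp m)) β p₂).vcomp t') := by
  classical
  have e1 : ∀ r : Quiver.Path u' y, (p₁.comp (α.dom.comp m)).comp r =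
      p₁.comp (α.dom.comp (m.comp r)) := fun r => by simp only [Quiver.Path.comp_assoc]
  have e2 : ∀ r : Quiver.Path u' y, (p₁.comp (α.cod.comp m)).comp r =
      p₁.comp (α.cod.comp (m.comp r)) := fun r => by simp only [Quiver.Path.comp_assoc]
  -- Both faces lie between the path and `q`, and they are different. Pushing over both therefore
  -- leaves a non-negative 2-chain, so a 2-cell completing the diamond exists.
  obtain ⟨k⟩ : Nonempty (P.computad.Term
      (p₁.comp (α.cod.comp (m.comp (β.cod.comp p₂)))) q) := by
    refine nonempty_term fun F => ?_
    have h1 := between_nonneg_of_term t F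
    have h2 := between_nonneg_of_term t' F
    rw [between_cod, e1] at h2
    rw [between_cod] at h1
    rw [← e2, between_cod, e2, between_cod]
    split_ifs at * with h3 h4 <;> first | omega | exact absurd (h4.symm.trans h3) hne.symm
  obtain ⟨s, s', h⟩ := Rel.exists_whisk_vcomp (K := P.computad) p₁ α m β p₂ k
  have h1 : Rel t s := ih _ (by rw [sum_between_cod]; ring) t s
  have h2 : Rel t' s' := ih _ (by rw [sum_between_cod, e1]; ring) t' s'
  exact (Rel.vcomp_congr (.refl _) h1).trans (h.trans (.vcomp_congr (.refl _) h2.symm))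

/-- Parallel 2-cells in the free 2-category of a pasting scheme are equal. -/
theorem rel_of_parallel {x y : P.graph.V} {p q : Quiver.Path x y} (a b : P.computad.Term p q) :
    Rel a b := by
  classical
  -- The induction is on the number of faces swept, which every 2-cell from `p` to `q` shares and
  -- each whiskered atomic cell lowers by one.
  obtain ⟨n, hn⟩ : ∃ n : ℕ, ∑ F, between p q F = n :=
    Int.eq_ofNat_of_zero_le (Finset.sum_nonneg fun F _ => between_nonneg_of_term a F)
  induction n generalizing p with
  | zero =>
    have key : ∀ a : P.computad.Term p q, Rel a (Term.id p) := fun a => by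
      rcases a.eq_id_or_exists_whisk with ha | ⟨u, w, p₁, α, p₂, q', t, ha⟩
      · exact ha
      · obtain ⟨rfl, rfl⟩ := ha.boundary
        have h1 := sum_between_cod p₁ α p₂ q
        have h2 : 0 ≤ ∑ F, between (p₁.comp (α.cod.comp p₂)) q F :=
          Finset.sum_nonneg fun F _ => between_nonneg_of_term t F
        have h3 : ∑ F, between (p₁.comp (α.dom.comp p₂)) q F = 0 := hn
        omega
    exact (key a).trans (key b).symm
  | succ n ih =>
    have key : ∀ a : P.computad.Term p q, ¬ Rel a (Term.id p) := fun a ha => by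
      obtain ⟨-, rfl⟩ := ha.boundary
      simp only [between_self, Finset.sum_const_zero] at hn
      omega
    obtain ⟨u, w, p₁, α, p₂, q₁, t, ha⟩ := a.eq_id_or_exists_whisk.resolve_left (key a)
    obtain ⟨u', w', p₁', β, p₂', q₂, t', hb⟩ := b.eq_id_or_exists_whisk.resolve_left (key b)
    obtain ⟨hp, rfl⟩ := ha.boundary
    obtain ⟨hp', rfl⟩ := hb.boundary
    refine ha.trans (Rel.trans ?_ hb.symm)
    clear ha hb key a b
    change P.graph.AnchoredFace u w at α
    change P.graph.AnchoredFace u' w' at β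
    change p = p₁.comp (α.dom.comp p₂) at hp
    change p = p₁'.comp (β.dom.comp p₂') at hp'
    have ih' : ∀ (p' : Quiver.Path x y), ∑ F, between p' q F + 1 = ∑ F, between p q F →
        ∀ a b : P.computad.Term p' q, Rel a b := fun p' h a b => ih a b (by rw [hn] at h; push_cast at h; omega)
    -- Equal first faces sit at the same place of `p` by acyclicity. Different ones have disjoint
    -- upper sides, because an edge has only one face on its right.
    by_cases hF : α.toFace = β.toFace
    · obtain ⟨rfl, rfl, h⟩ := AnchoredFace.eq_of_toFace hF
      obtain rfl := eq_of_heq h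
      obtain ⟨rfl, h1⟩ := comp_inj (hp.symm.trans hp')
      obtain ⟨-, rfl⟩ := comp_inj h1
      refine .vcomp_congr (.refl _) (ih' _ ?_ t t')
      change ∑ F, between (p₁.comp (α.cod.comp p₂)) q F + 1 = _
      rw [sum_between_cod, hp]
      ring
    · rcases comp_eq_comp_of_disjoint (edges_ne_nil α.forms_dom.1) (edges_ne_nil β.forms_dom.1)
        (fun e he he' => hF (((mem_edges_dom α e).1 he).symm.trans ((mem_edges_dom β e).1 he')))
        (hp.symm.trans hp') with ⟨m, rfl, rfl⟩ | ⟨m, rfl, rfl⟩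
      · exact rel_of_disjoint hF (hp ▸ ih') t t'
      · exact (rel_of_disjoint (Ne.symm hF) (hp' ▸ ih') t' t).symm

instance {x y : P.graph.V} (p q : Quiver.Path x y) : Subsingleton (P.computad.TwoCell p q) where
  allEq a b := by
    obtain ⟨a, rfl⟩ := TwoCell.exists_rep a
    obtain ⟨b, rfl⟩ := TwoCell.exists_rep b
    exact TwoCell.mk_eq (rel_of_parallel a b)

/-- Together with uniqueness of parallel 2-cells, this turns chains of 2-cells into descending
chains of paths. -/
theorem nonempty_twoCell_iff {x y : P.graph.V} {p q : Quiver.Path x y} :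
    Nonempty (P.computad.TwoCell p q) ↔ LiesAbove p q := by
  rw [liesAbove_iff]
  constructor
  · rintro ⟨a⟩
    obtain ⟨a, rfl⟩ := TwoCell.exists_rep a
    exact between_nonneg_of_term a
  · intro h
    exact (nonempty_term h).map TwoCell.mk

end PastingScheme

/-! ### Unique factorization of chains into atomic arrows -/

namespace PastingScheme
open PlaneGraph TwoComputad

variable {P : PastingScheme} {n : ℕ}

/-- The vertex underlying an object of the category of `n`-arrows. -/
def vertex (a : ArrowCat P.SimplicialCat n) : P.graph.V := a.as.as.as

theorem vertex_injective : Function.Injective (vertex : ArrowCat P.SimplicialCat n → P.graph.V) :=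
  fun _ _ h => congrArg (fun v => (⟨P.vertexObj v⟩ : ArrowCat P.SimplicialCat n)) h

/-- The chain of paths underlying an `n`-arrow. -/
def arrowPath {a b : ArrowCat P.SimplicialCat n} (f : a ⟶ b) (i : Fin (n + 1)) :
    Quiver.Path (vertex a) (vertex b) :=
  Functor.obj (C := Fin (n + 1)) (D := P.computad.OneCell (vertex a) (vertex b)) f i

theorem arrowPath_comp {a b c : ArrowCat P.SimplicialCat n} (f : a ⟶ b) (g : b ⟶ c)
    (i : Fin (n + 1)) : arrowPath (f ≫ g) i = (arrowPath f i).comp (arrowPath g i) := rfl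

/-- The 2-cells of a chain carry no information beyond their boundary paths. -/
theorem arrow_ext {a b : ArrowCat P.SimplicialCat n} {f g : a ⟶ b}
    (h : ∀ i, arrowPath f i = arrowPath g i) : f = g :=
  CategoryTheory.Functor.ext (C := Fin (n + 1)) (D := P.computad.OneCell (vertex a) (vertex b)) h
    fun _ _ _ => Subsingleton.elim (α := P.computad.TwoCell _ _) _ _

theorem liesAbove_arrowPath {a b : ArrowCat P.SimplicialCat n} (f : a ⟶ b) {i j : Fin (n + 1)}
    (h : i ≤ j) : LiesAbove (arrowPath f i) (arrowPath f j) :=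
  nonempty_twoCell_iff.1 ⟨CategoryTheory.Functor.map (C := Fin (n + 1))
    (D := P.computad.OneCell (vertex a) (vertex b)) f (homOfLE h)⟩

theorem exists_arrow (a b : ArrowCat P.SimplicialCat n)
    {p : Fin (n + 1) → Quiver.Path (vertex a) (vertex b)}
    (h : ∀ i j, i ≤ j → LiesAbove (p i) (p j)) : ∃ f : a ⟶ b, ∀ i, arrowPath f i = p i :=
  ⟨({ obj := p
      map := fun {i j} g => (nonempty_twoCell_iff.2 (h i j (leOfHom g))).some
      map_id := fun _ => Subsingleton.elim (α := P.computad.TwoCell _ _) _ _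
      map_comp := fun _ _ => Subsingleton.elim (α := P.computad.TwoCell _ _) _ _ } :
    Fin (n + 1) ⥤ P.computad.OneCell (vertex a) (vertex b)), fun _ => rfl⟩

theorem liesAbove_of_succ {x y : P.graph.V} {p : Fin (n + 1) → Quiver.Path x y}
    (h : ∀ i : Fin n, LiesAbove (p i.castSucc) (p i.succ)) {i j : Fin (n + 1)} (hij : i ≤ j) :
    LiesAbove (p i) (p j) := by
  let _ : Preorder (Quiver.Path x y) :=
    { le := fun q q' => LiesAbove q' q
      le_refl := fun q => liesAbove_iff.2 fun F => (between_self q F).ge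
      le_trans := fun _ _ _ h h' => h'.trans h }
  exact (Fin.antitone_iff_succ_le (f := p)).2 h hij

variable (P n) in
/-- The `n`-arrows `p₀ ≥ ⋯ ≥ pₙ` between distinct vertices such that `p₀` and `pₙ` meet only at the
ends. -/
def atomicArrows : WideSubquiver (ArrowCat P.SimplicialCat n) := fun a b =>
  {f | vertex a ≠ vertex b ∧ ∀ v, v ∈ (arrowPath f 0).vertices →
    v ∈ (arrowPath f (Fin.last n)).vertices → v = vertex a ∨ v = vertex b}

/-- An arrow can be split at each common vertex of its first and its last path. -/
theorem exists_eq_comp_of_mem {a b : ArrowCat P.SimplicialCat n} (f : a ⟶ b) {v : P.graph.V}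
    (h0 : v ∈ (arrowPath f 0).vertices) (hn : v ∈ (arrowPath f (Fin.last n)).vertices) :
    ∃ (g : a ⟶ ⟨P.vertexObj v⟩) (h : (⟨P.vertexObj v⟩ : ArrowCat P.SimplicialCat n) ⟶ b),
      g ≫ h = f := by
  have hv : ∀ i, v ∈ (arrowPath f i).vertices := fun i =>
    (liesAbove_arrowPath f (Fin.zero_le i)).mem_vertices (liesAbove_arrowPath f (Fin.le_last i)) h0 hn
  choose p q hpq using fun i => Quiver.Path.exists_eq_comp_of_mem_vertices _ (hv i)
  have hl : ∀ i j, i ≤ j → LiesAbove (p i) (p j) ∧ LiesAbove (q i) (q j) := fun i j hij => by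
    have := liesAbove_arrowPath f hij
    rw [hpq i, hpq j] at this
    exact this.of_comp
  obtain ⟨g, hg⟩ := exists_arrow a ⟨P.vertexObj v⟩ (p := p) fun i j hij => (hl i j hij).1
  obtain ⟨h, hh⟩ := exists_arrow ⟨P.vertexObj v⟩ b (p := q) fun i j hij => (hl i j hij).2
  exact ⟨g, h, arrow_ext fun i => by rw [arrowPath_comp, hg, hh, hpq i]; rfl⟩

theorem length_pos_of_ne {x y : P.graph.V} (p : Quiver.Path x y) (h : x ≠ y) : 0 < p.length := by
  cases p with
  | nil => exact absurd rfl h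
  | cons p e => simp

theorem exists_path_of_arrow {a b : ArrowCat P.SimplicialCat n} (f : a ⟶ b) :
    ∃ p : Quiver.Path (V := WideSubquiver.toType _ (atomicArrows P n)) a b,
      (Paths.lift (WideSubquiver.incl (atomicArrows P n))).map p = f := by
  -- A non-atomic arrow between distinct vertices splits at an inner common vertex, and both factors
  -- have a strictly shorter first path.
  induction hk : (arrowPath f 0).length using Nat.strong_induction_on generalizing a b with
  | h k ih =>
    by_cases hab : vertex a = vertex b
    · obtain rfl := vertex_injective hab
      refine ⟨.nil, arrow_ext fun i => ?_⟩
      exact (eq_nil_of_loop _).trans (eq_nil_of_loop _).symm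
    · by_cases hf : f ∈ atomicArrows P n a b
      · exact ⟨Quiver.Hom.toPath (V := WideSubquiver.toType _ (atomicArrows P n)) ⟨f, hf⟩,
          Paths.lift_toPath _ _⟩
      · obtain ⟨v, h0, hn, hva, hvb⟩ : ∃ v, v ∈ (arrowPath f 0).vertices ∧
            v ∈ (arrowPath f (Fin.last n)).vertices ∧ v ≠ vertex a ∧ v ≠ vertex b := by
          by_contra hcon
          push Not at hcon
          exact hf ⟨hab, fun v h0 hn => or_iff_not_imp_left.2 (hcon v h0 hn)⟩
        obtain ⟨g, h, rfl⟩ := exists_eq_comp_of_mem f h0 hn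
        rw [arrowPath_comp, Quiver.Path.length_comp] at hk
        have h1 := length_pos_of_ne (arrowPath g 0) hva.symm
        have h2 := length_pos_of_ne (arrowPath h 0) hvb
        obtain ⟨p, hp⟩ := ih _ (by omega) g rfl
        obtain ⟨q, hq⟩ := ih _ (by omega) h rfl
        exact ⟨p.comp q, by exact (Functor.map_comp _ _ _).trans (by rw [hp, hq]; rfl)⟩

/-- The last factor of a decomposition into atomic arrows is determined. -/
theorem vertex_eq_of_comp_eq {a b b' c : ArrowCat P.SimplicialCat n} {f : a ⟶ b} {f' : a ⟶ b'}
    {s : b ⟶ c} {s' : b' ⟶ c} (hs : s ∈ atomicArrows P n b c) (hs' : s' ∈ atomicArrows P n b' c)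
    (h : f ≫ s = f' ≫ s') : b = b' := by
  have hi : ∀ i, (arrowPath f i).comp (arrowPath s i) = (arrowPath f' i).comp (arrowPath s' i) :=
    fun i => by rw [← arrowPath_comp, h, arrowPath_comp]
  refine vertex_injective ?_
  -- If the two cuts come in the same order on the first and the last path, the later cut is a
  -- common vertex of an atomic factor, hence one of its ends. If the orders differ, the connecting
  -- paths run both ways and acyclicity applies.
  rcases Quiver.Path.comp_eq_comp (hi 0) with ⟨m, -, h0⟩ | ⟨m, -, h0⟩ <;>
  rcases Quiver.Path.comp_eq_comp (hi (Fin.last n)) with ⟨m', -, hn⟩ | ⟨m', -, hn⟩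
  · refine ((hs.2 (vertex b') ?_ ?_).resolve_right hs'.1).symm <;>
    · simp only [h0, hn, Quiver.Path.mem_vertices_comp]
      exact Or.inl (Quiver.Path.end_mem_vertices _)
  · exact eq_of_paths m m'
  · exact eq_of_paths m' m
  · refine (hs'.2 (vertex b) ?_ ?_).resolve_right hs.1 <;>
    · simp only [h0, hn, Quiver.Path.mem_vertices_comp]
      exact Or.inl (Quiver.Path.end_mem_vertices _)

theorem path_of_arrow_unique {a b : ArrowCat P.SimplicialCat n}
    {p q : Quiver.Path (V := WideSubquiver.toType _ (atomicArrows P n)) a b}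
    (h : (Paths.lift (WideSubquiver.incl (atomicArrows P n))).map p =
      (Paths.lift (WideSubquiver.incl (atomicArrows P n))).map q) : p = q := by
  have nil_ne : ∀ {a c : ArrowCat P.SimplicialCat n} (f : a ⟶ c) (s : c ⟶ a),
      s ∉ atomicArrows P n c a := fun f s hs => hs.1 (eq_of_paths (arrowPath s 0) (arrowPath f 0))
  induction p with
  | nil =>
    cases q with
    | nil => rfl
    | cons q s => exact absurd s.2 (nil_ne ((Paths.lift (WideSubquiver.incl _)).map q) s.1)
  | @cons b c p s ih =>
    cases q with
    | nil => exact absurd s.2 (nil_ne ((Paths.lift (WideSubquiver.incl _)).map p) s.1)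
    | @cons b' _ q s' =>
      replace h : (Paths.lift (WideSubquiver.incl (atomicArrows P n))).map p ≫ s.1 =
        (Paths.lift (WideSubquiver.incl (atomicArrows P n))).map q ≫ s'.1 := h
      obtain rfl : b = b' := vertex_eq_of_comp_eq s.2 s'.2 h
      have hi := fun i => comp_inj (congrArg (fun f => arrowPath f i) h)
      obtain rfl := ih (q := q) (arrow_ext fun i => (hi i).1)
      obtain rfl : s = s' := Subtype.ext (arrow_ext fun i => (hi i).2)
      rfl

theorem isFreeOn_atomicArrows : IsFreeOn (atomicArrows P n) := fun _ _ =>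
  ⟨fun _ _ => path_of_arrow_unique, exists_path_of_arrow⟩

theorem isSimplicialComputad : IsSimplicialComputad P.SimplicialCat (atomicArrows P) where
  free n := isFreeOn_atomicArrows
  degeneracy {m n} σ hσ x y f hf := by
    -- A surjective monotone map preserves the least and the greatest element, so the degenerate
    -- chain has the same first and last path.
    have hs := SimplexCategory.epi_iff_surjective.1 hσ
    have h0 : σ.toOrderHom 0 = 0 := by
      obtain ⟨i, hi⟩ := hs 0
      exact le_antisymm (hi ▸ σ.toOrderHom.monotone (Fin.zero_le i)) (Fin.zero_le _)
    have hl : σ.toOrderHom (Fin.last m) = Fin.last n := by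
      obtain ⟨i, hi⟩ := hs (Fin.last n)
      exact le_antisymm (Fin.le_last _) (hi ▸ σ.toOrderHom.monotone (Fin.le_last i))
    refine ⟨hf.1, fun v hv hv' => hf.2 v ?_ ?_⟩
    · rw [← h0]; exact hv
    · rw [← hl]; exact hv'

/-- In dimension 0 the first and last path coincide, so an atomic arrow is a path with no inner
vertices, which by acyclicity is a single edge. -/
theorem bijOn_edgeArrow (x y : P.graph.V) :
    Set.BijOn (fun e : x ⟶ y => edgeArrow e) Set.univ
      (atomicArrows P 0 ⟨P.vertexObj x⟩ ⟨P.vertexObj y⟩) := by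
  have hpath : ∀ e : x ⟶ y, (edgeArrow e).path 0 = e.toPath := fun e => rfl
  refine ⟨fun e _ => ⟨?_, fun v hv _ => ?_⟩, fun e _ e' _ h => ?_, fun f hf => ?_⟩
  · obtain ⟨e, rfl, rfl⟩ := e
    exact (tgt_ne_src e).symm
  · have hv : v ∈ e.toPath.vertices := hv
    rw [Quiver.Hom.toPath, Quiver.Path.mem_vertices_cons, Quiver.Path.vertices_nil,
      List.mem_singleton] at hv
    exact hv
  · have h1 : e.toPath = e'.toPath := congrArg (fun f : P.NArrow 0 x y => f.path 0) h
    exact eq_of_heq (Quiver.Path.hom_heq_of_cons_eq_cons h1)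
  · obtain ⟨hxy, hf⟩ := hf
    obtain ⟨e, he⟩ : ∃ e : x ⟶ y, NArrow.path f 0 = e.toPath := by
      have hv : ∀ v, v ∈ (NArrow.path f 0).vertices → v = x ∨ v = y := fun v hv => hf v hv hv
      generalize NArrow.path f 0 = p at hv
      cases p with
      | nil => exact absurd rfl hxy
      | @cons b _ p e =>
        rcases hv b (by rw [Quiver.Path.mem_vertices_cons]; exact Or.inl p.end_mem_vertices)
          with rfl | rfl
        · exact ⟨e, by rw [eq_nil_of_loop p]; rfl⟩
        · obtain ⟨e, h1, h2⟩ := e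
          exact absurd (h2.trans h1.symm) (tgt_ne_src e)
    refine ⟨e, trivial, arrow_ext fun i => ?_⟩
    rw [Fin.fin_one_eq_zero i]
    exact he.symm

theorem bijOn_path (n : ℕ) (x y : P.graph.V) :
    Set.BijOn (fun (f : P.NArrow n x y) (i : Fin (n + 1)) => f.path i)
      (atomicArrows P n ⟨P.vertexObj x⟩ ⟨P.vertexObj y⟩)
      {p : Fin (n + 1) → Quiver.Path x y |
        x ≠ y ∧
        (∀ i : Fin n, LiesAbove (p i.castSucc) (p i.succ)) ∧
        ∀ v, v ∈ (p 0).vertices → v ∈ (p (Fin.last n)).vertices → v = x ∨ v = y} := by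
  refine ⟨fun f hf => ⟨hf.1, fun i => ?_, hf.2⟩, fun f _ g _ h => arrow_ext (congrFun h),
    fun p hp => ?_⟩
  · exact liesAbove_arrowPath (a := ⟨P.vertexObj x⟩) (b := ⟨P.vertexObj y⟩) f
      (Fin.castSucc_lt_succ (i := i)).le
  · obtain ⟨f, hf⟩ := exists_arrow (⟨P.vertexObj x⟩ : ArrowCat P.SimplicialCat n)
      ⟨P.vertexObj y⟩ (p := p) fun i j hij => liesAbove_of_succ hp.2.1 hij
    refine ⟨f, ⟨hp.1, ?_⟩, funext hf⟩
    rw [hf, hf]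
    exact hp.2.2

end PastingScheme

theorem mainTheorem7 (P : PastingScheme) :
    Function.Bijective P.vertexObj ∧
    ∃ atomic : ∀ n : ℕ, WideSubquiver (ArrowCat P.SimplicialCat n),
      IsSimplicialComputad P.SimplicialCat atomic ∧
      (∀ x y : P.graph.V,
        Set.BijOn (fun e : x ⟶ y => PastingScheme.edgeArrow e) Set.univ
          (atomic 0 ⟨P.vertexObj x⟩ ⟨P.vertexObj y⟩)) ∧
      (∀ (n : ℕ) (x y : P.graph.V),
        Set.BijOn (fun (f : P.NArrow n x y) (i : Fin (n + 1)) => f.path i)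
          (atomic n ⟨P.vertexObj x⟩ ⟨P.vertexObj y⟩)
          {p : Fin (n + 1) → Quiver.Path x y |
            x ≠ y ∧
            (∀ i : Fin n, PastingScheme.LiesAbove (p i.castSucc) (p i.succ)) ∧
            ∀ v, v ∈ (p 0).vertices → v ∈ (p (Fin.last n)).vertices → v = x ∨ v = y}) :=
  ⟨⟨fun _ _ h => congrArg (fun a => a.as.as) h, fun a => ⟨a.as.as, rfl⟩⟩,
    PastingScheme.atomicArrows P, PastingScheme.isSimplicialComputad,
    PastingScheme.bijOn_edgeArrow, PastingScheme.bijOn_path⟩
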